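/- Let $0<\alpha<\beta<1$, $\mu>0$, $c_\varphi>0$, $c_\nu>0$. Let $\varphi:\mathbb R\to[0,\infty)$ be a Borel function vanishing on $(-\infty,0)$ with $\int_0^\infty\varphi(t)\,dt=1$ and $\lim_{t\to\infty}t^{\alpha}\int_t^\infty\varphi(s)\,ds=c_\varphi$. Let $\nu$ be a probability measure on $\mathbb R_+=[0,\infty)$ with $\int x\,\nu(dx)=1$ and $\lim_{x\to\infty}x^{1+\beta}\nu((x,\infty))=c_\nu$. Consider the critical marked Hawkes process with constant exogenous intensity $\mu$, kernel $x\varphi(t)$ and i.i.d. marks of law $\nu$, given as the following branching system. Exogenous particles arrive at the points of a Poisson random measure on $\mathbb R_+$ with intensity $\mu\,dt$. Each particle (exogenous or not) carries a mark with law $\nu$; a particle at time $t$ with mark $x$ has a Poisson($x$) number of children, located at the times $t+\xi$, where the displacements $\xi$ have density $\varphi$. The arrivals, the pairs (mark, number of children) of the particles, and all displacements are independent. Let $N$ be the random point measure on $\mathbb R_+$ of the times of all particles of all generations, and write $\langle N,g\rangle=\int_0^\infty g(t)\,N(dt)$. For $T\ge1$ put $$F_T=T^{\frac{1+\alpha(2+\beta)}{1+\beta}},\qquad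 f_T(t)=\frac1{F_T}f\Big(\frac tT\Big),\qquad \langle X_T,f\rangle=\langle N,f_T\rangle-E\langle N,f_T\rangle .$$ Further let $$G^{(\alpha)}f(t)=\int_0^\infty f(t+s)s^{\alpha-1}\,ds,\qquad c_\alpha=\frac1{c_\varphi\Gamma(1+\alpha)\Gamma(1-\alpha)},\qquad K=\frac{c_\nu}{\beta}\Gamma(1-\beta)\,c_\alpha^{2+\beta}\alpha^{1+\beta}.$$ **Proposition.** Let $\gamma>\frac{2+\beta}{1+\beta}(1+\alpha)$ and let $f:\mathbb R_+\to[0,\infty)$ have at most finitely many points of discontinuity and satisfy $f(s)\le C(1+s)^{-\gamma}$ for all $s\ge0$, with some constant $C>0$. Then for every $T\ge 1$ the variable $\langle N,f_T\rangle$ is almost surely finite and integrable and $E\exp(-\langle X_T,f\rangle)<\infty$; the integrals $G^{(\alpha)}f(t)$, $t\ge0$, and $\int_0^\infty (G^{(\alpha)}f(t))^{1+\beta}t^\alpha\,dt$ are finite; and $$\lim_{T\to\infty}E\exp(-\langle X_T,f\rangle)=\exp\Big\{\mu K\int_0^\infty\big(G^{(\alpha)}f(t)\big)^{1+\beta}t^{\alpha}\,dt\Big\}.$$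 -/

import Mathlib

open MeasureTheory ProbabilityTheory Filter Topology Set
open scoped NNReal ENNReal

noncomputable section

namespace MarkedHawkes

/-- The Poisson law on `ℕ` as a Markov kernel in its parameter `x ≥ 0`. -/
def poissonOffspring : Kernel ℝ≥0 ℕ where
  toFun := poissonMeasure
  measurable' := by
    refine Measure.measurable_of_measurable_coe _ fun s hs => ?_
    have h : ∀ r : ℝ≥0, poissonMeasure r s = ∑' n : ℕ,
        ENNReal.ofReal (Real.exp (-r) * (r : ℝ) ^ n / (n.factorial : ℝ)) *
          s.indicator 1 n := by
      intro r
      rw [poissonMeasure, Measure.sum_apply _ hs]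
      refine tsum_congr fun n => ?_
      rw [Measure.smul_apply, Measure.dirac_apply' _ hs, smul_eq_mul]
    simp_rw [h]
    refine Measurable.tsum fun n => Measurable.mul_const ?_ _
    fun_prop

instance : IsMarkovKernel poissonOffspring :=
  ⟨fun r => inferInstanceAs (IsProbabilityMeasure (poissonMeasure r))⟩

/-- `Q` is a Poisson random measure on `E` with intensity measure `Λ`: the number of points in a
measurable set `A` of finite intensity is Poisson with parameter `Λ A`, and the numbers of points
in pairwise disjoint measurable sets are independent. -/
structure IsPoissonRandomMeasure {Ω E : Type*} [MeasurableSpace Ω] [MeasurableSpace E]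
    (Q : Ω → Measure E) (Λ : Measure E) (P : Measure Ω) : Prop where
  measurable : Measurable Q
  law : ∀ A : Set E, MeasurableSet A → Λ A ≠ ∞ →
    HasLaw (fun ω => Q ω A) ((poissonMeasure (Λ A).toNNReal).map (Nat.cast : ℕ → ℝ≥0∞)) P
  indep : ∀ (n : ℕ) (A : Fin n → Set E), (∀ i, MeasurableSet (A i)) →
    Pairwise (Function.onFun Disjoint A) → iIndepFun (fun i ω => Q ω (A i)) P

/-- Labels of potential particles: `(j, [])` is the `j`-th exogenous particle, and `(j, k :: l)` is
the child number `k` (counted from `0`) of the particle `(j, l)`. -/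
abbrev Label := ℕ × List ℕ

/-- The random variables from which the branching system is built. -/
structure Ingredients (Ω : Type*) where
  /-- arrival time of the `j`-th exogenous particle -/
  arrival : ℕ → Ω → ℝ
  /-- displacement of a particle from its parent (not used for exogenous particles) -/
  displacement : Label → Ω → ℝ
  /-- mark of a particle -/
  mark : Label → Ω → ℝ≥0
  /-- number of children of a particle -/
  offspring : Label → Ω → ℕ

namespace Ingredients

variable {Ω : Type*}

/-- A particle is present if it is exogenous, or if its parent is present and has enough
children. -/
def Present (S : Ingredients Ω) (ω : Ω) (j : ℕ) : List ℕ → Prop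
  | [] => True
  | k :: l => S.Present ω j l ∧ k < S.offspring (j, l) ω

/-- The time of a particle: its arrival time if it is exogenous, and otherwise the time of its
parent plus its displacement. -/
def time (S : Ingredients Ω) (ω : Ω) (j : ℕ) : List ℕ → ℝ
  | [] => S.arrival j ω
  | k :: l => S.time ω j l + S.displacement (j, k :: l) ω

open Classical in
/-- The empirical measure `M` of the times and marks of all particles of all generations. -/
def M (S : Ingredients Ω) (ω : Ω) : Measure (ℝ × ℝ≥0) :=
  Measure.sum fun u : Label =>
    if S.Present ω u.1 u.2 then Measure.dirac (S.time ω u.1 u.2, S.mark u ω) else 0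

/-- The random point measure `N(B) = M(B × ℝ₊)` of the event times. -/
def N (S : Ingredients Ω) (ω : Ω) : Measure ℝ := (S.M ω).map Prod.fst

/-- `⟨N, f⟩ = ∫₀^∞ f(t) N(dt)`; the point `0` is included. -/
def pairN (S : Ingredients Ω) (f : ℝ → ℝ) (ω : Ω) : ℝ := ∫ t in Ici 0, f t ∂(S.N ω)

end Ingredients

/-- The probabilistic description of the critical marked Hawkes process with constant exogenous
intensity `μ`, kernel `φ(t, x) = x φ(t)` and mark distribution `ν`, as a branching system.
The exogenous particles arrive at the points of a Poisson random measure on `ℝ₊` with intensity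
`μ dt`. Every particle has, independently of everything else, a mark of law `ν`, given a mark `x`
a Poisson(`x`) number of children, and a displacement with density `φ` which is independent of
its mark and its number of children. -/
structure IsBranchingSystem {Ω : Type*} [MeasurableSpace Ω] (P : Measure Ω) (S : Ingredients Ω)
    (μ : ℝ) (φ : ℝ → ℝ) (ν : Measure ℝ≥0) [IsProbabilityMeasure ν] : Prop where
  measurable_arrival : ∀ j, Measurable (S.arrival j)
  measurable_displacement : ∀ u, Measurable (S.displacement u)
  measurable_mark : ∀ u, Measurable (S.mark u)
  measurable_offspring : ∀ u, Measurable (S.offspring u)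
  poisson_arrival : IsPoissonRandomMeasure
    (fun ω => Measure.sum fun j : ℕ => Measure.dirac (S.arrival j ω))
    (ENNReal.ofReal μ • volume.restrict (Ici (0 : ℝ))) P
  law_particle : ∀ u,
    HasLaw (fun ω => (S.displacement u ω, S.mark u ω, S.offspring u ω))
      ((volume.withDensity fun s => ENNReal.ofReal (φ s)).prod (ν ⊗ₘ poissonOffspring)) P
  indep_particle :
    iIndepFun (fun u ω => (S.displacement u ω, S.mark u ω, S.offspring u ω)) P
  indep_arrival :
    IndepFun (fun ω j => S.arrival j ω)
      (fun ω u => (S.displacement u ω, S.mark u ω, S.offspring u ω)) P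

/-- The class `𝔽_γ⁺` of nonnegative functions on `ℝ₊` with at most finitely many discontinuities
and decay of order `(1 + s)^(-γ)`. The values of `f` on `(-∞, 0)` play no role. -/
structure IsTestFunction (γ : ℝ) (f : ℝ → ℝ) : Prop where
  nonneg : ∀ s, 0 ≤ s → 0 ≤ f s
  finite_discont : {s | 0 ≤ s ∧ ¬ ContinuousWithinAt f (Ici 0) s}.Finite
  decay : ∃ C : ℝ, 0 < C ∧ ∀ s, 0 ≤ s → |f s| ≤ C / (1 + s) ^ γ

/-- The norming `F_T`. -/
def norming (α β T : ℝ) : ℝ := T ^ ((1 + α * (2 + β)) / (1 + β))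

/-- The rescaled function `f_T(t) = f(t / T) / F_T`. -/
def rescale (α β T : ℝ) (f : ℝ → ℝ) (t : ℝ) : ℝ := 1 / norming α β T * f (t / T)

/-- `⟨X_T, f⟩ = ⟨N, f_T⟩ - E⟨N, f_T⟩`. -/
def pairX {Ω : Type*} [MeasurableSpace Ω] (P : Measure Ω) (S : Ingredients Ω)
    (α β T : ℝ) (f : ℝ → ℝ) (ω : Ω) : ℝ :=
  S.pairN (rescale α β T f) ω - ∫ ω', S.pairN (rescale α β T f) ω' ∂P

/-- The potential `G^(α) f(t) = ∫₀^∞ f(t + s) s^(α - 1) ds`. -/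
def potential (α : ℝ) (f : ℝ → ℝ) (t : ℝ) : ℝ := ∫ s in Ioi 0, f (t + s) * s ^ (α - 1)

/-- `c_α = 1 / (c_φ Γ(1 + α) Γ(1 - α))`. -/
def cAlpha (α cφ : ℝ) : ℝ := 1 / (cφ * Real.Gamma (1 + α) * Real.Gamma (1 - α))

/-- `K = (c_ν / β) Γ(1 - β) c_α^(2 + β) α^(1 + β)`. -/
def limitConst (α β cφ cν : ℝ) : ℝ :=
  cν / β * Real.Gamma (1 - β) * cAlpha α cφ ^ (2 + β) * α ^ (1 + β)

end MarkedHawkes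

end

open MeasureTheory ProbabilityTheory Filter Topology Set
open scoped NNReal ENNReal

noncomputable section

namespace MarkedHawkes

/-! Write `κ` for the displacement law, `U` for its renewal measure, `h` for the rescaled test
function, and `Uh(t) = ∫ h(t + s) U(ds)`. Particles have one child on average, so `Uh(t)` is the
mean of the sum of `h` over a tree rooted at `t`. Let `u(t)` be one minus the Laplace functional of
that tree and `q(t) = ∫ u(t + s) κ(ds)`. Splitting the tree at its root gives `u = 1 - e^{-h} ∫
e^{-xq} ν(dx)`. Since `ν` has mean one, the last integral is `1 - q + ψ(q)` with `ψ = markExponent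
ν`, and the equation becomes `u + H = h + q`, where `H ≥ 0` (`nonlinearity`) collects the terms of
higher order. Iteration yields `Uh = u + UH`. For Poisson arrivals of rate `μ` the mean of `⟨N, h⟩`
is `μ ∫ Uh` and the logarithm of its Laplace transform is `-μ ∫ u`. Hence the centred transform
equals exactly `exp(μ ∫ UH) = exp(μ ∫ H(s) U([0, s]) ds)`, integrals over `[0, ∞)`
(`integral_exp_neg_pairN`).

The rest is asymptotics. The tail of `φ` makes the Laplace transform of `U` regularly varying at
`0`, and Karamata's method (`RegularLaplace.scalingLimit`) gives `T^{-α} U(T ds) → d s^{α-1} ds`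
with `d = α c_α`. The tail of `ν` gives `ψ(l) ~ k l^{1+β}` with `k = c_ν Γ(1-β)/β`. Put `e =
(1+α)/(1+β)`, so that `F_T = T^{α+e}`. Then `T^e q(Ts) → d G^{(α)}f(s)` (`tendsto_childExponent`),
`T^{1+α} H(Ts) → k (d G^{(α)}f(s))^{1+β}` (`tendsto_nonlinearity`) and `T^{-α} U([0, Ts]) → d s^α/α`
(`tendsto_real_Iic`). Substituting `Ts` for `s` contributes the missing factor `T`, and the constant
is `k d^{2+β}/α = K`.

The condition `α < β` means `e < 1`: it makes the correction `UH = O(T^{-1})` negligible against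
`q`, which is of order `T^{-e}`. The condition on `γ` says `(γ - (1+α))(1+β) > 1 + α`, which is the
integrability of the dominating function in the last passage to the limit
(`tendsto_lintegral_remainder`). -/

/-- The operator `h ↦ ∫ h(· + s) κ(ds)`. -/
def shiftOp (κ : Measure ℝ) (h : ℝ → ℝ≥0∞) (t : ℝ) : ℝ≥0∞ := ∫⁻ s, h (t + s) ∂κ

/-- The convolution powers of a measure. -/
def convPow (κ : Measure ℝ) : ℕ → Measure ℝ
  | 0 => Measure.dirac 0
  | n + 1 => κ ∗ convPow κ n

/-- The renewal measure `∑ₙ κ^{*n}`, which includes the atom at `0`. -/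
def renewalMeasure (κ : Measure ℝ) : Measure ℝ := Measure.sum (convPow κ)

/-! ### Renewal measures and the renewal equation. -/

section Renewal

variable {κ : Measure ℝ} [IsProbabilityMeasure κ]

instance isProbabilityMeasure_convPow (n : ℕ) : IsProbabilityMeasure (convPow κ n) := by
  induction n with
  | zero => unfold convPow; infer_instance
  | succ n ih => unfold convPow; infer_instance

instance sFinite_renewalMeasure : SFinite (renewalMeasure κ) := by
  unfold renewalMeasure; infer_instance

lemma measurable_shiftOp {m : Measure ℝ} [SFinite m] {h : ℝ → ℝ≥0∞} (hh : Measurable h) :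
    Measurable (shiftOp m h) := by
  unfold shiftOp
  exact Measurable.lintegral_prod_right' (f := fun p : ℝ × ℝ => h (p.1 + p.2)) (by fun_prop)

lemma shiftOp_mono {m : Measure ℝ} {h k : ℝ → ℝ≥0∞} (hk : h ≤ k) : shiftOp m h ≤ shiftOp m k :=
  fun _ => lintegral_mono fun _ => hk _

lemma measurable_iterate_shiftOp {h : ℝ → ℝ≥0∞} (hh : Measurable h) (n : ℕ) :
    Measurable ((shiftOp κ)^[n] h) := by
  induction n with
  | zero => exact hh
  | succ n ih => rw [Function.iterate_succ_apply']; exact measurable_shiftOp ih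

lemma shiftOp_convPow {h : ℝ → ℝ≥0∞} (hh : Measurable h) (n : ℕ) :
    shiftOp (convPow κ n) h = (shiftOp κ)^[n] h := by
  induction n with
  | zero => ext t; simp [shiftOp, convPow]
  | succ n ih =>
    rw [Function.iterate_succ_apply', ← ih]
    ext t
    simp only [shiftOp, convPow]
    rw [Measure.lintegral_conv (by fun_prop)]
    simp [add_assoc]

lemma shiftOp_renewalMeasure {h : ℝ → ℝ≥0∞} (hh : Measurable h) (t : ℝ) :
    shiftOp (renewalMeasure κ) h t = ∑' n, (shiftOp κ)^[n] h t := by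
  simp only [← shiftOp_convPow hh, shiftOp, renewalMeasure, lintegral_sum_measure]

omit [IsProbabilityMeasure κ] in
lemma iterate_shiftOp_mono {h k : ℝ → ℝ≥0∞} (hk : h ≤ k) (n : ℕ) :
    (shiftOp κ)^[n] h ≤ (shiftOp κ)^[n] k :=
  Monotone.iterate (fun _ _ => shiftOp_mono) n hk

/-- The result is a tail of the renewal series at `t`, so it tends to `0` in `n` wherever that
series is finite. -/
lemma iterate_shiftOp_renewalMeasure {h : ℝ → ℝ≥0∞} (hh : Measurable h) (n : ℕ) (t : ℝ) :
    (shiftOp κ)^[n] (shiftOp (renewalMeasure κ) h) t = ∑' k, (shiftOp κ)^[k + n] h t := by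
  rw [← shiftOp_convPow (measurable_shiftOp hh)]
  have : shiftOp (renewalMeasure κ) h = fun t => ∑' n, (shiftOp κ)^[n] h t :=
    funext (shiftOp_renewalMeasure hh)
  rw [this, shiftOp, lintegral_tsum]
  · refine tsum_congr fun k => ?_
    rw [add_comm, Function.iterate_add_apply, ← shiftOp_convPow (n := n)
      (measurable_iterate_shiftOp hh k)]
    rfl
  · intro k
    have := measurable_iterate_shiftOp (κ := κ) hh k
    exact (this.comp (measurable_const_add t)).aemeasurable

lemma iterate_shiftOp_add {h k : ℝ → ℝ≥0∞} (hh : Measurable h) (hk : Measurable k) (n : ℕ) :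
    (shiftOp κ)^[n] (h + k) = (shiftOp κ)^[n] h + (shiftOp κ)^[n] k := by
  rw [← shiftOp_convPow hh, ← shiftOp_convPow hk, ← shiftOp_convPow (hh.add hk)]
  ext t
  simp only [shiftOp, Pi.add_apply]
  exact lintegral_add_left (by fun_prop) _

/-- The solution of a perturbed renewal inequality, expressed through the renewal measure. -/
lemma eq_add_shiftOp_renewalMeasure {u g H : ℝ → ℝ≥0∞} (hu : Measurable u) (hg : Measurable g)
    (hH : Measurable H) (h_eq : u + H = g + shiftOp κ u)
    (h_le : u ≤ shiftOp (renewalMeasure κ) g) {t : ℝ}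
    (ht : shiftOp (renewalMeasure κ) g t ≠ ∞) :
    shiftOp (renewalMeasure κ) g t = u t + shiftOp (renewalMeasure κ) H t := by
  -- The equation iterated `n` times, kept additive because subtraction in `ℝ≥0∞` is truncated.
  have key : ∀ n, u t + ∑ k ∈ Finset.range n, (shiftOp κ)^[k] H t =
      ∑ k ∈ Finset.range n, (shiftOp κ)^[k] g t + (shiftOp κ)^[n] u t := by
    intro n
    induction n with
    | zero => simp
    | succ n ih =>
      rw [Finset.sum_range_succ, ← add_assoc, ih, Finset.sum_range_succ, add_assoc, add_assoc]
      congr 1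
      have := congrFun (congrArg (shiftOp κ)^[n] h_eq) t
      rw [iterate_shiftOp_add hu hH, iterate_shiftOp_add hg (measurable_shiftOp hu)] at this
      rw [Function.iterate_succ_apply]
      exact this
  -- The a priori bound `h_le` squeezes the leftover term under a tail of the convergent renewal
  -- series. Without such a bound uniqueness fails, since constants solve the homogeneous equation.
  have h0 : Tendsto (fun n => (shiftOp κ)^[n] u t) atTop (𝓝 0) := by
    refine tendsto_of_tendsto_of_tendsto_of_le_of_le tendsto_const_nhds
      (ENNReal.tendsto_sum_nat_add (fun n => (shiftOp κ)^[n] g t) ?_) (fun _ => zero_le) ?_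
    · rwa [← shiftOp_renewalMeasure hg]
    · intro n
      exact (iterate_shiftOp_mono h_le n t).trans_eq (iterate_shiftOp_renewalMeasure hg n t)
  have h1 := (ENNReal.tendsto_nat_tsum (fun n => (shiftOp κ)^[n] g t)).add h0
  have h2 := (ENNReal.tendsto_nat_tsum (fun n => (shiftOp κ)^[n] H t)).const_add (u t)
  simp only [key] at h2
  rw [shiftOp_renewalMeasure hg, shiftOp_renewalMeasure hH]
  have := tendsto_nhds_unique h1 h2
  simpa using this

lemma shiftOp_add_eq {g : ℝ → ℝ≥0∞} (hg : Measurable g) (t : ℝ) :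
    shiftOp (renewalMeasure κ) g t = g t + shiftOp κ (shiftOp (renewalMeasure κ) g) t := by
  have h1 := iterate_shiftOp_renewalMeasure (κ := κ) hg 1 t
  have h2 := tsum_eq_zero_add' (f := fun n => (shiftOp κ)^[n] g t) ENNReal.summable
  rw [Function.iterate_one] at h1
  rw [h1, shiftOp_renewalMeasure hg, h2, Function.iterate_zero_apply]

omit [IsProbabilityMeasure κ] in
lemma ae_nonneg_convPow (hκ : ∀ᵐ s ∂κ, 0 ≤ s) (n : ℕ) : ∀ᵐ s ∂(convPow κ n), 0 ≤ s := by
  have hm : MeasurableSet {s : ℝ | 0 ≤ s} := measurableSet_Ici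
  induction n with
  | zero => simp [convPow]
  | succ n ih =>
    rw [convPow, Measure.conv, ae_map_iff (by fun_prop) hm]
    have h1 : ∀ᵐ p ∂(κ.prod (convPow κ n)), 0 ≤ p.1 :=
      Measure.quasiMeasurePreserving_fst.ae hκ
    have h2 : ∀ᵐ p ∂(κ.prod (convPow κ n)), 0 ≤ p.2 :=
      Measure.quasiMeasurePreserving_snd.ae ih
    filter_upwards [h1, h2] with p hp1 hp2 using add_nonneg hp1 hp2

omit [IsProbabilityMeasure κ] in
lemma ae_nonneg_renewalMeasure (hκ : ∀ᵐ s ∂κ, 0 ≤ s) : ∀ᵐ s ∂(renewalMeasure κ), 0 ≤ s := by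
  rw [renewalMeasure, Measure.ae_sum_eq, Filter.eventually_iSup]
  exact ae_nonneg_convPow hκ

/-- The Laplace transform of the renewal measure. -/
lemma lintegral_exp_renewalMeasure (l : ℝ) :
    ∫⁻ s, ENNReal.ofReal (Real.exp (-(l * s))) ∂(renewalMeasure κ) =
      (1 - ∫⁻ s, ENNReal.ofReal (Real.exp (-(l * s))) ∂κ)⁻¹ := by
  -- Convolution powers have powers as transforms. The geometric series needs no smallness here:
  -- truncated subtraction and `0⁻¹ = ∞` cover ratios at least `1`.
  rw [renewalMeasure, lintegral_sum_measure, ← ENNReal.tsum_geometric]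
  refine tsum_congr fun n => ?_
  induction n with
  | zero => rw [convPow, lintegral_dirac' _ (by fun_prop)]; simp
  | succ n ih =>
    rw [convPow, Measure.lintegral_conv (by fun_prop), pow_succ', ← ih, ← lintegral_mul_const _
      (by fun_prop)]
    refine lintegral_congr fun x => ?_
    rw [← lintegral_const_mul _ (by fun_prop)]
    refine lintegral_congr fun y => ?_
    rw [← ENNReal.ofReal_mul (by positivity), ← Real.exp_add]
    ring_nf

/-- Fubini in the variables `s` and `x = t + s`: the condition `t ≥ 0` becomes `s ≤ x`. -/
lemma lintegral_shiftOp_renewalMeasure (hκ : ∀ᵐ s ∂κ, 0 ≤ s) {h : ℝ → ℝ≥0∞} (hh : Measurable h) :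
    ∫⁻ t in Ici 0, shiftOp (renewalMeasure κ) h t =
      ∫⁻ s in Ici 0, h s * renewalMeasure κ (Iic s) := by
  have hR := ae_nonneg_renewalMeasure hκ
  have h1 : ∀ s : ℝ, ∫⁻ t in Ici 0, h (t + s) = ∫⁻ x, (Ici s).indicator h x := by
    intro s
    rw [← lintegral_indicator measurableSet_Ici,
      ← lintegral_add_right_eq_self (fun x => (Ici s).indicator h x) s]
    refine lintegral_congr fun t => ?_
    simp only [indicator, mem_Ici, le_add_iff_nonneg_left]
  simp only [shiftOp]
  rw [lintegral_lintegral_swap]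
  · simp_rw [h1]
    rw [lintegral_lintegral_swap]
    · rw [← lintegral_indicator measurableSet_Ici]
      refine lintegral_congr fun x => ?_
      have h2 : ∀ s : ℝ, (Ici s).indicator h x = h x * (Iic x).indicator 1 s := by
        intro s; simp [indicator]
      simp_rw [h2]
      rw [lintegral_const_mul _ (by fun_prop (disch := exact measurableSet_Iic)),
        lintegral_indicator_one measurableSet_Iic]
      -- Negative `x` contribute nothing, because the renewal measure lives on `[0, ∞)`.
      by_cases hx : 0 ≤ x
      · simp [hx]
      · have : renewalMeasure κ (Iic x) = 0 := by
          refine measure_mono_null ?_ hR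
          intro s hs
          simp only [mem_Iic, mem_compl_iff, mem_ofPred_eq] at *
          linarith
        simp [hx, this]
    · have : (Function.uncurry fun (s x : ℝ) => (Ici s).indicator h x) =
          {p : ℝ × ℝ | p.1 ≤ p.2}.indicator (fun p => h p.2) := by
        ext p; simp [indicator, Function.uncurry]
      rw [this]
      exact ((hh.comp measurable_snd).indicator
        (measurableSet_le measurable_fst measurable_snd)).aemeasurable
  · exact Measurable.aemeasurable (by fun_prop)

end Renewal

/-! ### The exponential on `[0, ∞]`. -/

/-- The function `x ↦ e^{-x}` on `[0, ∞]`. -/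
def expNeg (x : ℝ≥0∞) : ℝ≥0∞ := EReal.exp (-(x : EReal))

section ExpNeg

/-- With the value `0` at `∞` continuity holds on all of `[0, ∞]`, so Laplace functionals can be
handled before the sums in them are known to be finite. -/
lemma continuous_expNeg : Continuous expNeg :=
  ENNReal.continuous_exp.comp (continuous_neg.comp continuous_coe_ennreal_ereal)

@[fun_prop]
lemma measurable_expNeg : Measurable expNeg := continuous_expNeg.measurable

@[simp] lemma expNeg_zero : expNeg 0 = 1 := by simp [expNeg]

@[simp] lemma expNeg_top : expNeg ∞ = 0 := by simp [expNeg]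

lemma expNeg_add (x y : ℝ≥0∞) : expNeg (x + y) = expNeg x * expNeg y := by
  rw [expNeg, EReal.coe_ennreal_add, EReal.neg_add (.inl (by simp)) (.inr (by simp)),
    sub_eq_add_neg, EReal.exp_add]
  rfl

lemma expNeg_ofReal {x : ℝ} (hx : 0 ≤ x) :
    expNeg (ENNReal.ofReal x) = ENNReal.ofReal (Real.exp (-x)) := by
  rw [expNeg, EReal.coe_ennreal_ofReal, max_eq_left hx, ← EReal.coe_neg, EReal.exp_coe]

lemma expNeg_of_ne_top {x : ℝ≥0∞} (hx : x ≠ ∞) :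
    expNeg x = ENNReal.ofReal (Real.exp (-x.toReal)) := by
  conv_lhs => rw [← ENNReal.ofReal_toReal hx]
  exact expNeg_ofReal ENNReal.toReal_nonneg

lemma antitone_expNeg : Antitone expNeg := fun x y h =>
  EReal.exp_monotone (EReal.neg_le_neg_iff.2 (by exact_mod_cast h))

lemma expNeg_le_one (x : ℝ≥0∞) : expNeg x ≤ 1 := expNeg_zero ▸ antitone_expNeg zero_le

lemma expNeg_ne_top (x : ℝ≥0∞) : expNeg x ≠ ∞ := ne_top_of_le_ne_top (by simp) (expNeg_le_one x)

lemma expNeg_sum {ι : Type*} (s : Finset ι) (a : ι → ℝ≥0∞) :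
    expNeg (∑ i ∈ s, a i) = ∏ i ∈ s, expNeg (a i) := by
  classical
  induction s using Finset.induction_on with
  | empty => simp
  | insert i s hi ih => rw [Finset.sum_insert hi, Finset.prod_insert hi, expNeg_add, ih]

lemma expNeg_mul_nat (x : ℝ≥0∞) (n : ℕ) : expNeg (x * n) = expNeg x ^ n := by
  have := expNeg_sum (Finset.range n) fun _ => x
  simpa [mul_comm] using this

lemma tendsto_prod_expNeg (a : ℕ → ℝ≥0∞) :
    Tendsto (fun n => ∏ i ∈ Finset.range n, expNeg (a i)) atTop (𝓝 (expNeg (∑' i, a i))) := by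
  simp_rw [← expNeg_sum]
  exact (continuous_expNeg.tendsto _).comp (ENNReal.tendsto_nat_tsum a)

lemma one_sub_expNeg_le (x : ℝ≥0∞) : 1 - expNeg x ≤ x := by
  by_cases hx : x = ∞
  · simp [hx]
  · rw [expNeg_of_ne_top hx, ← ENNReal.ofReal_one, ← ENNReal.ofReal_sub _ (by positivity)]
    refine ENNReal.ofReal_le_of_le_toReal ?_
    linarith [Real.add_one_le_exp (-x.toReal)]

end ExpNeg

/-! ### Poisson laws; mean and Laplace functional of a Poisson random measure. -/

section Poisson

lemma lintegral_poissonMeasure (r : ℝ≥0) (F : ℕ → ℝ≥0∞) :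
    ∫⁻ n, F n ∂(poissonMeasure r) =
      ∑' n : ℕ, ENNReal.ofReal (Real.exp (-r) * (r : ℝ) ^ n / (n.factorial : ℝ)) * F n := by
  rw [poissonMeasure, lintegral_sum_measure]
  simp

/-- The probability generating function of the Poisson law. -/
lemma lintegral_pow_poissonMeasure (r : ℝ≥0) {b : ℝ} (hb : 0 ≤ b) :
    ∫⁻ n, ENNReal.ofReal b ^ n ∂(poissonMeasure r) =
      ENNReal.ofReal (Real.exp (-(r * (1 - b)))) := by
  rw [lintegral_poissonMeasure]
  have h : HasSum (fun n : ℕ => Real.exp (-r) * ((r * b : ℝ) ^ n / (n.factorial : ℝ)))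
      (Real.exp (-r) * Real.exp (r * b)) := by
    have := NormedSpace.expSeries_div_hasSum_exp (r * b : ℝ)
    rw [← Real.exp_eq_exp_ℝ] at this
    exact this.mul_left _
  rw [show Real.exp (-(r * (1 - b))) = Real.exp (-r) * Real.exp (r * b) by
    rw [← Real.exp_add]; ring_nf, ← h.tsum_eq,
    ENNReal.ofReal_tsum_of_nonneg (fun n => by positivity) h.summable]
  refine tsum_congr fun n => ?_
  rw [← ENNReal.ofReal_pow hb, ← ENNReal.ofReal_mul (by positivity)]
  congr 1
  rw [mul_pow]; ring

lemma lintegral_natCast_poissonMeasure (r : ℝ≥0) :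
    ∫⁻ n, (n : ℝ≥0∞) ∂(poissonMeasure r) = r := by
  rw [lintegral_poissonMeasure, tsum_eq_zero_add' ENNReal.summable]
  have h := hasSum_one_poissonMeasure r
  have h2 : ∑' n : ℕ, ENNReal.ofReal (Real.exp (-r) * (r : ℝ) ^ n / (n.factorial : ℝ)) = 1 := by
    rw [← ENNReal.ofReal_tsum_of_nonneg (fun n => by positivity) h.summable, h.tsum_eq]
    simp
  simp only [CharP.cast_eq_zero, mul_zero, zero_add]
  conv_rhs => rw [← mul_one (r : ℝ≥0∞), ← h2, ← ENNReal.tsum_mul_left]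
  refine tsum_congr fun n => ?_
  rw [← ENNReal.ofReal_coe_nnreal, ← ENNReal.ofReal_mul (by positivity),
    ← ENNReal.ofReal_natCast, ← ENNReal.ofReal_mul (by positivity)]
  congr 1
  rw [Nat.factorial_succ]
  push_cast
  field_simp
  ring

variable {Ω E : Type*} [MeasurableSpace Ω] [MeasurableSpace E]
  {Q : Ω → Measure E} {Λ : Measure E} {P : Measure Ω}

namespace IsPoissonRandomMeasure

lemma lintegral_comp (hQ : IsPoissonRandomMeasure Q Λ P) {A : Set E} (hA : MeasurableSet A)
    (hΛ : Λ A ≠ ∞) {F : ℝ≥0∞ → ℝ≥0∞} (hF : Measurable F) :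
    ∫⁻ ω, F (Q ω A) ∂P = ∫⁻ n, F (n : ℝ≥0∞) ∂(poissonMeasure (Λ A).toNNReal) := by
  have h := hQ.law A hA hΛ
  rw [← lintegral_map' hF.aemeasurable h.aemeasurable, h.map_eq,
    lintegral_map hF (by fun_prop)]

lemma lintegral_expNeg_mul (hQ : IsPoissonRandomMeasure Q Λ P) {A : Set E}
    (hA : MeasurableSet A) (hΛ : Λ A ≠ ∞) (x : ℝ≥0∞) :
    ∫⁻ ω, expNeg (x * Q ω A) ∂P = expNeg ((1 - expNeg x) * Λ A) := by
  rw [hQ.lintegral_comp hA hΛ (F := fun y => expNeg (x * y)) (by fun_prop)]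
  simp_rw [expNeg_mul_nat]
  have hb := expNeg_ne_top x
  have hb1 : (expNeg x).toReal ≤ 1 := by simpa using ENNReal.toReal_mono (by simp) (expNeg_le_one x)
  conv_lhs => rw [← ENNReal.ofReal_toReal hb]
  rw [lintegral_pow_poissonMeasure _ ENNReal.toReal_nonneg, ← expNeg_ofReal, mul_comm,
    ENNReal.ofReal_mul (by linarith), ENNReal.ofReal_sub _ ENNReal.toReal_nonneg,
    ENNReal.ofReal_toReal hb]
  · simp [hΛ]
  · have : 0 ≤ 1 - (expNeg x).toReal := by linarith
    positivity

/-- The level sets are disjoint, so their point counts are independent and the functional factors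
into one-dimensional Poisson transforms. The level `0` is left out, as its intensity may be
infinite. -/
lemma lintegral_expNeg_simpleFunc (hQ : IsPoissonRandomMeasure Q Λ P) (f : SimpleFunc E ℝ≥0∞)
    (hf : ∀ x ≠ 0, Λ (f ⁻¹' {x}) ≠ ∞) :
    ∫⁻ ω, expNeg (∫⁻ x, f x ∂(Q ω)) ∂P = expNeg (∫⁻ x, (1 - expNeg (f x)) ∂Λ) := by
  classical
  set s := f.range.filter (· ≠ 0) with hs
  set A : Fin s.card → Set E := fun i => f ⁻¹' {(s.equivFin.symm i : ℝ≥0∞)} with hA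
  have hAm : ∀ i, MeasurableSet (A i) := fun i => f.measurableSet_fiber _
  have hdisj : Pairwise (Function.onFun Disjoint A) := by
    intro i j hij
    refine Disjoint.preimage _ (disjoint_singleton.2 fun h => hij ?_)
    exact s.equivFin.symm.injective (Subtype.ext h)
  have hind := hQ.indep _ A hAm hdisj
  have hne : ∀ i, (s.equivFin.symm i : ℝ≥0∞) ≠ 0 := fun i =>
    (Finset.mem_filter.1 (s.equivFin.symm i).2).2
  have h1 : ∀ m : Measure E, ∀ G : ℝ≥0∞ → ℝ≥0∞, G 0 = 0 → ∫⁻ x, G (f x) ∂m =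
      ∑ i, G (s.equivFin.symm i : ℝ≥0∞) * m (A i) := by
    intro m G hG
    have : ∫⁻ x, G (f x) ∂m = (f.map G).lintegral m := by
      rw [← SimpleFunc.lintegral_eq_lintegral]; rfl
    rw [this, SimpleFunc.map_lintegral,
      Fintype.sum_equiv s.equivFin.symm _ (fun y : s => G y * m (f ⁻¹' {(y : ℝ≥0∞)}))
        (fun i => rfl),
      Finset.sum_coe_sort s (fun y => G y * m (f ⁻¹' {y})), hs, Finset.sum_filter_of_ne]
    rintro x - hx rfl
    simp [hG] at hx
  have h2 : ∀ ω, ∫⁻ x, f x ∂(Q ω) = ∑ i, (s.equivFin.symm i : ℝ≥0∞) * Q ω (A i) :=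
    fun ω => h1 (Q ω) id rfl
  simp_rw [h2, expNeg_sum]
  rw [lintegral_prod_eq_prod_lintegral_of_indepFun Finset.univ
    (fun i ω => expNeg ((s.equivFin.symm i : ℝ≥0∞) * Q ω (A i)))
    (hind.comp (fun i y => expNeg ((s.equivFin.symm i : ℝ≥0∞) * y)) (fun i => by fun_prop))
    (fun i => by
      have := (Measure.measurable_coe (hAm i)).comp hQ.measurable
      simp only [Function.comp_def] at this
      fun_prop)]
  rw [h1 Λ (fun y => 1 - expNeg y) (by simp), expNeg_sum]
  exact Finset.prod_congr rfl fun i _ => hQ.lintegral_expNeg_mul (hAm i) (hf _ (hne i)) _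

/-- The Laplace functional of a Poisson random measure. -/
lemma lintegral_expNeg [SigmaFinite Λ] [IsProbabilityMeasure P]
    (hQ : IsPoissonRandomMeasure Q Λ P) {h : E → ℝ≥0∞}
    (hh : Measurable h) :
    ∫⁻ ω, expNeg (∫⁻ x, h x ∂(Q ω)) ∂P = expNeg (∫⁻ x, (1 - expNeg (h x)) ∂Λ) := by
  -- Restriction to spanning sets gives every nonzero level finite intensity and keeps the
  -- approximation increasing.
  set f : ℕ → SimpleFunc E ℝ≥0∞ := fun n =>
    (SimpleFunc.eapprox h n).restrict (spanningSets Λ n) with hf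
  have hS : ∀ n, MeasurableSet (spanningSets Λ n) := measurableSet_spanningSets Λ
  have hmono : Monotone fun n => (f n : E → ℝ≥0∞) := by
    intro n m hnm x
    simp only [hf, SimpleFunc.coe_restrict _ (hS _)]
    exact (indicator_le_indicator_of_subset (monotone_spanningSets Λ hnm) (fun _ => zero_le) x).trans
      (indicator_le_indicator (SimpleFunc.monotone_eapprox h hnm x))
  have hlim : ∀ x, Tendsto (fun n => f n x) atTop (𝓝 (h x)) := by
    intro x
    refine (SimpleFunc.tendsto_eapprox hh x).congr' ?_
    obtain ⟨N, hN⟩ := mem_iUnion.1 ((iUnion_spanningSets Λ).symm ▸ mem_univ x)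
    filter_upwards [eventually_ge_atTop N] with n hn
    simp only [hf, SimpleFunc.coe_restrict _ (hS _)]
    rw [indicator_of_mem (monotone_spanningSets Λ hn hN)]
  have hfin : ∀ n, ∀ x ≠ 0, Λ (f n ⁻¹' {x}) ≠ ∞ := by
    intro n x hx
    rw [hf, SimpleFunc.restrict_preimage_singleton _ (hS n) hx]
    exact ne_top_of_le_ne_top (measure_spanningSets_lt_top Λ n).ne (measure_mono inter_subset_left)
  have key := fun n => hQ.lintegral_expNeg_simpleFunc (f n) (hfin n)
  have hR : Tendsto (fun n => expNeg (∫⁻ x, (1 - expNeg (f n x)) ∂Λ)) atTop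
      (𝓝 (expNeg (∫⁻ x, (1 - expNeg (h x)) ∂Λ))) := by
    refine (continuous_expNeg.tendsto _).comp (lintegral_tendsto_of_tendsto_of_monotone
      (fun n => ?_) ?_ ?_)
    · exact ((measurable_expNeg.comp (f n).measurable).const_sub _).aemeasurable
    · exact Eventually.of_forall fun x n m hnm =>
        tsub_le_tsub_left (antitone_expNeg (hmono hnm x)) _
    · refine Eventually.of_forall fun x => ?_
      exact ENNReal.Tendsto.sub tendsto_const_nhds
        ((continuous_expNeg.tendsto _).comp (hlim x)) (.inl (by simp))
  have hL : Tendsto (fun n => ∫⁻ ω, expNeg (∫⁻ x, f n x ∂(Q ω)) ∂P) atTop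
      (𝓝 (∫⁻ ω, expNeg (∫⁻ x, h x ∂(Q ω)) ∂P)) := by
    refine tendsto_lintegral_of_dominated_convergence (fun _ => 1) (fun n => ?_) (fun n => ?_)
      (by simp) ?_
    · exact measurable_expNeg.comp
        ((Measure.measurable_lintegral (f n).measurable).comp hQ.measurable)
    · exact Eventually.of_forall fun ω => expNeg_le_one _
    · refine Eventually.of_forall fun ω => (continuous_expNeg.tendsto _).comp ?_
      exact lintegral_tendsto_of_tendsto_of_monotone
        (fun n => (f n).measurable.aemeasurable)
        (Eventually.of_forall fun x n m hnm => hmono hnm x) (Eventually.of_forall hlim)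
  simp_rw [key] at hL
  exact tendsto_nhds_unique hL hR

/-- The intensity measure is the mean measure. -/
lemma lintegral_lintegral [SigmaFinite Λ] (hQ : IsPoissonRandomMeasure Q Λ P) {h : E → ℝ≥0∞}
    (hh : Measurable h) : ∫⁻ ω, ∫⁻ x, h x ∂(Q ω) ∂P = ∫⁻ x, h x ∂Λ := by
  have hfin : ∀ A, MeasurableSet A → Λ A ≠ ∞ → ∫⁻ ω, Q ω A ∂P = Λ A := by
    intro A hA hΛ
    rw [hQ.lintegral_comp hA hΛ (F := fun y => y) measurable_id,
      lintegral_natCast_poissonMeasure, ENNReal.coe_toNNReal hΛ]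
  -- The mean measure of `Q` is the join of its law. It agrees with `Λ` on sets of finite intensity,
  -- and the spanning sets exhaust every other set.
  have hjoin : Measure.join (P.map Q) = Λ := by
    have happ : ∀ A, MeasurableSet A → Measure.join (P.map Q) A = ∫⁻ ω, Q ω A ∂P := by
      intro A hA
      rw [Measure.join_apply hA, lintegral_map (Measure.measurable_coe hA) hQ.measurable]
    ext A hA
    have hS : ∀ n, MeasurableSet (spanningSets Λ n ∩ A) :=
      fun n => (measurableSet_spanningSets Λ n).inter hA
    have hU : A = ⋃ n, spanningSets Λ n ∩ A := by
      rw [← iUnion_inter, iUnion_spanningSets, univ_inter]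
    have hm : Monotone fun n => spanningSets Λ n ∩ A := fun n m hnm =>
      inter_subset_inter_left _ (monotone_spanningSets Λ hnm)
    rw [hU, hm.measure_iUnion, hm.measure_iUnion]
    congr 1
    ext n
    rw [happ _ (hS n), hfin _ (hS n)]
    exact ne_top_of_le_ne_top (measure_spanningSets_lt_top Λ n).ne (measure_mono inter_subset_left)
  conv_rhs => rw [← hjoin]
  rw [Measure.lintegral_join hh.aemeasurable, lintegral_map (Measure.measurable_lintegral hh)
    hQ.measurable]

end IsPoissonRandomMeasure

end Poisson

/-! ### Trees and their decomposition at the root. -/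

/-- An environment of a tree: the displacement and the number of children of every potential
particle. -/
abbrev Env := List ℕ → ℝ × ℕ

/-- A label belongs to the tree. -/
def present (e : Env) : List ℕ → Prop
  | [] => True
  | k :: l => present e l ∧ k < (e l).2

/-- The location of a label when the root is located at `t`. -/
def position (e : Env) (t : ℝ) : List ℕ → ℝ
  | [] => t
  | k :: l => position e t l + (e (k :: l)).1

/-- The environment of the subtree of the `k`-th child of the root. -/
def subtree (k : ℕ) (e : Env) : Env := fun l => e (l ++ [k])

open Classical in
/-- The sum of `g (generation) (location)` over a tree with root at `t`. -/
def treeSum (g : ℕ → ℝ → ℝ≥0∞) (t : ℝ) (e : Env) : ℝ≥0∞ :=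
  ∑' l : List ℕ, if present e l then g l.length (position e t l) else 0

/-- The same with root at `t` plus the displacement of the root. -/
def childSum (g : ℕ → ℝ → ℝ≥0∞) (t : ℝ) (e : Env) : ℝ≥0∞ := treeSum g (t + (e []).1) e

section Tree

/-- Labels carry the latest generation at the head, so the descendants of the `k`-th child of the
root are the labels that end in `k`. -/
lemma present_append (e : Env) (k : ℕ) (l : List ℕ) :
    present e (l ++ [k]) ↔ k < (e []).2 ∧ present (subtree k e) l := by
  induction l with
  | nil => simp [present]
  | cons m l ih => simp only [List.cons_append, present, ih, subtree, and_assoc]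

lemma position_append (e : Env) (t : ℝ) (k : ℕ) (l : List ℕ) :
    position e t (l ++ [k]) = position (subtree k e) (t + (e [k]).1) l := by
  induction l with
  | nil => simp [position]
  | cons m l ih => simp only [List.cons_append, position, ih, subtree]

/-- Every nonempty label is `l ++ [k]` for exactly one pair `(k, l)`. -/
lemma tsum_list_eq (F : List ℕ → ℝ≥0∞) : ∑' l, F l = F [] + ∑' (k : ℕ) (l : List ℕ), F (l ++ [k]) := by
  rw [ENNReal.tsum_eq_add_tsum_ite []]
  congr 1
  have hinj : Function.Injective (fun p : ℕ × List ℕ => p.2 ++ [p.1]) := by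
    rintro ⟨k, l⟩ ⟨k', l'⟩ h
    simpa [and_comm] using h
  rw [← ENNReal.tsum_prod (f := fun k l => F (l ++ [k])), ← hinj.tsum_eq]
  · refine tsum_congr fun p => by simp
  · intro l hl
    rcases List.eq_nil_or_concat l with rfl | ⟨l', k, rfl⟩
    · simp at hl
    · exact ⟨(k, l'), by simp⟩

/-- The branching property. The generation argument of `g` moves by one, and `childSum` adds the
displacement of the child, which `treeSum` ignores at its own root. -/
lemma treeSum_eq (g : ℕ → ℝ → ℝ≥0∞) (t : ℝ) (e : Env) :
    treeSum g t e = g 0 t +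
      ∑ k ∈ Finset.range (e []).2, childSum (fun n => g (n + 1)) t (subtree k e) := by
  rw [treeSum, tsum_list_eq]
  congr 1
  · simp [present, position]
  · rw [tsum_eq_sum (s := Finset.range (e []).2)]
    · refine Finset.sum_congr rfl fun k hk => ?_
      rw [childSum, treeSum]
      refine tsum_congr fun l => ?_
      have h1 : present e (l ++ [k]) ↔ present (subtree k e) l := by
        simp [present_append, Finset.mem_range.1 hk]
      by_cases hp : present (subtree k e) l
      · rw [if_pos (h1.2 hp), if_pos hp, position_append, List.length_append]
        rfl
      · rw [if_neg (mt h1.1 hp), if_neg hp]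
    · intro k hk
      simp only [Finset.mem_range] at hk
      simp [present_append, hk]

lemma measurable_position (l : List ℕ) : Measurable fun p : ℝ × Env => position p.2 p.1 l := by
  induction l with
  | nil => exact measurable_fst
  | cons k l ih => exact ih.add (by fun_prop)

lemma measurableSet_present (l : List ℕ) : MeasurableSet {e : Env | present e l} := by
  induction l with
  | nil => simp [present]
  | cons k l ih =>
    have : MeasurableSet {e : Env | k < (e l).2} :=
      measurableSet_lt measurable_const (by fun_prop)
    exact ih.inter this

lemma measurable_treeSum {g : ℕ → ℝ → ℝ≥0∞} (hg : ∀ n, Measurable (g n)) :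
    Measurable fun p : ℝ × Env => treeSum g p.1 p.2 := by
  unfold treeSum
  refine Measurable.tsum fun l => ?_
  exact Measurable.ite (measurable_snd (measurableSet_present l))
    ((hg _).comp (measurable_position l)) measurable_const

lemma measurable_childSum {g : ℕ → ℝ → ℝ≥0∞} (hg : ∀ n, Measurable (g n)) :
    Measurable fun p : ℝ × Env => childSum g p.1 p.2 :=
  (measurable_treeSum hg).comp (f := fun p : ℝ × Env => (p.1 + (p.2 []).1, p.2)) (by fun_prop)

end Tree

lemma lintegral_const_add_of_isProbabilityMeasure {X : Type*} [MeasurableSpace X] (m : Measure X)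
    [IsProbabilityMeasure m] (c : ℝ≥0∞) (f : X → ℝ≥0∞) :
    ∫⁻ x, c + f x ∂m = c + ∫⁻ x, f x ∂m := by
  rw [lintegral_add_left measurable_const]
  simp

/-! ### Trees in an environment with independent entries. -/

section TreeLaw

variable {τ : Measure (ℝ × ℕ)} [IsProbabilityMeasure τ]

variable (τ) in
/-- The law of an environment with independent entries of law `τ`. -/
abbrev envLaw : Measure Env := Measure.infinitePi fun _ : List ℕ => τ

lemma measurable_subtrees : Measurable fun (e : Env) (k : ℕ) => subtree k e := by
  unfold subtree; fun_prop

/-- Since `(k, l) ↦ l ++ [k]` is injective, different subtrees read disjoint families of independent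
coordinates, each with the same law. -/
lemma map_subtrees : (envLaw τ).map (fun e k => subtree k e) =
    Measure.infinitePi fun _ : ℕ => envLaw τ := by
  have hinj : Function.Injective (fun p : ℕ × List ℕ => p.2 ++ [p.1]) := by
    rintro ⟨k, l⟩ ⟨k', l'⟩ h
    simpa [and_comm] using h
  have h1 := Measure.map_infinitePi_infinitePi_of_inj (P := fun _ : List ℕ => τ) hinj
  have h2 := Measure.infinitePi_map_curry (fun (_ : ℕ) (_ : List ℕ) => τ)
  rw [← h1, Measure.map_map (by fun_prop) (by fun_prop)] at h2
  exact h2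

/-- The subtrees only read coordinates `l ++ [k]`, never `[]`. -/
lemma indepFun_root_subtrees :
    IndepFun (fun e : Env => e []) (fun e k => subtree k e) (envLaw τ) := by
  have h := iIndepFun_infinitePi (P := fun _ : List ℕ => τ) (X := fun _ x => x)
    (fun _ => measurable_id)
  have h2 := indep_iSup_of_disjoint (S := {[]}) (T := {[]}ᶜ)
    (fun l => (measurable_pi_apply l).comap_le) h disjoint_compl_right
  refine indep_of_indep_of_le_left (indep_of_indep_of_le_right h2 ?_) ?_
  · rw [← measurable_iff_comap_le]
    refine @measurable_pi_lambda _ _ _ (_) _ _ fun k => ?_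
    refine @measurable_pi_lambda _ _ _ (_) _ _ fun l => ?_
    have hl : l ++ [k] ∈ ({[]}ᶜ : Set (List ℕ)) := by simp
    exact Measurable.mono (comap_measurable (fun e : Env => e (l ++ [k])))
      (le_iSup₂_of_le (l ++ [k]) hl le_rfl) le_rfl
  · exact le_iSup₂_of_le [] rfl le_rfl

lemma map_root_subtrees : (envLaw τ).map (fun e => (e [], fun k => subtree k e)) =
    τ.prod (Measure.infinitePi fun _ : ℕ => envLaw τ) := by
  rw [indepFun_root_subtrees.map_prod_eq_prod_map_map (measurable_pi_apply _).aemeasurable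
    measurable_subtrees.aemeasurable, map_subtrees, Measure.infinitePi_map_eval]

lemma lintegral_envLaw {F : (ℝ × ℕ) × (ℕ → Env) → ℝ≥0∞} (hF : Measurable F) :
    ∫⁻ e, F (e [], fun k => subtree k e) ∂(envLaw τ) =
      ∫⁻ x, ∫⁻ ε, F (x, ε) ∂(Measure.infinitePi fun _ : ℕ => envLaw τ) ∂τ := by
  rw [← lintegral_prod _ hF.aemeasurable, ← map_root_subtrees, lintegral_map hF]
  exact Measurable.prodMk (by fun_prop) measurable_subtrees

lemma lintegral_prod_infinitePi {F : ℕ → Env → ℝ≥0∞} (hF : ∀ k, Measurable (F k))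
    (n : ℕ) : ∫⁻ ε, ∏ k ∈ Finset.range n, F k (ε k) ∂(Measure.infinitePi fun _ : ℕ => envLaw τ) =
      ∏ k ∈ Finset.range n, ∫⁻ e, F k e ∂(envLaw τ) := by
  rw [lintegral_prod_eq_prod_lintegral_of_indepFun (Finset.range n)
    (fun k (ε : ℕ → Env) => F k (ε k)) (iIndepFun_infinitePi hF) (fun k => by fun_prop)]
  refine Finset.prod_congr rfl fun k _ => ?_
  conv_rhs => rw [← Measure.infinitePi_map_eval (fun _ : ℕ => envLaw τ) k]
  rw [lintegral_map (hF k) (by fun_prop)]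

lemma lintegral_sum_infinitePi {F : Env → ℝ≥0∞} (hF : Measurable F) (n : ℕ) :
    ∫⁻ ε, ∑ k ∈ Finset.range n, F (ε k) ∂(Measure.infinitePi fun _ : ℕ => envLaw τ) =
      n * ∫⁻ e, F e ∂(envLaw τ) := by
  rw [lintegral_finsetSum _ (fun k _ => by fun_prop)]
  have : ∀ k, ∫⁻ ε, F (ε k) ∂(Measure.infinitePi fun _ : ℕ => envLaw τ) =
      ∫⁻ e, F e ∂(envLaw τ) := by
    intro k
    conv_rhs => rw [← Measure.infinitePi_map_eval (fun _ : ℕ => envLaw τ) k]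
    rw [lintegral_map hF (by fun_prop)]
  simp [this]

variable {g : ℕ → ℝ → ℝ≥0∞}

/-- A sum with a random number of terms is rewritten as a series of terms cut off by measurable
events. -/
lemma measurable_sum_range {F : ℝ × Env → ℝ≥0∞} (hF : Measurable F) {T : ℝ → ℝ}
    (hT : Measurable T) :
    Measurable fun p : (ℝ × ℕ) × (ℕ → Env) =>
      ∑ k ∈ Finset.range p.1.2, F (T p.1.1, p.2 k) := by
  have : (fun p : (ℝ × ℕ) × (ℕ → Env) => ∑ k ∈ Finset.range p.1.2, F (T p.1.1, p.2 k)) =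
      fun p => ∑' k : ℕ, if k < p.1.2 then F (T p.1.1, p.2 k) else 0 := by
    ext p
    rw [tsum_eq_sum (s := Finset.range p.1.2)]
    · exact Finset.sum_congr rfl fun k hk => by simp [Finset.mem_range.1 hk]
    · intro k hk
      simp only [Finset.mem_range] at hk
      simp [hk]
  rw [this]
  refine Measurable.tsum fun k => Measurable.ite ?_ (by fun_prop) measurable_const
  exact measurableSet_lt measurable_const (by fun_prop)

/-- `T` turns the root's displacement into its location: a constant `T` gives a tree with fixed
root, `T x = t + x` gives a child of a particle at `t`. One computation thus serves both recursions.
-/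
lemma lintegral_expNeg_treeSum_comp (hg : ∀ n, Measurable (g n)) {T : ℝ → ℝ} (hT : Measurable T) :
    ∫⁻ e, expNeg (treeSum g (T (e []).1) e) ∂(envLaw τ) =
      ∫⁻ x, expNeg (g 0 (T x.1)) *
        (∫⁻ e, expNeg (childSum (fun n => g (n + 1)) (T x.1) e) ∂(envLaw τ)) ^ x.2 ∂τ := by
  have hD := measurable_childSum (g := fun n => g (n + 1)) (fun n => hg _)
  have h1 := measurable_sum_range hD hT
  have h0 := hg 0
  simp_rw [treeSum_eq]
  rw [lintegral_envLaw (F := fun p : (ℝ × ℕ) × (ℕ → Env) => expNeg (g 0 (T p.1.1) +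
    ∑ k ∈ Finset.range p.1.2, childSum (fun n => g (n + 1)) (T p.1.1) (p.2 k)))
    (measurable_expNeg.comp (Measurable.add (by fun_prop) h1))]
  refine lintegral_congr fun x => ?_
  have h2 : Measurable fun e => childSum (fun n => g (n + 1)) (T x.1) e :=
    hD.comp measurable_prodMk_left
  simp_rw [expNeg_add, expNeg_sum]
  rw [lintegral_const_mul _ (Finset.measurable_prod _ fun k _ => by fun_prop),
    lintegral_prod_infinitePi (F := fun _ e => expNeg (childSum (fun n => g (n + 1)) (T x.1) e))
      (fun _ => by fun_prop)]
  simp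

lemma lintegral_treeSum_comp (hg : ∀ n, Measurable (g n)) {T : ℝ → ℝ} (hT : Measurable T) :
    ∫⁻ e, treeSum g (T (e []).1) e ∂(envLaw τ) =
      ∫⁻ x, (g 0 (T x.1) +
        x.2 * ∫⁻ e, childSum (fun n => g (n + 1)) (T x.1) e ∂(envLaw τ)) ∂τ := by
  have hD := measurable_childSum (g := fun n => g (n + 1)) (fun n => hg _)
  have h1 := measurable_sum_range hD hT
  have h0 := hg 0
  simp_rw [treeSum_eq]
  rw [lintegral_envLaw (F := fun p : (ℝ × ℕ) × (ℕ → Env) => g 0 (T p.1.1) +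
    ∑ k ∈ Finset.range p.1.2, childSum (fun n => g (n + 1)) (T p.1.1) (p.2 k))
    (Measurable.add (by fun_prop) h1)]
  refine lintegral_congr fun x => ?_
  have h2 : Measurable fun e => childSum (fun n => g (n + 1)) (T x.1) e :=
    hD.comp measurable_prodMk_left
  dsimp only
  rw [lintegral_const_add_of_isProbabilityMeasure, lintegral_sum_infinitePi h2]

end TreeLaw

/-! ### Recursions for Laplace functionals and means of trees. -/

section Branching

variable {κ : Measure ℝ} [IsProbabilityMeasure κ] {π : Measure ℕ} [IsProbabilityMeasure π]

lemma lintegral_expNeg_treeSum {g : ℕ → ℝ → ℝ≥0∞} (hg : ∀ n, Measurable (g n)) (t : ℝ) :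
    ∫⁻ e, expNeg (treeSum g t e) ∂(envLaw (κ.prod π)) = expNeg (g 0 t) *
      ∫⁻ n, (∫⁻ e, expNeg (childSum (fun n => g (n + 1)) t e) ∂(envLaw (κ.prod π))) ^ n ∂π := by
  rw [lintegral_expNeg_treeSum_comp (τ := κ.prod π) hg (T := fun _ => t) measurable_const,
    lintegral_const_mul _ (by fun_prop), lintegral_prod _ (by fun_prop)]
  simp

lemma measurable_lintegral_childSum {τ : Measure (ℝ × ℕ)} [IsProbabilityMeasure τ]
    {g : ℕ → ℝ → ℝ≥0∞} (hg : ∀ n, Measurable (g n)) :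
    Measurable fun t => ∫⁻ e, childSum g t e ∂(envLaw τ) :=
  Measurable.lintegral_prod_right' (measurable_childSum hg)

lemma measurable_lintegral_expNeg_childSum {τ : Measure (ℝ × ℕ)} [IsProbabilityMeasure τ]
    {g : ℕ → ℝ → ℝ≥0∞} (hg : ∀ n, Measurable (g n)) :
    Measurable fun t => ∫⁻ e, expNeg (childSum g t e) ∂(envLaw τ) :=
  Measurable.lintegral_prod_right' (f := fun p : ℝ × Env => expNeg (childSum g p.1 p.2))
    (measurable_expNeg.comp (measurable_childSum hg))

lemma measurable_lintegral_expNeg_treeSum {τ : Measure (ℝ × ℕ)} [IsProbabilityMeasure τ]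
    {g : ℕ → ℝ → ℝ≥0∞} (hg : ∀ n, Measurable (g n)) :
    Measurable fun t => ∫⁻ e, expNeg (treeSum g t e) ∂(envLaw τ) :=
  Measurable.lintegral_prod_right' (f := fun p : ℝ × Env => expNeg (treeSum g p.1 p.2))
    (measurable_expNeg.comp (measurable_treeSum hg))

lemma lintegral_expNeg_childSum {g : ℕ → ℝ → ℝ≥0∞} (hg : ∀ n, Measurable (g n)) (t : ℝ) :
    ∫⁻ e, expNeg (childSum g t e) ∂(envLaw (κ.prod π)) =
      shiftOp κ (fun s => ∫⁻ e, expNeg (treeSum g s e) ∂(envLaw (κ.prod π))) t := by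
  have h1 := measurable_lintegral_expNeg_childSum (τ := κ.prod π) (g := fun n => g (n + 1))
    fun n => hg _
  have h0 := hg 0
  unfold shiftOp
  simp_rw [lintegral_expNeg_treeSum hg]
  simp_rw [childSum]
  rw [lintegral_expNeg_treeSum_comp (τ := κ.prod π) hg (T := fun x => t + x)
    (by fun_prop), lintegral_prod]
  · refine lintegral_congr fun s => ?_
    dsimp only
    rw [lintegral_const_mul _ .of_discrete]
    rfl
  · refine Measurable.aemeasurable (Measurable.mul (by fun_prop) ?_)
    refine measurable_from_prod_countable_left fun n => ?_
    exact Measurable.pow_const (h1.comp (measurable_const_add t)) _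

lemma lintegral_treeSum (hπ : ∫⁻ n, (n : ℝ≥0∞) ∂π = 1) {g : ℕ → ℝ → ℝ≥0∞}
    (hg : ∀ n, Measurable (g n)) (t : ℝ) :
    ∫⁻ e, treeSum g t e ∂(envLaw (κ.prod π)) = g 0 t +
      ∫⁻ e, childSum (fun n => g (n + 1)) t e ∂(envLaw (κ.prod π)) := by
  rw [lintegral_treeSum_comp (τ := κ.prod π) hg (T := fun _ => t) measurable_const,
    lintegral_const_add_of_isProbabilityMeasure, lintegral_mul_const _ (by fun_prop),
    lintegral_prod (fun x : ℝ × ℕ => (x.2 : ℝ≥0∞)) (by fun_prop)]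
  simp [hπ]

lemma lintegral_childSum (hπ : ∫⁻ n, (n : ℝ≥0∞) ∂π = 1) {g : ℕ → ℝ → ℝ≥0∞}
    (hg : ∀ n, Measurable (g n)) (t : ℝ) :
    ∫⁻ e, childSum g t e ∂(envLaw (κ.prod π)) =
      shiftOp κ (fun s => ∫⁻ e, treeSum g s e ∂(envLaw (κ.prod π))) t := by
  have h1 := measurable_lintegral_childSum (τ := κ.prod π) (g := fun n => g (n + 1))
    fun n => hg _
  have h0 := hg 0
  unfold shiftOp
  simp_rw [lintegral_treeSum hπ hg]
  simp_rw [childSum]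
  rw [lintegral_treeSum_comp (τ := κ.prod π) hg (T := fun x => t + x)
    (by fun_prop), lintegral_prod]
  · refine lintegral_congr fun s => ?_
    dsimp only
    rw [lintegral_const_add_of_isProbabilityMeasure, lintegral_mul_const _ .of_discrete, hπ,
      one_mul]
    rfl
  · refine Measurable.aemeasurable (Measurable.add (by fun_prop) (Measurable.mul (by fun_prop) ?_))
    exact h1.comp (f := fun x : ℝ × ℕ => t + x.1) (by fun_prop)

/-- The mean of the sum of `g` over a critical tree. -/
lemma lintegral_treeSum_eq_renewal (hπ : ∫⁻ n, (n : ℝ≥0∞) ∂π = 1) {g : ℝ → ℝ≥0∞}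
    (hg : Measurable g) (t : ℝ) :
    ∫⁻ e, treeSum (fun _ => g) t e ∂(envLaw (κ.prod π)) = shiftOp (renewalMeasure κ) g t := by
  have hmeas : ∀ n m : ℕ, Measurable (if m = n then g else 0) := fun n m => by
    split_ifs; exacts [hg, measurable_const]
  have hz : ∀ t e, childSum (fun _ => (0 : ℝ → ℝ≥0∞)) t e = 0 := by
    intro t e; simp [childSum, treeSum]
  -- Restricting `g` to generation `n` isolates that generation; its mean is `n` applications of
  -- `shiftOp κ`, as the offspring mean is one. This is the purpose of the generation argument in
  -- `treeSum`.
  have hgen : ∀ n t, ∫⁻ e, treeSum (fun m => if m = n then g else 0) t e ∂(envLaw (κ.prod π)) =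
      (shiftOp κ)^[n] g t := by
    intro n
    induction n with
    | zero => intro t; rw [lintegral_treeSum hπ (hmeas 0)]; simp [hz]
    | succ n ih =>
      intro t
      rw [lintegral_treeSum hπ (hmeas (n + 1)), lintegral_childSum hπ (fun m => hmeas _ _)]
      simp only [Nat.add_right_cancel_iff, ih, Function.iterate_succ_apply']
      simp
  rw [shiftOp_renewalMeasure hg, ← tsum_congr fun n => hgen n t, ← lintegral_tsum]
  · refine lintegral_congr fun e => ?_
    unfold treeSum
    rw [ENNReal.tsum_comm]
    refine tsum_congr fun l => ?_
    split_ifs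
    · rw [tsum_eq_single l.length (fun n hn => by simp [hn.symm])]
      simp
    · simp
  · exact fun n => ((measurable_treeSum (hmeas n)).comp measurable_prodMk_left).aemeasurable

end Branching

/-! ### Mixed Poisson offspring and the equation for the cluster exponent. -/

/-- The law of the displacements. -/
abbrev displacementLaw (φ : ℝ → ℝ) : Measure ℝ := volume.withDensity fun s => ENNReal.ofReal (φ s)

/-- The law of the number of children of a particle. -/
def offspringLaw (ν : Measure ℝ≥0) : Measure ℕ := (ν ⊗ₘ poissonOffspring).map Prod.snd

/-- The environment of the tree of the `j`-th exogenous particle. -/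
def Ingredients.env {Ω : Type*} (S : Ingredients Ω) (ω : Ω) (j : ℕ) : Env :=
  fun l => (S.displacement (j, l) ω, S.offspring (j, l) ω)

section OffspringLaw

variable {ν : Measure ℝ≥0} [IsProbabilityMeasure ν]

instance : IsProbabilityMeasure (offspringLaw ν) :=
  Measure.isProbabilityMeasure_map measurable_snd.aemeasurable

lemma lintegral_offspringLaw (F : ℕ → ℝ≥0∞) :
    ∫⁻ n, F n ∂(offspringLaw ν) = ∫⁻ x, ∫⁻ n, F n ∂(poissonMeasure x) ∂ν := by
  rw [offspringLaw, lintegral_map .of_discrete measurable_snd,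
    Measure.lintegral_compProd (f := fun p => F p.2) (Measurable.comp .of_discrete measurable_snd)]
  rfl

lemma lintegral_natCast_offspringLaw :
    ∫⁻ n, (n : ℝ≥0∞) ∂(offspringLaw ν) = ∫⁻ x, (x : ℝ≥0∞) ∂ν := by
  simp_rw [lintegral_offspringLaw, lintegral_natCast_poissonMeasure]

lemma lintegral_pow_offspringLaw {b : ℝ≥0∞} (hb : b ≤ 1) :
    ∫⁻ n, b ^ n ∂(offspringLaw ν) =
      ∫⁻ x : ℝ≥0, ENNReal.ofReal (Real.exp (-(x * (1 - b).toReal))) ∂ν := by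
  have hb' : b ≠ ∞ := ne_top_of_le_ne_top (by simp) hb
  rw [lintegral_offspringLaw]
  refine lintegral_congr fun x => ?_
  rw [ENNReal.toReal_sub_of_le hb (by simp), ENNReal.toReal_one,
    ← lintegral_pow_poissonMeasure _ ENNReal.toReal_nonneg, ENNReal.ofReal_toReal hb']

end OffspringLaw

section ClusterEquation

variable {κ : Measure ℝ} [IsProbabilityMeasure κ] {ν : Measure ℝ≥0} [IsProbabilityMeasure ν]

/-- One minus the Laplace functional of a tree, as a function of the location of its root. -/
def clusterExponent (κ : Measure ℝ) [IsProbabilityMeasure κ] (ν : Measure ℝ≥0)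
    [IsProbabilityMeasure ν] (h : ℝ → ℝ≥0∞) (t : ℝ) : ℝ≥0∞ :=
  1 - ∫⁻ e, expNeg (treeSum (fun _ => h) t e) ∂(envLaw (κ.prod (offspringLaw ν)))

variable {h : ℝ → ℝ≥0∞}

lemma lintegral_expNeg_le_one {X : Type*} [MeasurableSpace X] (m : Measure X)
    [IsProbabilityMeasure m] (F : X → ℝ≥0∞) : ∫⁻ x, expNeg (F x) ∂m ≤ 1 :=
  (lintegral_mono fun _ => expNeg_le_one _).trans_eq (by simp)

lemma measurable_clusterExponent (hh : Measurable h) : Measurable (clusterExponent κ ν h) :=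
  (measurable_lintegral_expNeg_treeSum fun _ => hh).const_sub _

lemma shiftOp_clusterExponent (hh : Measurable h) (t : ℝ) :
    shiftOp κ (clusterExponent κ ν h) t =
      1 - ∫⁻ e, expNeg (childSum (fun _ => h) t e) ∂(envLaw (κ.prod (offspringLaw ν))) := by
  have hm := measurable_lintegral_expNeg_treeSum (τ := κ.prod (offspringLaw ν))
    (g := fun _ => h) fun _ => hh
  have hle : ∫⁻ s, (∫⁻ e, expNeg (treeSum (fun _ => h) (t + s) e)
      ∂(envLaw (κ.prod (offspringLaw ν)))) ∂κ ≤ 1 :=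
    (lintegral_mono fun s => lintegral_expNeg_le_one _ _).trans_eq (by simp)
  rw [lintegral_expNeg_childSum (fun _ => hh)]
  simp only [shiftOp, clusterExponent]
  have hm' : Measurable fun s => ∫⁻ e, expNeg (treeSum (fun _ => h) (t + s) e)
    ∂(envLaw (κ.prod (offspringLaw ν))) := hm.comp (measurable_const_add t)
  rw [lintegral_sub hm' (ne_top_of_le_ne_top (by simp) hle)
    (Eventually.of_forall fun s => lintegral_expNeg_le_one _ _)]
  simp

lemma clusterExponent_eq (hh : Measurable h) (t : ℝ) :
    clusterExponent κ ν h t = 1 - expNeg (h t) * ∫⁻ x : ℝ≥0,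
      ENNReal.ofReal (Real.exp (-(x * (shiftOp κ (clusterExponent κ ν h) t).toReal))) ∂ν := by
  rw [shiftOp_clusterExponent hh, clusterExponent, lintegral_expNeg_treeSum fun _ => hh,
    lintegral_pow_offspringLaw (lintegral_expNeg_le_one _ _)]

/-- From `1 - e^{-x} ≤ x` and the mean formula. This is the a priori bound that the iteration of the
renewal equation requires. -/
lemma clusterExponent_le (hν : ∫⁻ x, (x : ℝ≥0∞) ∂ν = 1) (hh : Measurable h) :
    clusterExponent κ ν h ≤ shiftOp (renewalMeasure κ) h := by
  intro t
  have hm : Measurable fun e => treeSum (fun _ => h) t e :=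
    (measurable_treeSum fun _ => hh).comp measurable_prodMk_left
  rw [← lintegral_treeSum_eq_renewal (π := offspringLaw ν)
    (by rw [lintegral_natCast_offspringLaw, hν]) hh, clusterExponent]
  have : ∫⁻ e, (1 - expNeg (treeSum (fun _ => h) t e)) ∂(envLaw (κ.prod (offspringLaw ν))) =
      1 - ∫⁻ e, expNeg (treeSum (fun _ => h) t e) ∂(envLaw (κ.prod (offspringLaw ν))) := by
    rw [lintegral_sub (by fun_prop)
      (ne_top_of_le_ne_top (by simp) (lintegral_expNeg_le_one _ _))
      (Eventually.of_forall fun s => expNeg_le_one _)]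
    simp
  rw [← this]
  exact lintegral_mono fun e => one_sub_expNeg_le _

end ClusterEquation

/-! ### From a single tree to the whole branching system. -/

section System

variable {Ω : Type*} [MeasurableSpace Ω] {P : Measure Ω} [IsProbabilityMeasure P]
  {S : Ingredients Ω} {μ : ℝ} {φ : ℝ → ℝ} [IsProbabilityMeasure (displacementLaw φ)]
  {ν : Measure ℝ≥0} [IsProbabilityMeasure ν]

omit [MeasurableSpace Ω] in
lemma Ingredients.present_iff (S : Ingredients Ω) (ω : Ω) (j : ℕ) (l : List ℕ) :
    S.Present ω j l ↔ present (S.env ω j) l := by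
  induction l with
  | nil => simp [Ingredients.Present, present]
  | cons k l ih => simp only [Ingredients.Present, present, ih]; rfl

omit [MeasurableSpace Ω] in
lemma Ingredients.time_eq (S : Ingredients Ω) (ω : Ω) (j : ℕ) (l : List ℕ) :
    S.time ω j l = position (S.env ω j) (S.arrival j ω) l := by
  induction l with
  | nil => simp [Ingredients.time, position]
  | cons k l ih => simp only [Ingredients.time, position, ih]; rfl

omit [MeasurableSpace Ω] in
lemma Ingredients.lintegral_N (S : Ingredients Ω) (ω : Ω) {h : ℝ → ℝ≥0∞} (hh : Measurable h) :
    ∫⁻ t, h t ∂(S.N ω) = ∑' j, treeSum (fun _ => h) (S.arrival j ω) (S.env ω j) := by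
  rw [Ingredients.N, lintegral_map hh measurable_fst, Ingredients.M, lintegral_sum_measure,
    ENNReal.tsum_prod']
  refine tsum_congr fun j => tsum_congr fun l => ?_
  by_cases hp : present (S.env ω j) l
  · rw [if_pos hp, if_pos ((S.present_iff ω j l).2 hp), lintegral_dirac' _ (by fun_prop),
      S.time_eq]
  · rw [if_neg hp, if_neg (mt (S.present_iff ω j l).1 hp), lintegral_zero_measure]

namespace IsBranchingSystem

omit [IsProbabilityMeasure P] [IsProbabilityMeasure (displacementLaw φ)] in
lemma measurable_env (hS : IsBranchingSystem P S μ φ ν) : Measurable fun ω j => S.env ω j := by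
  have := hS.measurable_displacement
  have := hS.measurable_offspring
  unfold Ingredients.env
  fun_prop

-- Marks influence the tree only through the offspring numbers, so projecting them away leaves
-- independent pairs (displacement, offspring number) of product law.
omit [IsProbabilityMeasure P] in
lemma map_env (hS : IsBranchingSystem P S μ φ ν) : P.map (fun ω j => S.env ω j) =
    Measure.infinitePi fun _ : ℕ => envLaw ((displacementLaw φ).prod (offspringLaw ν)) := by
  set p : ℝ × ℝ≥0 × ℕ → ℝ × ℕ := fun x => (x.1, x.2.2) with hp
  have hpm : Measurable p := by fun_prop
  have hd := hS.measurable_displacement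
  have ho := hS.measurable_offspring
  have hk := hS.measurable_mark
  have hlaw : ∀ u : Label, P.map (fun ω => (S.displacement u ω, S.offspring u ω)) =
      (displacementLaw φ).prod (offspringLaw ν) := by
    intro u
    have h1 := congrArg (Measure.map p) (hS.law_particle u).map_eq
    rw [Measure.map_map hpm (by fun_prop)] at h1
    have h2 := Measure.map_prod_map (displacementLaw φ) (ν ⊗ₘ poissonOffspring) measurable_id
      (measurable_snd (α := ℝ≥0) (β := ℕ))
    rw [Measure.map_id] at h2
    rw [offspringLaw, h2]
    exact h1
  have h1 : iIndepFun (fun (u : Label) ω => (S.displacement u ω, S.offspring u ω)) P :=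
    hS.indep_particle.comp (fun _ => p) fun _ => hpm
  have h2 := h1.map_fun_eq_infinitePi_map fun u => by fun_prop
  simp_rw [hlaw] at h2
  have h3 := Measure.infinitePi_map_curry
    (fun (_ : ℕ) (_ : List ℕ) => (displacementLaw φ).prod (offspringLaw ν))
  rw [← h3, ← h2, Measure.map_map (by fun_prop) (by fun_prop)]
  rfl

lemma map_arrival_env (hS : IsBranchingSystem P S μ φ ν) :
    P.map (fun ω => (fun j => S.arrival j ω, fun j => S.env ω j)) =
      (P.map fun ω j => S.arrival j ω).prod
        (Measure.infinitePi fun _ : ℕ => envLaw ((displacementLaw φ).prod (offspringLaw ν))) := by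
  have ha := hS.measurable_arrival
  have h := hS.indep_arrival.comp (φ := id)
    (ψ := fun (y : Label → ℝ × ℝ≥0 × ℕ) (j : ℕ) (l : List ℕ) => ((y (j, l)).1, (y (j, l)).2.2))
    measurable_id (by fun_prop)
  rw [← hS.map_env]
  exact h.map_prod_eq_prod_map_map (Measurable.aemeasurable (by fun_prop))
    hS.measurable_env.aemeasurable

lemma lintegral_arrival_env (hS : IsBranchingSystem P S μ φ ν)
    {F : (ℕ → ℝ) × (ℕ → Env) → ℝ≥0∞} (hF : Measurable F) :
    ∫⁻ ω, F (fun j => S.arrival j ω, fun j => S.env ω j) ∂P =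
      ∫⁻ ω, ∫⁻ ε, F (fun j => S.arrival j ω, ε) ∂(Measure.infinitePi fun _ : ℕ =>
        envLaw ((displacementLaw φ).prod (offspringLaw ν))) ∂P := by
  have ha := hS.measurable_arrival
  have h1 : Measurable fun ω j => S.arrival j ω := by fun_prop
  have h2 : Measurable fun ω => ((fun j => S.arrival j ω, fun j => S.env ω j) :
    (ℕ → ℝ) × (ℕ → Env)) := h1.prodMk hS.measurable_env
  rw [← lintegral_map (f := F) hF h2, hS.map_arrival_env, lintegral_prod _ hF.aemeasurable,
    lintegral_map hF.lintegral_prod_right' h1]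

lemma sigmaFinite_intensity (μ : ℝ) :
    SigmaFinite (ENNReal.ofReal μ • volume.restrict (Ici (0 : ℝ))) :=
  inferInstanceAs (SigmaFinite (μ.toNNReal • volume.restrict (Ici (0 : ℝ))))

variable {h : ℝ → ℝ≥0∞}

omit [MeasurableSpace Ω] in
lemma lintegral_arrivals (hh : Measurable h) (ω : Ω) :
    ∫⁻ t, h t ∂(Measure.sum fun j : ℕ => Measure.dirac (S.arrival j ω)) =
      ∑' j, h (S.arrival j ω) := by
  rw [lintegral_sum_measure]
  exact tsum_congr fun j => lintegral_dirac' _ hh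

omit [IsProbabilityMeasure P] [IsProbabilityMeasure (displacementLaw φ)] in
lemma measurable_lintegral_N (hS : IsBranchingSystem P S μ φ ν) (hh : Measurable h) :
    Measurable fun ω => ∫⁻ t, h t ∂(S.N ω) := by
  simp_rw [S.lintegral_N _ hh]
  refine Measurable.tsum fun j => ?_
  exact (measurable_treeSum fun _ => hh).comp
    ((hS.measurable_arrival j).prodMk ((measurable_pi_apply j).comp hS.measurable_env))

/-- The mean measure of the event times. -/
lemma lintegral_lintegral_N (hS : IsBranchingSystem P S μ φ ν)
    (hν : ∫⁻ x, (x : ℝ≥0∞) ∂ν = 1) (hh : Measurable h) :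
    ∫⁻ ω, ∫⁻ t, h t ∂(S.N ω) ∂P =
      ENNReal.ofReal μ * ∫⁻ t in Ici 0, shiftOp (renewalMeasure (displacementLaw φ)) h t := by
  have hT : ∀ j : ℕ, Measurable fun p : (ℕ → ℝ) × (ℕ → Env) =>
      treeSum (fun _ => h) (p.1 j) (p.2 j) := fun j =>
    (measurable_treeSum fun _ => hh).comp (f := fun p : (ℕ → ℝ) × (ℕ → Env) => (p.1 j, p.2 j))
      (by fun_prop)
  simp_rw [S.lintegral_N _ hh]
  rw [hS.lintegral_arrival_env (F := fun p => ∑' j, treeSum (fun _ => h) (p.1 j) (p.2 j))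
    (Measurable.tsum hT)]
  have h1 : ∀ a : ℕ → ℝ, ∫⁻ ε, ∑' j, treeSum (fun _ => h) (a j) (ε j)
      ∂(Measure.infinitePi fun _ : ℕ => envLaw ((displacementLaw φ).prod (offspringLaw ν))) =
      ∑' j, shiftOp (renewalMeasure (displacementLaw φ)) h (a j) := by
    intro a
    have hm : ∀ j, Measurable fun e => treeSum (fun _ => h) (a j) e := fun j =>
      (measurable_treeSum fun _ => hh).comp measurable_prodMk_left
    have hm' : ∀ j, Measurable fun ε : ℕ → Env => treeSum (fun _ => h) (a j) (ε j) := fun j =>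
      (hm j).comp (measurable_pi_apply j)
    rw [lintegral_tsum fun j => (hm' j).aemeasurable]
    refine tsum_congr fun j => ?_
    rw [← lintegral_treeSum_eq_renewal (π := offspringLaw ν)
      (by rw [lintegral_natCast_offspringLaw, hν]) hh]
    conv_rhs => rw [← Measure.infinitePi_map_eval (fun _ : ℕ => envLaw _) j,
      lintegral_map (hm j) (by fun_prop)]
  simp_rw [h1]
  have := sigmaFinite_intensity μ
  have hsm : Measurable (shiftOp (renewalMeasure (displacementLaw φ)) h) := measurable_shiftOp hh
  have h2 := hS.poisson_arrival.lintegral_lintegral hsm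
  simp_rw [lintegral_arrivals hsm, lintegral_smul_measure] at h2
  exact h2

/-- The Laplace functional of the event times. -/
lemma lintegral_expNeg_N (hS : IsBranchingSystem P S μ φ ν) (hh : Measurable h) :
    ∫⁻ ω, expNeg (∫⁻ t, h t ∂(S.N ω)) ∂P =
      expNeg (ENNReal.ofReal μ * ∫⁻ t in Ici 0, clusterExponent (displacementLaw φ) ν h t) := by
  set τ := (displacementLaw φ).prod (offspringLaw ν) with hτ
  set V : ℝ → ℝ≥0∞ := fun t => ∫⁻ e, expNeg (treeSum (fun _ => h) t e) ∂(envLaw τ) with hV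
  have hVm : Measurable V := measurable_lintegral_expNeg_treeSum fun _ => hh
  have hV1 : ∀ t, V t ≤ 1 := fun t => lintegral_expNeg_le_one _ _
  have hT : ∀ j : ℕ, Measurable fun p : (ℕ → ℝ) × (ℕ → Env) =>
      treeSum (fun _ => h) (p.1 j) (p.2 j) := fun j =>
    (measurable_treeSum fun _ => hh).comp (f := fun p : (ℕ → ℝ) × (ℕ → Env) => (p.1 j, p.2 j))
      (by fun_prop)
  -- With `k = -log V` the product of the `V (a j)` given the arrivals `a` becomes `expNeg (∑' j, k
  -- (a j))`, to which the Poisson Laplace functional applies. Where `V` vanishes, `k` is `∞`.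
  set k : ℝ → ℝ≥0∞ := fun t => (-ENNReal.log (V t)).toENNReal with hk
  have hkm : Measurable k := by
    have h1 : Measurable fun t => -ENNReal.log (V t) :=
      continuous_neg.measurable.comp (ENNReal.measurable_log.comp hVm)
    exact h1.ereal_toENNReal
  have hkV : ∀ t, expNeg (k t) = V t := by
    intro t
    rw [hk, expNeg, EReal.coe_toENNReal, neg_neg, ENNReal.exp_log]
    simpa using hV1 t
  simp_rw [S.lintegral_N _ hh]
  rw [hS.lintegral_arrival_env (F := fun p => expNeg (∑' j, treeSum (fun _ => h) (p.1 j) (p.2 j)))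
    (measurable_expNeg.comp (Measurable.tsum hT))]
  have h1 : ∀ a : ℕ → ℝ, ∫⁻ ε, expNeg (∑' j, treeSum (fun _ => h) (a j) (ε j))
      ∂(Measure.infinitePi fun _ : ℕ => envLaw τ) = expNeg (∑' j, k (a j)) := by
    intro a
    have hm : ∀ j, Measurable fun e => expNeg (treeSum (fun _ => h) (a j) e) := fun j =>
      measurable_expNeg.comp ((measurable_treeSum fun _ => hh).comp measurable_prodMk_left)
    have hl : Tendsto (fun n => ∫⁻ ε, ∏ j ∈ Finset.range n, expNeg (treeSum (fun _ => h) (a j) (ε j))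
        ∂(Measure.infinitePi fun _ : ℕ => envLaw τ)) atTop
        (𝓝 (∫⁻ ε, expNeg (∑' j, treeSum (fun _ => h) (a j) (ε j))
          ∂(Measure.infinitePi fun _ : ℕ => envLaw τ))) := by
      refine tendsto_lintegral_of_dominated_convergence (fun _ => 1) (fun n => ?_) (fun n => ?_)
        (by simp) ?_
      · exact Finset.measurable_prod _ fun j _ => (hm j).comp (measurable_pi_apply j)
      · exact Eventually.of_forall fun ε => Finset.prod_le_one' fun j _ => expNeg_le_one _
      · exact Eventually.of_forall fun ε => tendsto_prod_expNeg _
    have hr := tendsto_prod_expNeg fun j => k (a j)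
    simp_rw [lintegral_prod_infinitePi (F := fun j e => expNeg (treeSum (fun _ => h) (a j) e)) hm]
      at hl
    simp_rw [hkV] at hr
    exact tendsto_nhds_unique hl hr
  simp_rw [← hτ, h1]
  have := sigmaFinite_intensity μ
  have h2 := hS.poisson_arrival.lintegral_expNeg hkm
  simp_rw [lintegral_arrivals hkm, lintegral_smul_measure, hkV] at h2
  exact h2

end IsBranchingSystem

end System

/-! ### Abelian asymptotics for heavy tails, with the Gamma integrals they need. -/

section Abelian

variable {X : Type*} [MeasurableSpace X] {m : Measure X} [IsProbabilityMeasure m] {F : X → ℝ}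

/-- Convergence bounds the expression beyond some `x₀`; below it the probability is at most one. -/
lemma exists_rpow_mul_tail_le {p c : ℝ} (hp : 0 < p)
    (h : Tendsto (fun x : ℝ => x ^ p * m.real {z | x < F z}) atTop (𝓝 c)) :
    ∃ B : ℝ, ∀ x, 0 < x → x ^ p * m.real {z | x < F z} ≤ B := by
  obtain ⟨x₀, hx₀⟩ := eventually_atTop.1 (h.eventually (gt_mem_nhds (lt_add_one c)))
  refine ⟨max (c + 1) (max x₀ 0 ^ p), fun x hx => ?_⟩
  rcases le_total x₀ x with h1 | h1
  · exact (hx₀ x h1).le.trans (le_max_left _ _)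
  · refine le_trans ?_ (le_max_right _ _)
    calc x ^ p * m.real {z | x < F z} ≤ x ^ p * 1 := by
          gcongr; exact measureReal_le_one
      _ ≤ max x₀ 0 ^ p := by
          rw [mul_one]; gcongr; exact h1.trans (le_max_left _ _)

/-- The layer cake formula for `l * F`. -/
lemma integral_integral_eq_integral_tail (hF : Measurable F) (hF0 : 0 ≤ᵐ[m] F) {g : ℝ → ℝ}
    (hg : Continuous g) (hg0 : ∀ z, 0 ≤ z → 0 ≤ g z) {l : ℝ} (hl : 0 < l) :
    ∫ x, (∫ t in (0 : ℝ)..(l * F x), g t) ∂m =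
      ∫ z in Ioi 0, g z * m.real {x | z / l < F x} := by
  have hlF : 0 ≤ᵐ[m] fun x => l * F x := hF0.mono fun x hx => mul_nonneg hl.le hx
  have hanti : Measurable fun z : ℝ => m.real {x | z / l < F x} := by
    have : Antitone fun z : ℝ => m.real {x | z / l < F x} := fun a b hab =>
      measureReal_mono fun x (hx : b / l < F x) =>
        lt_of_le_of_lt (div_le_div_of_nonneg_right hab hl.le) hx
    exact this.measurable
  have hcont : Continuous fun y : ℝ => ∫ t in (0 : ℝ)..y, g t :=
    intervalIntegral.continuous_primitive (fun a b => hg.intervalIntegrable a b) 0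
  rw [integral_eq_lintegral_of_nonneg_ae, integral_eq_lintegral_of_nonneg_ae,
    lintegral_comp_eq_lintegral_meas_lt_mul m hlF (by fun_prop)
      (fun t _ => hg.intervalIntegrable 0 t)]
  · congr 1
    refine lintegral_congr fun z => ?_
    have : {a | z < l * F a} = {x | z / l < F x} := by
      ext x
      change z < l * F x ↔ z / l < F x
      rw [div_lt_iff₀ hl, mul_comm]
    rw [this, mul_comm, ENNReal.ofReal_mul' measureReal_nonneg, ofReal_measureReal]
  · exact (ae_restrict_iff' measurableSet_Ioi).2 (Eventually.of_forall fun z hz => hg0 z hz.le)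
  · exact (ae_restrict_iff' measurableSet_Ioi).2 (Eventually.of_forall fun z hz =>
      mul_nonneg (hg0 z (le_of_lt hz)) measureReal_nonneg)
  · exact (hg.measurable.mul hanti).aestronglyMeasurable
  · filter_upwards [hlF] with x hx
    exact intervalIntegral.integral_nonneg hx fun t ht => hg0 t ht.1
  · exact (hcont.measurable.comp (hF.const_mul l)).aestronglyMeasurable

/-- An Abelian theorem for laws with a regularly varying tail. -/
lemma tendsto_rpow_mul_integral (hF : Measurable F) (hF0 : 0 ≤ᵐ[m] F) {g : ℝ → ℝ}
    (hg : Continuous g) (hg0 : ∀ z, 0 ≤ z → 0 ≤ g z) {p c : ℝ} (hp : 0 < p)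
    (hint : IntegrableOn (fun z => g z * z ^ (-p)) (Ioi 0))
    (h : Tendsto (fun x : ℝ => x ^ p * m.real {z | x < F z}) atTop (𝓝 c)) :
    Tendsto (fun l : ℝ => l ^ (-p) * ∫ x, (∫ t in (0 : ℝ)..(l * F x), g t) ∂m) (𝓝[>] 0)
      (𝓝 ((∫ z in Ioi 0, g z * z ^ (-p)) * c)) := by
  obtain ⟨B, hB⟩ := exists_rpow_mul_tail_le hp h
  have hanti : Measurable fun z : ℝ => m.real {x | z < F x} := by
    have : Antitone fun z : ℝ => m.real {x | z < F x} := fun a b hab =>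
      measureReal_mono fun x (hx : b < F x) => lt_of_le_of_lt hab hx
    exact this.measurable
  -- Inserting `(z / l) ^ p` produces a factor that is bounded and converges to `c` for each fixed
  -- `z`, so dominated convergence applies.
  have key : ∀ l : ℝ, 0 < l → l ^ (-p) * ∫ x, (∫ t in (0 : ℝ)..(l * F x), g t) ∂m =
      ∫ z in Ioi 0, g z * z ^ (-p) * ((z / l) ^ p * m.real {x | z / l < F x}) := by
    intro l hl
    rw [integral_integral_eq_integral_tail hF hF0 hg hg0 hl, ← integral_const_mul]
    refine setIntegral_congr_fun measurableSet_Ioi fun z (hz : 0 < z) => ?_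
    rw [Real.div_rpow hz.le hl.le, Real.rpow_neg hz.le, Real.rpow_neg hl.le]
    have := Real.rpow_pos_of_pos hz p
    field_simp
  rw [← integral_mul_const]
  refine Tendsto.congr' (eventually_nhdsWithin_of_forall fun l hl => (key l hl).symm) ?_
  refine tendsto_integral_filter_of_dominated_convergence
    (fun z => ‖g z * z ^ (-p)‖ * |B|) ?_ ?_ (hint.norm.mul_const _) ?_
  · filter_upwards with l
    have h1 : Measurable fun z : ℝ => m.real {x | z / l < F x} :=
      hanti.comp (measurable_id.div_const l)
    exact Measurable.aestronglyMeasurable (by fun_prop)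
  · refine eventually_nhdsWithin_of_forall fun l (hl : 0 < l) => ?_
    refine (ae_restrict_iff' measurableSet_Ioi).2 (Eventually.of_forall fun z (hz : 0 < z) => ?_)
    rw [norm_mul]
    gcongr
    have hzl : 0 < z / l := div_pos hz hl
    rw [Real.norm_of_nonneg (mul_nonneg (Real.rpow_nonneg hzl.le _) measureReal_nonneg)]
    exact (hB _ hzl).trans (le_abs_self _)
  · refine (ae_restrict_iff' measurableSet_Ioi).2 (Eventually.of_forall fun z (hz : 0 < z) => ?_)
    have hdiv : Tendsto (fun l : ℝ => z / l) (𝓝[>] 0) atTop := by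
      simp_rw [div_eq_mul_inv]
      exact tendsto_inv_nhdsGT_zero.const_mul_atTop hz
    exact Tendsto.const_mul _ (h.comp hdiv)

end Abelian

section GammaIntegrals

lemma integrableOn_exp_neg_mul_rpow {a : ℝ} (ha : a < 1) :
    IntegrableOn (fun z : ℝ => Real.exp (-z) * z ^ (-a)) (Ioi 0) := by
  have := Real.GammaIntegral_convergent (s := 1 - a) (by linarith)
  rwa [show 1 - a - 1 = -a by ring] at this

lemma integral_exp_neg_mul_rpow {a : ℝ} (ha : a < 1) :
    ∫ z in Ioi (0 : ℝ), Real.exp (-z) * z ^ (-a) = Real.Gamma (1 - a) := by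
  rw [Real.Gamma_eq_integral (by linarith), show 1 - a - 1 = -a by ring]

lemma integral_zero_exp_neg (z : ℝ) :
    ∫ t in (0 : ℝ)..z, Real.exp (-t) = 1 - Real.exp (-z) := by
  simp [intervalIntegral.integral_comp_neg (fun t => Real.exp t)]

lemma integral_zero_one_sub_exp_neg (z : ℝ) :
    ∫ t in (0 : ℝ)..z, (1 - Real.exp (-t)) = Real.exp (-z) - 1 + z := by
  rw [intervalIntegral.integral_sub (by simp)
    (Continuous.intervalIntegrable (by fun_prop) _ _), integral_zero_exp_neg]
  simp
  ring

/-- Layer cake again, for the measure `z^{-(1+b)} dz`, whose tail is `t^{-b}/b`: writing `1 -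
e^{-z}` as an integral of `e^{-t}` leaves a Gamma integral. -/
lemma lintegral_one_sub_exp_neg_mul_rpow {b : ℝ} (hb : 0 < b) (hb1 : b < 1) :
    ∫⁻ z in Ioi (0 : ℝ), ENNReal.ofReal ((1 - Real.exp (-z)) * z ^ (-(1 + b))) =
      ENNReal.ofReal (Real.Gamma (1 - b) / b) := by
  set m := (volume.restrict (Ioi (0 : ℝ))).withDensity fun z => ENNReal.ofReal (z ^ (-(1 + b)))
    with hm
  have hpos : ∀ᵐ z ∂m, 0 ≤ z := (withDensity_absolutelyContinuous _ _).ae_le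
    ((ae_restrict_iff' measurableSet_Ioi).2 (Eventually.of_forall fun z hz => le_of_lt hz))
  have h1 := lintegral_comp_eq_lintegral_meas_lt_mul (f := fun z : ℝ => z)
    (g := fun t => Real.exp (-t)) m hpos (by fun_prop)
    (fun t _ => Continuous.intervalIntegrable (by fun_prop) 0 t)
    (Eventually.of_forall fun t => (Real.exp_pos _).le)
  simp_rw [integral_zero_exp_neg] at h1
  rw [hm, lintegral_withDensity_eq_lintegral_mul _ (by fun_prop) (by fun_prop), ← hm] at h1
  have h2 : ∀ t ∈ Ioi (0 : ℝ), m {a | t < a} * ENNReal.ofReal (Real.exp (-t)) =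
      ENNReal.ofReal (Real.exp (-t) * t ^ (-b) / b) := by
    intro t ht
    have hmt : m {a | t < a} = ENNReal.ofReal (t ^ (-b) / b) := by
      change m (Ioi t) = _
      rw [hm, withDensity_apply _ measurableSet_Ioi, Measure.restrict_restrict measurableSet_Ioi,
        inter_eq_left.2 (Ioi_subset_Ioi (le_of_lt ht)), ← ofReal_integral_eq_lintegral_ofReal,
        integral_Ioi_rpow_of_lt (by linarith) ht]
      · congr 1
        rw [show -(1 + b) + 1 = -b by ring, neg_div_neg_eq]
      · exact integrableOn_Ioi_rpow_of_lt (by linarith) ht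
      · exact (ae_restrict_iff' measurableSet_Ioi).2 (Eventually.of_forall fun z hz =>
          Real.rpow_nonneg ((le_of_lt ht).trans (le_of_lt hz)) _)
    rw [hmt, ← ENNReal.ofReal_mul (div_nonneg (Real.rpow_nonneg (le_of_lt ht) _) hb.le)]
    ring_nf
  rw [setLIntegral_congr_fun measurableSet_Ioi h2, ← ofReal_integral_eq_lintegral_ofReal,
    integral_div, integral_exp_neg_mul_rpow hb1] at h1
  · rw [← h1]
    refine setLIntegral_congr_fun measurableSet_Ioi fun z (hz : 0 < z) => ?_
    rw [Pi.mul_apply, mul_comm, ENNReal.ofReal_mul (by positivity)]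
  · exact (integrableOn_exp_neg_mul_rpow hb1).div_const b
  · exact (ae_restrict_iff' measurableSet_Ioi).2 (Eventually.of_forall fun z hz =>
      div_nonneg (mul_nonneg (Real.exp_pos _).le (Real.rpow_nonneg (le_of_lt hz) _)) hb.le)

lemma one_sub_exp_neg_nonneg {z : ℝ} (hz : 0 ≤ z) : 0 ≤ 1 - Real.exp (-z) := by
  have := Real.exp_le_one_iff.2 (neg_nonpos.2 hz)
  linarith

lemma ae_one_sub_exp_neg_mul_rpow_nonneg (b : ℝ) :
    ∀ᵐ z ∂(volume.restrict (Ioi (0 : ℝ))), 0 ≤ (1 - Real.exp (-z)) * z ^ (-(1 + b)) :=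
  (ae_restrict_iff' measurableSet_Ioi).2 (Eventually.of_forall fun _ hz =>
    mul_nonneg (one_sub_exp_neg_nonneg (le_of_lt hz)) (Real.rpow_nonneg (le_of_lt hz) _))

lemma integrableOn_one_sub_exp_neg_mul_rpow {b : ℝ} (hb : 0 < b) (hb1 : b < 1) :
    IntegrableOn (fun z : ℝ => (1 - Real.exp (-z)) * z ^ (-(1 + b))) (Ioi 0) := by
  refine ⟨Measurable.aestronglyMeasurable (by fun_prop), ?_⟩
  rw [hasFiniteIntegral_iff_ofReal (ae_one_sub_exp_neg_mul_rpow_nonneg b),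
    lintegral_one_sub_exp_neg_mul_rpow hb hb1]
  exact ENNReal.ofReal_lt_top

lemma integral_one_sub_exp_neg_mul_rpow {b : ℝ} (hb : 0 < b) (hb1 : b < 1) :
    ∫ z in Ioi (0 : ℝ), (1 - Real.exp (-z)) * z ^ (-(1 + b)) = Real.Gamma (1 - b) / b := by
  rw [integral_eq_lintegral_of_nonneg_ae (ae_one_sub_exp_neg_mul_rpow_nonneg b)
    (Measurable.aestronglyMeasurable (by fun_prop)), lintegral_one_sub_exp_neg_mul_rpow hb hb1,
    ENNReal.toReal_ofReal]
  exact div_nonneg (Real.Gamma_nonneg_of_nonneg (by linarith)) hb.le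

end GammaIntegrals

/-! ### Laplace exponents of the displacement and of the mark. -/

/-- The function `l ↦ ∫ (1 - e^{-l s}) κ(ds)`. -/
def laplaceExponent (κ : Measure ℝ) (l : ℝ) : ℝ := ∫ s, (1 - Real.exp (-(l * s))) ∂κ

/-- The function `l ↦ ∫ (e^{-l x} - 1 + l x) ν(dx)`. -/
def markExponent (ν : Measure ℝ≥0) (l : ℝ) : ℝ := ∫ x : ℝ≥0, (Real.exp (-(l * x)) - 1 + l * x) ∂ν

section LaplaceExponent

variable {κ : Measure ℝ} [IsProbabilityMeasure κ]

lemma integrable_exp_neg_mul (hκ : ∀ᵐ s ∂κ, 0 ≤ s) {l : ℝ} (hl : 0 ≤ l) :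
    Integrable (fun s => Real.exp (-(l * s))) κ := by
  refine Integrable.mono' (integrable_const 1) (Measurable.aestronglyMeasurable (by fun_prop)) ?_
  filter_upwards [hκ] with s hs
  rw [Real.norm_of_nonneg (Real.exp_pos _).le]
  exact Real.exp_le_one_iff.2 (neg_nonpos.2 (mul_nonneg hl hs))

lemma laplaceExponent_mono (hκ : ∀ᵐ s ∂κ, 0 ≤ s) {l k : ℝ} (hl : 0 ≤ l) (hlk : l ≤ k) :
    laplaceExponent κ l ≤ laplaceExponent κ k := by
  refine integral_mono_ae ((integrable_const _).sub (integrable_exp_neg_mul hκ hl))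
    ((integrable_const _).sub (integrable_exp_neg_mul hκ (hl.trans hlk))) ?_
  filter_upwards [hκ] with s hs
  gcongr

lemma tendsto_laplaceExponent (hκ : ∀ᵐ s ∂κ, 0 ≤ s) {a c : ℝ} (ha : 0 < a) (ha1 : a < 1)
    (h : Tendsto (fun x : ℝ => x ^ a * κ.real (Ioi x)) atTop (𝓝 c)) :
    Tendsto (fun l : ℝ => l ^ (-a) * laplaceExponent κ l) (𝓝[>] 0)
      (𝓝 (Real.Gamma (1 - a) * c)) := by
  have := tendsto_rpow_mul_integral (m := κ) (F := fun s => s) measurable_id hκ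
    (g := fun t => Real.exp (-t)) (by fun_prop) (fun _ _ => (Real.exp_pos _).le) ha
    (integrableOn_exp_neg_mul_rpow ha1) h
  simpa only [integral_zero_exp_neg, integral_exp_neg_mul_rpow ha1, laplaceExponent] using this

lemma lintegral_exp_renewalMeasure_eq (hκ : ∀ᵐ s ∂κ, 0 ≤ s) {l : ℝ} (hl : 0 ≤ l)
    (hpos : 0 < laplaceExponent κ l) :
    ∫⁻ s, ENNReal.ofReal (Real.exp (-(l * s))) ∂(renewalMeasure κ) =
      ENNReal.ofReal (1 / laplaceExponent κ l) := by
  have h1 := integrable_exp_neg_mul hκ hl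
  rw [lintegral_exp_renewalMeasure, ← ofReal_integral_eq_lintegral_ofReal h1
    (Eventually.of_forall fun s => (Real.exp_pos _).le), ← ENNReal.ofReal_one,
    ← ENNReal.ofReal_sub _ (integral_nonneg fun s => (Real.exp_pos _).le), one_div,
    ENNReal.ofReal_inv_of_pos hpos]
  congr 2
  rw [laplaceExponent, integral_sub (integrable_const _) h1]
  simp

/-- The asymptotics give positivity at arbitrarily small arguments, and monotonicity carries it to
all `l > 0`. -/
lemma laplaceExponent_pos (hκ : ∀ᵐ s ∂κ, 0 ≤ s) {a c : ℝ} (ha : 0 < a) (ha1 : a < 1) (hc : 0 < c)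
    (h : Tendsto (fun x : ℝ => x ^ a * κ.real (Ioi x)) atTop (𝓝 c)) {l : ℝ} (hl : 0 < l) :
    0 < laplaceExponent κ l := by
  have h1 := tendsto_laplaceExponent hκ ha ha1 h
  have hG := Real.Gamma_pos_of_pos (s := 1 - a) (by linarith)
  have h2 := (h1.eventually (lt_mem_nhds (mul_pos hG hc))).and
    (eventually_nhdsWithin_of_eventually_nhds (gt_mem_nhds hl))
  obtain ⟨k, ⟨hk1, hk2⟩, hk0⟩ := (h2.and self_mem_nhdsWithin).exists
  have hk3 : 0 < laplaceExponent κ k :=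
    pos_of_mul_pos_right hk1 (Real.rpow_nonneg (le_of_lt hk0) _)
  exact hk3.trans_le (laplaceExponent_mono hκ (le_of_lt hk0) hk2.le)

lemma tendsto_one_div_laplaceExponent (hκ : ∀ᵐ s ∂κ, 0 ≤ s) {a c : ℝ} (ha : 0 < a) (ha1 : a < 1)
    (hc : 0 < c) (h : Tendsto (fun x : ℝ => x ^ a * κ.real (Ioi x)) atTop (𝓝 c)) :
    Tendsto (fun l : ℝ => l ^ a * (1 / laplaceExponent κ l)) (𝓝[>] 0)
      (𝓝 (1 / (c * Real.Gamma (1 - a)))) := by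
  have hG := Real.Gamma_pos_of_pos (s := 1 - a) (by linarith)
  have h1 := (tendsto_laplaceExponent hκ ha ha1 h).inv₀ (mul_pos hG hc).ne'
  rw [one_div, mul_comm c]
  refine h1.congr' (eventually_nhdsWithin_of_forall fun l (hl : 0 < l) => ?_)
  simp only [Real.rpow_neg hl.le, mul_inv, inv_inv, one_div]

/-- Near `0` by the asymptotics, away from `0` by monotonicity. The bound has to hold for every `l`,
since it dominates integrals over `l` later. -/
lemma exists_one_div_laplaceExponent_le (hκ : ∀ᵐ s ∂κ, 0 ≤ s) {a c : ℝ} (ha : 0 < a)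
    (ha1 : a < 1) (hc : 0 < c)
    (h : Tendsto (fun x : ℝ => x ^ a * κ.real (Ioi x)) atTop (𝓝 c)) :
    ∃ B : ℝ, 0 < B ∧ ∀ l, 0 < l → 1 / laplaceExponent κ l ≤ B * (1 + l ^ (-a)) := by
  have h1 := tendsto_one_div_laplaceExponent hκ ha ha1 hc h
  have hpos : ∀ {l : ℝ}, 0 < l → 0 < laplaceExponent κ l := laplaceExponent_pos hκ ha ha1 hc h
  set b := 1 / (c * Real.Gamma (1 - a)) with hb
  have hG := Real.Gamma_pos_of_pos (s := 1 - a) (by linarith)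
  have hb0 : 0 < b := by positivity
  obtain ⟨l₀, hl₀, hl₀'⟩ := mem_nhdsGT_iff_exists_Ioo_subset.1
    (h1.eventually (gt_mem_nhds (lt_add_one b)))
  have hl₀ : 0 < l₀ := hl₀
  refine ⟨max (b + 1) (1 / laplaceExponent κ (l₀ / 2)), by positivity, fun l hl => ?_⟩
  have hla := Real.rpow_pos_of_pos hl (-a)
  rcases lt_or_ge l l₀ with hll | hll
  · have h2 : l ^ a * (1 / laplaceExponent κ l) < b + 1 := hl₀' ⟨hl, hll⟩
    have h3 : 1 / laplaceExponent κ l = l ^ (-a) * (l ^ a * (1 / laplaceExponent κ l)) := by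
      rw [← mul_assoc, ← Real.rpow_add hl]; simp
    rw [h3, mul_comm]
    have : (b + 1) ≤ max (b + 1) (1 / laplaceExponent κ (l₀ / 2)) := le_max_left _ _
    calc l ^ a * (1 / laplaceExponent κ l) * l ^ (-a) ≤ (b + 1) * l ^ (-a) := by gcongr
      _ ≤ max (b + 1) (1 / laplaceExponent κ (l₀ / 2)) * (1 + l ^ (-a)) := by
        gcongr; linarith
  · have h2 : 1 / laplaceExponent κ l ≤ 1 / laplaceExponent κ (l₀ / 2) :=
      one_div_le_one_div_of_le (hpos (by linarith))
        (laplaceExponent_mono hκ (by linarith) (by linarith))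
    have h0 := hpos (half_pos hl₀)
    calc 1 / laplaceExponent κ l ≤ max (b + 1) (1 / laplaceExponent κ (l₀ / 2)) * 1 := by
          rw [mul_one]; exact h2.trans (le_max_right _ _)
      _ ≤ _ := by gcongr; linarith

end LaplaceExponent

section MarkExponent

variable {ν : Measure ℝ≥0} [IsProbabilityMeasure ν]

omit [IsProbabilityMeasure ν] in
lemma integrable_mark (hν : ∫⁻ x, (x : ℝ≥0∞) ∂ν = 1) : Integrable (fun x : ℝ≥0 => (x : ℝ)) ν := by
  refine ⟨Measurable.aestronglyMeasurable (by fun_prop), ?_⟩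
  rw [hasFiniteIntegral_iff_ofReal (Eventually.of_forall fun x => x.2)]
  simp [hν]

omit [IsProbabilityMeasure ν] in
lemma integral_mark (hν : ∫⁻ x, (x : ℝ≥0∞) ∂ν = 1) : ∫ x : ℝ≥0, (x : ℝ) ∂ν = 1 := by
  rw [integral_eq_lintegral_of_nonneg_ae (Eventually.of_forall fun x => x.2)
    (Measurable.aestronglyMeasurable (by fun_prop))]
  simp [hν]

lemma integrable_exp_neg_mul_mark {l : ℝ} (hl : 0 ≤ l) :
    Integrable (fun x : ℝ≥0 => Real.exp (-(l * x))) ν := by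
  refine Integrable.mono' (integrable_const 1) (Measurable.aestronglyMeasurable (by fun_prop)) ?_
  refine Eventually.of_forall fun x => ?_
  rw [Real.norm_of_nonneg (Real.exp_pos _).le]
  exact Real.exp_le_one_iff.2 (neg_nonpos.2 (mul_nonneg hl x.2))

lemma integral_exp_neg_mul_mark (hν : ∫⁻ x, (x : ℝ≥0∞) ∂ν = 1) {l : ℝ} (hl : 0 ≤ l) :
    ∫ x : ℝ≥0, Real.exp (-(l * x)) ∂ν = 1 - l + markExponent ν l := by
  have h1 := integrable_exp_neg_mul_mark (ν := ν) hl
  have h2 : Integrable (fun x : ℝ≥0 => Real.exp (-(l * x)) - 1) ν := h1.sub (integrable_const _)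
  rw [markExponent, integral_add h2 ((integrable_mark hν).const_mul l),
    integral_sub h1 (integrable_const _), integral_const_mul, integral_mark hν]
  simp

omit [IsProbabilityMeasure ν] in
lemma markExponent_nonneg (l : ℝ) : 0 ≤ markExponent ν l := by
  refine integral_nonneg fun x => ?_
  have := Real.add_one_le_exp (-(l * x))
  simp only [Pi.zero_apply]
  linarith

lemma markExponent_le (hν : ∫⁻ x, (x : ℝ≥0∞) ∂ν = 1) {l : ℝ} (hl : 0 ≤ l) :
    markExponent ν l ≤ l := by
  have h1 := integral_exp_neg_mul_mark hν hl
  have h2 : ∫ x : ℝ≥0, Real.exp (-(l * x)) ∂ν ≤ ∫ x : ℝ≥0, (1 : ℝ) ∂ν :=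
    integral_mono (integrable_exp_neg_mul_mark hl) (integrable_const _) fun x =>
      Real.exp_le_one_iff.2 (neg_nonpos.2 (mul_nonneg hl x.2))
  simp only [integral_const, probReal_univ, smul_eq_mul, mul_one] at h2
  linarith

omit [IsProbabilityMeasure ν] in
lemma markExponent_zero : markExponent ν 0 = 0 := by simp [markExponent]

@[fun_prop]
lemma measurable_markExponent : Measurable (markExponent ν) := by
  have : StronglyMeasurable fun p : ℝ × ℝ≥0 => Real.exp (-(p.1 * p.2)) - 1 + p.1 * p.2 :=
    Measurable.stronglyMeasurable (by fun_prop)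
  exact this.integral_prod_right'.measurable

variable {b c : ℝ}

lemma tendsto_markExponent (hb : 0 < b) (hb1 : b < 1)
    (h : Tendsto (fun x : ℝ => x ^ (1 + b) * ν.real {z : ℝ≥0 | x < (z : ℝ)}) atTop (𝓝 c)) :
    Tendsto (fun l : ℝ => l ^ (-(1 + b)) * markExponent ν l) (𝓝[>] 0)
      (𝓝 (Real.Gamma (1 - b) / b * c)) := by
  have := tendsto_rpow_mul_integral (m := ν) (F := fun s => (s : ℝ)) (by fun_prop)
    (Eventually.of_forall fun x => x.2)
    (g := fun t => 1 - Real.exp (-t)) (by fun_prop) (fun _ hz => one_sub_exp_neg_nonneg hz)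
    (by linarith) (integrableOn_one_sub_exp_neg_mul_rpow hb hb1) h
  simpa only [integral_zero_one_sub_exp_neg, integral_one_sub_exp_neg_mul_rpow hb hb1,
    markExponent] using this

/-- Near `0` by the asymptotics; for `l ≥ l₀` because `markExponent ν l ≤ l = l^{-b} l^{1+b} ≤
l₀^{-b} l^{1+b}`. -/
lemma exists_markExponent_le (hν : ∫⁻ x, (x : ℝ≥0∞) ∂ν = 1) (hb : 0 < b) (hb1 : b < 1)
    (h : Tendsto (fun x : ℝ => x ^ (1 + b) * ν.real {z : ℝ≥0 | x < (z : ℝ)}) atTop (𝓝 c)) :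
    ∃ B : ℝ, 0 < B ∧ ∀ l, 0 ≤ l → markExponent ν l ≤ B * l ^ (1 + b) := by
  have h1 := tendsto_markExponent hb hb1 h
  set k := Real.Gamma (1 - b) / b * c with hk
  obtain ⟨l₀, hl₀, hl₀'⟩ := mem_nhdsGT_iff_exists_Ioo_subset.1
    (h1.eventually (gt_mem_nhds (lt_add_one k)))
  have hl₀ : 0 < l₀ := hl₀
  refine ⟨max (k + 1) (l₀ ^ (-b)), lt_max_of_lt_right (by positivity), fun l hl => ?_⟩
  rcases hl.eq_or_lt with rfl | hl
  · rw [markExponent_zero, Real.zero_rpow (by linarith), mul_zero]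
  have hlp := Real.rpow_pos_of_pos hl (1 + b)
  rcases lt_or_ge l l₀ with hll | hll
  · have h2 : l ^ (-(1 + b)) * markExponent ν l < k + 1 := hl₀' ⟨hl, hll⟩
    rw [Real.rpow_neg hl.le, inv_mul_lt_iff₀ hlp] at h2
    refine h2.le.trans ?_
    rw [mul_comm]
    gcongr
    exact le_max_left _ _
  · calc markExponent ν l ≤ l := markExponent_le hν hl.le
      _ = l ^ (-b) * l ^ (1 + b) := by
        rw [← Real.rpow_add hl]; simp
      _ ≤ l₀ ^ (-b) * l ^ (1 + b) := by
        gcongr ?_ * _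
        exact Real.rpow_le_rpow_of_nonpos hl₀ hll (by linarith)
      _ ≤ _ := by gcongr; exact le_max_right _ _

end MarkExponent

/-! ### Karamata's Tauberian theorem for functions with finitely many discontinuities. -/

/-- A measure on `[0, ∞)` whose Laplace transform `ρ` is regularly varying with index `-a`
at `0`. -/
structure RegularLaplace (θ : Measure ℝ) (a D : ℝ) (ρ : ℝ → ℝ) : Prop where
  ae_nonneg : ∀ᵐ s ∂θ, 0 ≤ s
  nonneg : ∀ l, 0 < l → 0 ≤ ρ l
  laplace : ∀ l, 0 < l → ∫⁻ s, ENNReal.ofReal (Real.exp (-(l * s))) ∂θ = ENNReal.ofReal (ρ l)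
  bound : ∃ B, 0 < B ∧ ∀ l, 0 < l → ρ l ≤ B * (1 + l ^ (-a))
  tendsto : Tendsto (fun l => l ^ a * ρ l) (𝓝[>] 0) (𝓝 D)

/-- The rescaled integrals of `h` with respect to `θ` converge to the integral with respect to the
measure with density `d s^{a - 1}`. -/
structure ScalingLimit (θ : Measure ℝ) (a d : ℝ) (h : ℝ → ℝ) : Prop where
  integrable : ∀ T, 0 < T → Integrable (fun s => h (s / T)) θ
  integrableOn : IntegrableOn (fun s => h s * s ^ (a - 1)) (Ioi 0)
  tendsto : Tendsto (fun T => T ^ (-a) * ∫ s, h (s / T) ∂θ) atTop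
    (𝓝 (d * ∫ s in Ioi 0, h s * s ^ (a - 1)))

namespace ScalingLimit

variable {θ : Measure ℝ} {a d : ℝ} {h k : ℝ → ℝ}

lemma add (hh : ScalingLimit θ a d h) (hk : ScalingLimit θ a d k) :
    ScalingLimit θ a d fun s => h s + k s where
  integrable T hT := (hh.integrable T hT).add (hk.integrable T hT)
  integrableOn := by
    simp_rw [add_mul]
    exact hh.integrableOn.add hk.integrableOn
  tendsto := by
    simp_rw [add_mul]
    rw [integral_add hh.integrableOn hk.integrableOn, mul_add]
    refine (hh.tendsto.add hk.tendsto).congr' ?_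
    filter_upwards [eventually_gt_atTop 0] with T hT
    rw [integral_add (hh.integrable T hT) (hk.integrable T hT), mul_add]

lemma const_mul (hh : ScalingLimit θ a d h) (c : ℝ) :
    ScalingLimit θ a d fun s => c * h s where
  integrable T hT := (hh.integrable T hT).const_mul c
  integrableOn := by
    simp_rw [mul_assoc]
    exact hh.integrableOn.const_mul c
  tendsto := by
    simp_rw [mul_assoc, integral_const_mul, mul_left_comm _ c]
    exact hh.tendsto.const_mul c

lemma congr (hR : ∀ᵐ s ∂θ, 0 ≤ s) (hh : ScalingLimit θ a d h) (hk : ∀ s, 0 ≤ s → h s = k s) :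
    ScalingLimit θ a d k := by
  have h1 : ∀ T, 0 < T → (fun s => h (s / T)) =ᵐ[θ] fun s => k (s / T) := fun T hT => by
    filter_upwards [hR] with s hs using hk _ (div_nonneg hs hT.le)
  have h2 : ∀ s ∈ Ioi (0 : ℝ), h s * s ^ (a - 1) = k s * s ^ (a - 1) := fun s hs => by
    rw [hk s (le_of_lt hs)]
  refine ⟨fun T hT => (hh.integrable T hT).congr (h1 T hT),
    hh.integrableOn.congr_fun h2 measurableSet_Ioi, ?_⟩
  rw [← setIntegral_congr_fun measurableSet_Ioi h2]
  refine hh.tendsto.congr' ?_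
  filter_upwards [eventually_gt_atTop 0] with T hT
  rw [integral_congr_ae (h1 T hT)]

/-- An argument with `ε / 3`. The error function `r` only needs small integrals against the rescaled
measures and against the limit measure; its rescaled integrals need not converge. -/
lemma of_approx (hR : ∀ᵐ s ∂θ, 0 ≤ s) (hd : 0 ≤ d) (hm : Measurable h)
    (H : ∀ ε > 0, ∃ k r : ℝ → ℝ, ScalingLimit θ a d k ∧ (∀ s, 0 ≤ s → |h s - k s| ≤ r s) ∧
      (∀ T, 0 < T → Integrable (fun s => r (s / T)) θ) ∧
      IntegrableOn (fun s => r s * s ^ (a - 1)) (Ioi 0) ∧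
      (∀ᶠ T in atTop, T ^ (-a) * ∫ s, r (s / T) ∂θ ≤ ε) ∧
      d * ∫ s in Ioi 0, r s * s ^ (a - 1) ≤ ε) : ScalingLimit θ a d h := by
  have hint : ∀ T, 0 < T → Integrable (fun s => h (s / T)) θ := by
    intro T hT
    obtain ⟨k, r, hk, hkr, hr, -, -, -⟩ := H 1 one_pos
    refine Integrable.mono' ((hk.integrable T hT).norm.add (hr T hT))
      (Measurable.aestronglyMeasurable (by fun_prop)) ?_
    filter_upwards [hR] with s hs
    have h1 := hkr (s / T) (div_nonneg hs hT.le)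
    have h2 := abs_sub_abs_le_abs_sub (h (s / T)) (k (s / T))
    simp only [Real.norm_eq_abs, Pi.add_apply]
    linarith
  have hintOn : IntegrableOn (fun s => h s * s ^ (a - 1)) (Ioi 0) := by
    obtain ⟨k, r, hk, hkr, -, hr, -, -⟩ := H 1 one_pos
    refine Integrable.mono' (hk.integrableOn.norm.add hr)
      (Measurable.aestronglyMeasurable (by fun_prop)) ?_
    refine (ae_restrict_iff' measurableSet_Ioi).2 (Eventually.of_forall fun s (hs : 0 < s) => ?_)
    have h1 := hkr s hs.le
    have h2 := abs_sub_abs_le_abs_sub (h s) (k s)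
    have h3 := Real.rpow_nonneg hs.le (a - 1)
    simp only [Real.norm_eq_abs, Pi.add_apply, abs_mul, abs_of_nonneg h3, ← add_mul]
    gcongr
    linarith
  refine ⟨hint, hintOn, ?_⟩
  rw [Metric.tendsto_atTop']
  intro ε hε
  obtain ⟨k, r, hk, hkr, hr, hr', hrT, hrJ⟩ := H (ε / 3) (by positivity)
  have hkT := (Metric.tendsto_nhds.1 hk.tendsto) (ε / 3) (by positivity)
  obtain ⟨T₀, hT₀⟩ := eventually_atTop.1 ((hkT.and hrT).and (eventually_gt_atTop 0))
  refine ⟨T₀, fun T hT => ?_⟩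
  obtain ⟨⟨h1, h2⟩, hT0⟩ := hT₀ T hT.le
  rw [Real.dist_eq] at h1 ⊢
  have hTa := Real.rpow_nonneg hT0.le (-a)
  have e1 : |T ^ (-a) * ∫ s, h (s / T) ∂θ - T ^ (-a) * ∫ s, k (s / T) ∂θ| ≤ ε / 3 := by
    rw [← mul_sub, ← integral_sub (hint T hT0) (hk.integrable T hT0), abs_mul, abs_of_nonneg hTa]
    refine le_trans ?_ h2
    gcongr
    refine norm_integral_le_of_norm_le (f := fun s => h (s / T) - k (s / T)) (hr T hT0) ?_
    filter_upwards [hR] with s hs using hkr _ (div_nonneg hs hT0.le)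
  have e2 : |d * (∫ s in Ioi 0, k s * s ^ (a - 1)) - d * (∫ s in Ioi 0, h s * s ^ (a - 1))| ≤
      ε / 3 := by
    rw [abs_sub_comm, ← mul_sub, ← integral_sub hintOn hk.integrableOn, abs_mul, abs_of_nonneg hd]
    refine le_trans ?_ hrJ
    gcongr
    refine norm_integral_le_of_norm_le
      (f := fun s => h s * s ^ (a - 1) - k s * s ^ (a - 1)) hr' ?_
    refine (ae_restrict_iff' measurableSet_Ioi).2 (Eventually.of_forall fun s (hs : 0 < s) => ?_)
    have h3 := Real.rpow_nonneg hs.le (a - 1)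
    rw [← sub_mul, Real.norm_eq_abs, abs_mul, abs_of_nonneg h3]
    gcongr
    exact hkr s hs.le
  rw [abs_le] at e1 e2
  rw [abs_lt] at h1 ⊢
  constructor <;> linarith [e1.1, e1.2, e2.1, e2.2, h1.1, h1.2]

end ScalingLimit

namespace RegularLaplace

variable {θ : Measure ℝ} {a D : ℝ} {ρ : ℝ → ℝ}

lemma integrable_exp (hR : RegularLaplace θ a D ρ) {l : ℝ} (hl : 0 < l) :
    Integrable (fun s => Real.exp (-(l * s))) θ := by
  refine ⟨Measurable.aestronglyMeasurable (by fun_prop), ?_⟩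
  rw [hasFiniteIntegral_iff_ofReal (Eventually.of_forall fun s => (Real.exp_pos _).le),
    hR.laplace l hl]
  exact ENNReal.ofReal_lt_top

lemma integral_exp (hR : RegularLaplace θ a D ρ) {l : ℝ} (hl : 0 < l) :
    ∫ s, Real.exp (-(l * s)) ∂θ = ρ l := by
  rw [integral_eq_lintegral_of_nonneg_ae (Eventually.of_forall fun s => (Real.exp_pos _).le)
    (Measurable.aestronglyMeasurable (by fun_prop)), hR.laplace l hl,
    ENNReal.toReal_ofReal (hR.nonneg l hl)]

/-- The hypothesis on `ρ` restated: the density `(D / Γ(a)) s^{a-1}` has Laplace transform `D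
l^{-a}`. -/
lemma scalingLimit_exp (hR : RegularLaplace θ a D ρ) (ha : 0 < a) {l : ℝ} (hl : 0 < l) :
    ScalingLimit θ a (D / Real.Gamma a) fun s => Real.exp (-(l * s)) := by
  have hdiv : ∀ T s : ℝ, l * (s / T) = l / T * s := fun T s => by ring
  refine ⟨fun T hT => ?_, ?_, ?_⟩
  · simp_rw [hdiv]
    exact hR.integrable_exp (div_pos hl hT)
  · have h1 := integrableOn_rpow_mul_exp_neg_mul_rpow (s := a - 1) (p := 1) (b := l)
      (by linarith) (by norm_num) hl
    refine h1.congr_fun (fun s _ => ?_) measurableSet_Ioi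
    simp only [Real.rpow_one]
    rw [mul_comm, neg_mul]
  · have h1 := Real.integral_rpow_mul_exp_neg_mul_Ioi ha hl
    have h2 : ∫ s in Ioi 0, Real.exp (-(l * s)) * s ^ (a - 1) = l ^ (-a) * Real.Gamma a := by
      rw [show l ^ (-a) = (1 / l) ^ a by
        rw [one_div, Real.inv_rpow hl.le, Real.rpow_neg hl.le], ← h1]
      exact setIntegral_congr_fun measurableSet_Ioi fun s _ => mul_comm _ _
    have hG := (Real.Gamma_pos_of_pos ha).ne'
    rw [h2, show D / Real.Gamma a * (l ^ (-a) * Real.Gamma a) = l ^ (-a) * D by field_simp]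
    have hlim : Tendsto (fun T : ℝ => l / T) atTop (𝓝[>] 0) := by
      refine tendsto_nhdsWithin_iff.2 ⟨tendsto_const_nhds.div_atTop tendsto_id, ?_⟩
      filter_upwards [eventually_gt_atTop 0] with T hT using div_pos hl hT
    refine ((hR.tendsto.comp hlim).const_mul (l ^ (-a))).congr' ?_
    filter_upwards [eventually_gt_atTop 0] with T hT
    simp_rw [hdiv]
    rw [hR.integral_exp (div_pos hl hT), Function.comp_apply, Real.div_rpow hl.le hT.le,
      Real.rpow_neg hl.le, Real.rpow_neg hT.le]
    have h3 := Real.rpow_pos_of_pos hl a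
    field_simp

/-- The factor `e^{-s}` turns the monomial of degree `n` into an exponential of rate `n + 1 > 0`,
even for `n = 0`. -/
lemma scalingLimit_polynomial (hR : RegularLaplace θ a D ρ) (ha : 0 < a) (p : Polynomial ℝ) :
    ScalingLimit θ a (D / Real.Gamma a) fun s => Real.exp (-s) * p.eval (Real.exp (-s)) := by
  induction p using Polynomial.induction_on' with
  | add p q hp hq =>
    simp_rw [Polynomial.eval_add, mul_add]
    exact hp.add hq
  | monomial n c =>
    have h1 := (hR.scalingLimit_exp ha (l := n + 1) (by positivity)).const_mul c
    refine h1.congr hR.ae_nonneg fun s _ => ?_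
    rw [Polynomial.eval_monomial, ← Real.exp_nat_mul, mul_left_comm, ← Real.exp_add]
    ring_nf

lemma D_nonneg (hR : RegularLaplace θ a D ρ) : 0 ≤ D :=
  ge_of_tendsto hR.tendsto (eventually_nhdsWithin_of_forall fun l (hl : 0 < l) =>
    mul_nonneg (Real.rpow_nonneg hl.le _) (hR.nonneg l hl))

lemma d_nonneg (hR : RegularLaplace θ a D ρ) (ha : 0 < a) : 0 ≤ D / Real.Gamma a :=
  div_nonneg hR.D_nonneg (Real.Gamma_pos_of_pos ha).le

/-- Weierstrass approximation in the variable `x = e^{-s} ∈ [0, 1]`; the error is at most `η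
e^{-s}`, whose scaling limit is known. -/
lemma scalingLimit_continuousOn (hR : RegularLaplace θ a D ρ) (ha : 0 < a) {k : ℝ → ℝ}
    (hk : ContinuousOn k (Icc 0 1)) (hm : Measurable k) :
    ScalingLimit θ a (D / Real.Gamma a) fun s => Real.exp (-s) * k (Real.exp (-s)) := by
  have hexp := hR.scalingLimit_exp ha one_pos
  simp only [one_mul] at hexp
  refine ScalingLimit.of_approx hR.ae_nonneg (hR.d_nonneg ha) (by fun_prop) fun ε hε => ?_
  set J := D / Real.Gamma a * ∫ s in Ioi 0, Real.exp (-s) * s ^ (a - 1) with hJ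
  have hJ0 : 0 ≤ J := mul_nonneg (hR.d_nonneg ha) (setIntegral_nonneg measurableSet_Ioi
    fun s (hs : 0 < s) => mul_nonneg (Real.exp_pos _).le (Real.rpow_nonneg hs.le _))
  -- The `+ 1` guards against `J = 0` and makes `η * J < ε` strict, so that convergence gives an
  -- eventual bound by `ε`.
  set η := ε / (J + 1) with hη
  have hη0 : 0 < η := by positivity
  have hηJ : η * (J + 1) = ε := by rw [hη]; field_simp
  obtain ⟨p, hp⟩ := exists_polynomial_near_of_continuousOn 0 1 k hk η hη0
  have hr := hexp.const_mul η
  refine ⟨_, _, hR.scalingLimit_polynomial ha p, fun s hs => ?_, hr.integrable, hr.integrableOn,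
    ?_, ?_⟩
  · rw [← mul_sub, abs_mul, abs_of_pos (Real.exp_pos _), mul_comm, abs_sub_comm]
    gcongr
    exact (hp _ ⟨(Real.exp_pos _).le, Real.exp_le_one_iff.2 (neg_nonpos.2 hs)⟩).le
  · have h1 := hr.tendsto
    simp_rw [mul_assoc, integral_const_mul, mul_left_comm _ η] at h1 ⊢
    have h2 : η * J < ε := by rw [← hηJ]; linarith
    filter_upwards [h1.eventually (gt_mem_nhds h2)] with T hT using hT.le
  · simp_rw [mul_assoc, integral_const_mul]
    rw [mul_left_comm, ← hJ, ← hηJ]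
    gcongr
    linarith

/-- The substitution `x = e^{-s}`: the function `h(-log x)/x` is continuous on `[0, 1]` because it
vanishes for small `x`. -/
lemma scalingLimit_compact (hR : RegularLaplace θ a D ρ) (ha : 0 < a) {h : ℝ → ℝ}
    (hh : Continuous h) {A : ℝ} (hA : ∀ s, A ≤ s → h s = 0) :
    ScalingLimit θ a (D / Real.Gamma a) h := by
  set k : ℝ → ℝ := fun x => h (-Real.log x) / x with hk
  have hm : Measurable k := (hh.measurable.comp (Real.measurable_log.neg)).div measurable_id
  have hc : ContinuousOn k (Icc 0 1) := by
    intro x hx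
    rcases hx.1.eq_or_lt with rfl | hx0
    -- At the endpoint itself `k 0 = 0`, by the convention for division by zero.
    · have h0 : k =ᶠ[𝓝[Icc 0 1] 0] fun _ => 0 := by
        have h1 : ∀ᶠ x : ℝ in 𝓝[Icc 0 1] 0, x < Real.exp (-A) :=
          eventually_nhdsWithin_of_eventually_nhds (gt_mem_nhds (Real.exp_pos _))
        filter_upwards [h1, self_mem_nhdsWithin] with x h1 h2
        rcases h2.1.eq_or_lt with rfl | h3
        · simp [hk]
        · have := (Real.log_lt_iff_lt_exp h3).2 h1
          simp [hk, hA (-Real.log x) (by linarith)]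
      exact (continuousWithinAt_const (b := (0 : ℝ))).congr_of_eventuallyEq h0 (by simp [hk])
    · refine ContinuousAt.continuousWithinAt (ContinuousAt.div ?_ continuousAt_id hx0.ne')
      exact hh.continuousAt.comp (Real.continuousAt_log hx0.ne').neg
  refine (hR.scalingLimit_continuousOn ha hc hm).congr hR.ae_nonneg fun s _ => ?_
  simp only [hk, Real.log_exp, neg_neg]
  field_simp

end RegularLaplace

namespace RegularLaplace

variable {θ : Measure ℝ} {a D : ℝ} {ρ : ℝ → ℝ}

/-- An exponential Chebyshev bound: `1 ≤ e · e^{-y/x}` for `y ≤ x`, used with `x = T * (1 + s)`. -/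
lemma exists_measure_Iic_le (hR : RegularLaplace θ a D ρ) (ha : 0 < a) :
    ∃ C, 0 < C ∧ ∀ T, 1 ≤ T → ∀ s, 0 ≤ s →
      θ (Iic (T * s)) ≤ ENNReal.ofReal (C * T ^ a * (1 + s) ^ a) := by
  obtain ⟨B, hB, hρ⟩ := hR.bound
  refine ⟨Real.exp 1 * (B * 2), by positivity, fun T hT s hs => ?_⟩
  set x := T * (1 + s) with hx
  have hx1 : 1 ≤ x := one_le_mul_of_one_le_of_one_le hT (by linarith)
  have hx0 : 0 < x := by linarith
  have h1 : θ (Iic (T * s)) ≤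
      ∫⁻ y, ENNReal.ofReal (Real.exp 1) * ENNReal.ofReal (Real.exp (-(1 / x * y))) ∂θ := by
    rw [← lintegral_indicator_one measurableSet_Iic]
    refine lintegral_mono fun y => ?_
    by_cases hy : y ∈ Iic (T * s)
    · rw [indicator_of_mem hy, ← ENNReal.ofReal_mul (Real.exp_pos _).le, ← Real.exp_add,
        Pi.one_apply, ← ENNReal.ofReal_one]
      refine ENNReal.ofReal_le_ofReal (Real.one_le_exp ?_)
      have : y ≤ x := le_trans hy (by rw [hx]; nlinarith)
      have : 1 / x * y ≤ 1 := by rw [one_div, inv_mul_le_iff₀ hx0]; linarith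
      linarith
    · simp [hy]
  refine h1.trans ?_
  rw [lintegral_const_mul _ (by fun_prop), hR.laplace _ (by positivity),
    ← ENNReal.ofReal_mul (Real.exp_pos _).le, mul_assoc, mul_assoc]
  refine ENNReal.ofReal_le_ofReal ?_
  gcongr
  refine (hρ _ (by positivity)).trans ?_
  rw [mul_assoc]
  gcongr
  rw [← Real.mul_rpow (by linarith) (by linarith), ← hx, one_div, Real.inv_rpow hx0.le,
    Real.rpow_neg hx0.le, inv_inv]
  have := Real.one_le_rpow hx1 ha.le
  linarith

/-- The power is a Gamma mixture of exponentials: `(1 + y/T)^{-(1+a)}` is the average of `e^{-ty/T}`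
with weight `t^a e^{-t}/Γ(1+a)`. The integral is therefore the same average of `ρ(t/T) ≤ B (1 + T^a
t^{-a})`, and the weight `t^a` cancels the singularity. -/
lemma exists_lintegral_one_add_rpow_le [SFinite θ] (hR : RegularLaplace θ a D ρ) (ha : 0 < a) :
    ∃ C, 0 < C ∧ ∀ T, 0 < T →
      ∫⁻ y, ENNReal.ofReal ((1 + y / T) ^ (-(1 + a))) ∂θ ≤ ENNReal.ofReal (C * (1 + T ^ a)) := by
  obtain ⟨B, hB, hρ⟩ := hR.bound
  have hG := Real.Gamma_pos_of_pos (s := 1 + a) (by linarith)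
  have hG1 : Real.Gamma (1 + a) = ∫ t in Ioi 0, t ^ a * Real.exp (-t) := by
    rw [Real.Gamma_eq_integral (by linarith)]
    refine setIntegral_congr_fun measurableSet_Ioi fun t _ => ?_
    simp only [add_sub_cancel_left]
    ring
  have hint1 : IntegrableOn (fun t : ℝ => t ^ a * Real.exp (-t)) (Ioi 0) := by
    have := Real.GammaIntegral_convergent (s := 1 + a) (by linarith)
    simpa only [add_sub_cancel_left, mul_comm] using this
  have hint2 : IntegrableOn (fun t : ℝ => Real.exp (-t)) (Ioi 0) := integrableOn_exp_neg_Ioi 0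
  set G := Real.Gamma (1 + a) with hGdef
  refine ⟨B * (1 + 1 / G), by positivity, fun T hT => ?_⟩
  have h1 : ∀ y, 0 ≤ y → ENNReal.ofReal ((1 + y / T) ^ (-(1 + a))) =
      ENNReal.ofReal (1 / G) * ∫⁻ t in Ioi 0,
        ENNReal.ofReal (t ^ a * Real.exp (-t)) * ENNReal.ofReal (Real.exp (-(t / T * y))) := by
    intro y hy
    have hr : 0 < 1 + y / T := by positivity
    have h2 := Real.integral_rpow_mul_exp_neg_mul_Ioi (a := 1 + a) (by linarith) hr
    have h3 : ∀ t ∈ Ioi (0 : ℝ), ENNReal.ofReal (t ^ a * Real.exp (-t)) *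
        ENNReal.ofReal (Real.exp (-(t / T * y))) =
        ENNReal.ofReal (t ^ (1 + a - 1) * Real.exp (-((1 + y / T) * t))) := by
      intro t (ht : 0 < t)
      rw [← ENNReal.ofReal_mul (by positivity), mul_assoc, ← Real.exp_add, add_sub_cancel_left]
      ring_nf
    rw [setLIntegral_congr_fun measurableSet_Ioi h3, ← ofReal_integral_eq_lintegral_ofReal, h2,
      ← ENNReal.ofReal_mul (by positivity), ← hGdef]
    · congr 1
      rw [one_div (1 + y / T), Real.inv_rpow hr.le, Real.rpow_neg hr.le]
      field_simp
    · refine Integrable.of_integral_ne_zero ?_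
      rw [h2]
      positivity
    · exact (ae_restrict_iff' measurableSet_Ioi).2 (Eventually.of_forall fun t (ht : 0 < t) =>
        mul_nonneg (Real.rpow_nonneg ht.le _) (Real.exp_pos _).le)
  rw [lintegral_congr_ae (hR.ae_nonneg.mono h1), lintegral_const_mul, lintegral_lintegral_swap]
  · have h4 : ∀ t ∈ Ioi (0 : ℝ), ∫⁻ y, ENNReal.ofReal (t ^ a * Real.exp (-t)) *
        ENNReal.ofReal (Real.exp (-(t / T * y))) ∂θ ≤
        ENNReal.ofReal (B * (t ^ a * Real.exp (-t) + T ^ a * Real.exp (-t))) := by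
      intro t (ht : 0 < t)
      rw [lintegral_const_mul _ (by fun_prop), hR.laplace _ (by positivity),
        ← ENNReal.ofReal_mul (by positivity)]
      refine ENNReal.ofReal_le_ofReal ?_
      refine (mul_le_mul_of_nonneg_left (hρ _ (by positivity)) (by positivity)).trans_eq ?_
      rw [Real.div_rpow ht.le hT.le, Real.rpow_neg ht.le, Real.rpow_neg hT.le]
      have := Real.rpow_pos_of_pos ht a
      have := Real.rpow_pos_of_pos hT a
      field_simp
    refine (mul_le_mul_right (setLIntegral_mono' measurableSet_Ioi h4) _).trans ?_
    rw [← ofReal_integral_eq_lintegral_ofReal, integral_const_mul, integral_add hint1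
      (hint2.const_mul _), ← hG1, integral_const_mul, integral_exp_neg_Ioi_zero,
      ← ENNReal.ofReal_mul (by positivity)]
    · refine ENNReal.ofReal_le_ofReal ?_
      have hTa := Real.rpow_pos_of_pos hT a
      have : 1 / G * (B * (G + T ^ a * 1)) = B * (1 + 1 / G * T ^ a) := by field_simp
      rw [this, mul_assoc]
      gcongr
      have : 0 < 1 / G := by positivity
      nlinarith
    · exact (hint1.add (hint2.const_mul _)).const_mul B
    · exact (ae_restrict_iff' measurableSet_Ioi).2 (Eventually.of_forall fun t (ht : 0 < t) => by
        have := Real.rpow_nonneg ht.le a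
        simp only [Pi.zero_apply]
        positivity)
  · exact Measurable.aemeasurable (by fun_prop)
  · exact Measurable.lintegral_prod_right' (f := fun p : ℝ × ℝ =>
      ENNReal.ofReal (p.2 ^ a * Real.exp (-p.2)) * ENNReal.ofReal (Real.exp (-(p.2 / T * p.1))))
      (by fun_prop)

lemma integrableOn_one_add_rpow_mul_rpow (ha : 0 < a) :
    IntegrableOn (fun s : ℝ => (1 + s) ^ (-(1 + a)) * s ^ (a - 1)) (Ioi 0) := by
  rw [← Ioc_union_Ioi_eq_Ioi zero_le_one]
  refine IntegrableOn.union ?_ ?_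
  · have h1 : IntegrableOn (fun s : ℝ => s ^ (a - 1)) (Ioc 0 1) :=
      (intervalIntegrable_iff_integrableOn_Ioc_of_le zero_le_one).1
        (intervalIntegral.intervalIntegrable_rpow' (by linarith))
    refine Integrable.mono' h1 (Measurable.aestronglyMeasurable (by fun_prop)) ?_
    refine (ae_restrict_iff' measurableSet_Ioc).2 (Eventually.of_forall fun s hs => ?_)
    have h2 : (0 : ℝ) < 1 + s := by linarith [hs.1]
    have h3 := Real.rpow_nonneg hs.1.le (a - 1)
    rw [Real.norm_of_nonneg (mul_nonneg (Real.rpow_nonneg h2.le _) h3)]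
    refine mul_le_of_le_one_left h3 ?_
    exact Real.rpow_le_one_of_one_le_of_nonpos (by linarith [hs.1]) (by linarith)
  · refine Integrable.mono' (integrableOn_Ioi_rpow_of_lt (a := -2) (by norm_num) one_pos)
      (Measurable.aestronglyMeasurable (by fun_prop)) ?_
    refine (ae_restrict_iff' measurableSet_Ioi).2 (Eventually.of_forall fun s (hs : 1 < s) => ?_)
    have hs0 : 0 < s := by linarith
    rw [Real.norm_of_nonneg (by positivity), show (-2 : ℝ) = -(1 + a) + (a - 1) by ring,
      Real.rpow_add hs0]
    gcongr ?_ * _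
    exact Real.rpow_le_rpow_of_nonpos hs0 (by linarith) (by linarith)

/-- The indicator of a finite set, thickened to a continuous function. -/
def bump (F : Finset ℝ) (n : ℕ) (s : ℝ) : ℝ := min 1 (∑ d ∈ F, max 0 (1 - n * |s - d|))

lemma continuous_bump (F : Finset ℝ) (n : ℕ) : Continuous (bump F n) := by
  unfold bump; fun_prop

lemma bump_sum_nonneg (F : Finset ℝ) (n : ℕ) (s : ℝ) :
    0 ≤ ∑ d ∈ F, max 0 (1 - n * |s - d|) := Finset.sum_nonneg fun _ _ => le_max_left _ _

lemma bump_nonneg (F : Finset ℝ) (n : ℕ) (s : ℝ) : 0 ≤ bump F n s :=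
  le_min zero_le_one (bump_sum_nonneg F n s)

lemma bump_le_one (F : Finset ℝ) (n : ℕ) (s : ℝ) : bump F n s ≤ 1 := min_le_left _ _

lemma bump_eq_one {F : Finset ℝ} (n : ℕ) {s : ℝ} (hs : s ∈ F) : bump F n s = 1 := by
  refine min_eq_left ?_
  have := Finset.single_le_sum (f := fun d => max 0 (1 - n * |s - d|))
    (fun _ _ => le_max_left _ _) hs
  simpa using this

lemma bump_anti (F : Finset ℝ) {n m : ℕ} (hnm : n ≤ m) (s : ℝ) : bump F m s ≤ bump F n s := by
  unfold bump; gcongr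

lemma tendsto_bump {F : Finset ℝ} {s : ℝ} (hs : s ∉ F) :
    Tendsto (fun n => bump F n s) atTop (𝓝 0) := by
  have h1 : ∀ d ∈ F, Tendsto (fun n : ℕ => max 0 (1 - (n : ℝ) * |s - d|)) atTop (𝓝 0) := by
    intro d hd
    have hpos : 0 < |s - d| := abs_pos.2 (sub_ne_zero.2 fun h => hs (h ▸ hd))
    refine tendsto_const_nhds.congr' ?_
    have := (tendsto_natCast_atTop_atTop (R := ℝ)).atTop_mul_const hpos
    filter_upwards [this.eventually_ge_atTop 1] with n hn
    rw [max_eq_left (by linarith)]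
  have h2 := tendsto_finsetSum F h1
  simp only [Finset.sum_const_zero] at h2
  have h3 := (tendsto_const_nhds (x := (1 : ℝ))).min h2
  simpa [bump] using h3

lemma exists_bump_eq_zero (F : Finset ℝ) {n : ℕ} (hn : 1 ≤ n) :
    ∃ A : ℝ, ∀ s, A ≤ s → bump F n s = 0 := by
  refine ⟨∑ d ∈ F, |d| + 1, fun s hs => ?_⟩
  refine (min_eq_right ?_).trans ?_
  all_goals
    have : ∑ d ∈ F, max 0 (1 - (n : ℝ) * |s - d|) = 0 := by
      refine Finset.sum_eq_zero fun d hd => max_eq_left ?_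
      have h1 := Finset.single_le_sum (f := fun d : ℝ => |d|) (fun _ _ => abs_nonneg _) hd
      have h2 := le_abs_self d
      have h3 := le_abs_self (s - d)
      have h4 : (1 : ℝ) ≤ n := by exact_mod_cast hn
      have h5 : 1 ≤ |s - d| := by linarith
      nlinarith
    simp [this]

/-- Rescaled integrals against a measure with regularly varying Laplace transform converge for
functions with finitely many discontinuities and sufficient decay. -/
lemma scalingLimit [SFinite θ] (hR : RegularLaplace θ a D ρ) (ha : 0 < a) {h : ℝ → ℝ}
    (hm : Measurable h) (hfin : {s | 0 ≤ s ∧ ¬ ContinuousWithinAt h (Ici 0) s}.Finite)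
    {C γ : ℝ} (hC : 0 < C) (hγ : 1 + a < γ) (hh : ∀ s, 0 ≤ s → |h s| ≤ C * (1 + s) ^ (-γ)) :
    ScalingLimit θ a (D / Real.Gamma a) h := by
  set d := D / Real.Gamma a with hd
  have hd0 : 0 ≤ d := hR.d_nonneg ha
  set F := hfin.toFinset with hF
  have hbump : ∀ n, 1 ≤ n → ScalingLimit θ a d (bump F n) := fun n hn => by
    obtain ⟨A, hA⟩ := exists_bump_eq_zero F hn
    exact hR.scalingLimit_compact ha (continuous_bump F n) hA
  obtain ⟨B, hB0, hB⟩ := hR.exists_lintegral_one_add_rpow_le ha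
  set w : ℝ → ℝ := fun s => (1 + s) ^ (-(1 + a)) with hw
  have hw0 : ∀ s, 0 ≤ s → 0 ≤ w s := fun s hs => Real.rpow_nonneg (by linarith) _
  have hwm : Measurable w := by fun_prop
  have hwae : ∀ T, 0 < T → 0 ≤ᵐ[θ] fun s => w (s / T) := fun T hT =>
    hR.ae_nonneg.mono fun s hs => hw0 _ (div_nonneg hs hT.le)
  have hwint : ∀ T, 0 < T → Integrable (fun s => w (s / T)) θ := fun T hT => by
    refine ⟨Measurable.aestronglyMeasurable (by fun_prop), ?_⟩
    rw [hasFiniteIntegral_iff_ofReal (hwae T hT)]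
    exact (hB T hT).trans_lt ENNReal.ofReal_lt_top
  have hwle : ∀ T, 1 ≤ T → T ^ (-a) * ∫ s, w (s / T) ∂θ ≤ 2 * B := fun T hT => by
    have hT0 : 0 < T := by linarith
    have hTa := Real.rpow_pos_of_pos hT0 a
    have h1 : ∫ s, w (s / T) ∂θ ≤ B * (1 + T ^ a) := by
      rw [integral_eq_lintegral_of_nonneg_ae (hwae T hT0)
        (Measurable.aestronglyMeasurable (by fun_prop))]
      exact ENNReal.toReal_le_of_le_ofReal (by positivity) (hB T hT0)
    rw [Real.rpow_neg hT0.le, inv_mul_le_iff₀ hTa]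
    have := Real.one_le_rpow hT ha.le
    nlinarith
  have hwint' : IntegrableOn (fun s => w s * s ^ (a - 1)) (Ioi 0) :=
    integrableOn_one_add_rpow_mul_rpow ha
  set J := ∫ s in Ioi 0, w s * s ^ (a - 1) with hJ
  have hJ0 : 0 ≤ J := setIntegral_nonneg measurableSet_Ioi fun s (hs : 0 < s) =>
    mul_nonneg (hw0 s hs.le) (Real.rpow_nonneg hs.le _)
  have hbumpJ : Tendsto (fun n => d * ∫ s in Ioi 0, bump F n s * s ^ (a - 1)) atTop (𝓝 0) := by
    suffices h0 : Tendsto (fun n => ∫ s in Ioi 0, bump F n s * s ^ (a - 1)) atTop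
        (𝓝 (∫ _ in Ioi (0 : ℝ), (0 : ℝ))) by
      simpa using h0.const_mul d
    refine tendsto_integral_filter_of_dominated_convergence (fun s => bump F 1 s * s ^ (a - 1))
      (Eventually.of_forall fun n => ?_) ?_ (hbump 1 le_rfl).integrableOn ?_
    · exact ((continuous_bump F n).measurable.mul (by fun_prop)).aestronglyMeasurable
    · filter_upwards [eventually_ge_atTop 1] with n hn
      refine (ae_restrict_iff' measurableSet_Ioi).2 (Eventually.of_forall fun s (hs : 0 < s) => ?_)
      have h1 := Real.rpow_nonneg hs.le (a - 1)
      rw [Real.norm_of_nonneg (mul_nonneg (bump_nonneg F n s) h1)]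
      gcongr
      exact bump_anti F hn s
    · refine ae_restrict_of_ae ?_
      have h1 : ∀ᵐ s : ℝ, s ∉ (F : Set ℝ) := F.finite_toSet.measure_zero _ |> fun h => by
        simpa [ae_iff] using h
      filter_upwards [h1] with s hs
      simpa using (tendsto_bump hs).mul_const (s ^ (a - 1))
  refine ScalingLimit.of_approx hR.ae_nonneg hd0 hm fun ε hε => ?_
  -- `2 * B` bounds the rescaled integrals of `w`, and `d * J` is its integral against the limit
  -- measure; `η` makes both contributions at most `ε / 2`.
  obtain ⟨η, hη0, hη1, hη2⟩ : ∃ η, 0 < η ∧ η * (2 * B) ≤ ε / 2 ∧ η * (d * J) ≤ ε / 2 := by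
    refine ⟨ε / 2 / (2 * B + d * J + 1), by positivity, ?_, ?_⟩ <;>
    · rw [div_mul_eq_mul_div, div_le_iff₀ (by positivity)]
      gcongr
      linarith [mul_nonneg hd0 hJ0]
  -- Beyond `A` the surplus decay `γ - (1 + a)` puts `|h|` below `η * w`.
  obtain ⟨A, hA0, hA⟩ : ∃ A : ℝ, 0 ≤ A ∧ C * (1 + A) ^ (-(γ - (1 + a))) ≤ η := by
    have h1 : Tendsto (fun A : ℝ => C * (1 + A) ^ (-(γ - (1 + a)))) atTop (𝓝 (C * 0)) :=
      ((tendsto_rpow_neg_atTop (by linarith)).comp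
        (tendsto_atTop_add_const_left atTop 1 tendsto_id)).const_mul C
    rw [mul_zero] at h1
    obtain ⟨A, h2, h3⟩ := ((h1.eventually (gt_mem_nhds hη0)).and (eventually_ge_atTop 0)).exists
    exact ⟨A, h3, h2.le⟩
  obtain ⟨n, hn, hn1⟩ := (((hbumpJ.const_mul C).eventually
    (gt_mem_nhds (show C * 0 < ε / 2 by rw [mul_zero]; positivity))).and
      (eventually_ge_atTop 1)).exists
  set cut : ℝ → ℝ := fun s => max 0 (min 1 (A + 1 - s)) with hcut
  have hcut0 : ∀ s, 0 ≤ cut s := fun s => le_max_left _ _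
  have hcut1 : ∀ s, cut s ≤ 1 := fun s => max_le zero_le_one (min_le_left _ _)
  -- A continuous truncation of `h`: at a discontinuity the factor `1 - bump F n` tends to `0` while
  -- `h` stays bounded by `C`. The error is at most `C * bump F n` up to `A`, and at most `η * w`
  -- beyond.
  set k : ℝ → ℝ := fun s => h s * ((1 - bump F n s) * cut s) with hk
  have hkc : ContinuousOn k (Ici 0) := by
    intro s hs
    by_cases hsF : s ∈ F
    · have h1 : k s = 0 := by simp [hk, bump_eq_one n hsF]
      rw [ContinuousWithinAt, h1]
      refine squeeze_zero_norm' (a := fun s => C * (1 - bump F n s)) ?_ ?_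
      · filter_upwards [self_mem_nhdsWithin] with x hx
        have h2 : |h x| ≤ C := (hh x hx).trans (mul_le_of_le_one_right hC.le
          (Real.rpow_le_one_of_one_le_of_nonpos (by linarith [mem_Ici.1 hx]) (by linarith)))
        have h3 : 0 ≤ 1 - bump F n x := by linarith [bump_le_one F n x]
        rw [hk, norm_mul, Real.norm_eq_abs, Real.norm_of_nonneg (mul_nonneg h3 (hcut0 x))]
        gcongr
        exact mul_le_of_le_one_right h3 (hcut1 x)
      · have h2 : Continuous fun s => C * (1 - bump F n s) :=
          continuous_const.mul (continuous_const.sub (continuous_bump F n))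
        have h3 := h2.continuousWithinAt (s := Ici 0) (x := s)
        rw [ContinuousWithinAt, bump_eq_one n hsF, sub_self, mul_zero] at h3
        exact h3
    · have h1 : ContinuousWithinAt h (Ici 0) s := by
        by_contra h2
        exact hsF (hfin.mem_toFinset.2 ⟨hs, h2⟩)
      refine h1.mul (Continuous.continuousWithinAt ?_)
      have := continuous_bump F n
      fun_prop
  -- Freezing the value at `0` extends `k` continuously to the negative half-line, which `θ` does
  -- not charge.
  have hkmax : Continuous fun s => k (max s 0) :=
    hkc.comp_continuous (by fun_prop) fun s => mem_Ici.2 (le_max_right _ _)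
  have hk0 : ∀ s, A + 1 ≤ s → k (max s 0) = 0 := fun s hs => by
    have h1 : A + 1 - max s 0 ≤ 0 := by linarith [le_max_left s 0]
    simp [hk, hcut, h1]
  refine ⟨fun s => k (max s 0), fun s => C * bump F n s + η * w s,
    hR.scalingLimit_compact ha hkmax hk0, fun s hs => ?_, fun T hT => ?_, ?_, ?_, ?_⟩
  · dsimp only
    rw [max_eq_left hs]
    have e : h s - k s = h s * (1 - (1 - bump F n s) * cut s) := by rw [hk]; ring
    have hb0 := bump_nonneg F n s
    have hb1 := bump_le_one F n s
    have hc0 := hcut0 s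
    have hc1 := hcut1 s
    have hws := hw0 s hs
    rcases le_or_gt s A with hsA | hsA
    · have hc : cut s = 1 := by
        simp only [hcut]
        rw [min_eq_left (by linarith), max_eq_right zero_le_one]
      have h2 : |h s| ≤ C := (hh s hs).trans (mul_le_of_le_one_right hC.le
        (Real.rpow_le_one_of_one_le_of_nonpos (by linarith) (by linarith)))
      rw [e, hc, mul_one, sub_sub_cancel, abs_mul, abs_of_nonneg hb0]
      have h3 : |h s| * bump F n s ≤ C * bump F n s := by gcongr
      have h4 : 0 ≤ η * w s := by positivity
      linarith
    · have h1 : 0 ≤ 1 - (1 - bump F n s) * cut s := by nlinarith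
      have h2 : 1 - (1 - bump F n s) * cut s ≤ 1 := by nlinarith
      rw [e, abs_mul, abs_of_nonneg h1]
      have h3 : C * (1 + s) ^ (-γ) ≤ η * w s := by
        have h4 : (1 + s) ^ (-γ) = (1 + s) ^ (-(γ - (1 + a))) * w s := by
          rw [hw, ← Real.rpow_add (by linarith)]
          ring_nf
        rw [h4, ← mul_assoc]
        gcongr
        refine le_trans ?_ hA
        gcongr C * ?_
        exact Real.rpow_le_rpow_of_nonpos (by linarith) (by linarith) (by linarith)
      have h5 : |h s| * (1 - (1 - bump F n s) * cut s) ≤ |h s| :=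
        mul_le_of_le_one_right (abs_nonneg _) h2
      have h6 : 0 ≤ C * bump F n s := by positivity
      linarith [hh s hs]
  · exact (((hbump n hn1).integrable T hT).const_mul C).add ((hwint T hT).const_mul η)
  · have h1 := ((hbump n hn1).integrableOn.const_mul C).add (hwint'.const_mul η)
    simp_rw [add_mul, mul_assoc]
    exact h1
  · filter_upwards [((hbump n hn1).tendsto.const_mul C).eventually (gt_mem_nhds hn),
      eventually_ge_atTop 1] with T hT1 hT2
    have hT0 : 0 < T := by linarith
    have h1 := (hbump n hn1).integrable T hT0
    rw [integral_add (h1.const_mul C) ((hwint T hT0).const_mul η), integral_const_mul,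
      integral_const_mul, mul_add, mul_left_comm, mul_left_comm _ η]
    have h2 := mul_le_mul_of_nonneg_left (hwle T hT2) hη0.le
    linarith
  · simp_rw [add_mul, mul_assoc]
    rw [integral_add ((hbump n hn1).integrableOn.const_mul C) (hwint'.const_mul η),
      integral_const_mul, integral_const_mul, mul_add, mul_left_comm, mul_left_comm _ η]
    linarith

end RegularLaplace

/-! ### The displacement law and its renewal measure. -/

section Kernel

variable {φ : ℝ → ℝ}

lemma displacementLaw_apply {A : Set ℝ} (hA : MeasurableSet A) :
    displacementLaw φ A = ∫⁻ s in A, ENNReal.ofReal (φ s) :=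
  withDensity_apply _ hA

lemma displacementLaw_real (hm : Measurable φ) (h0 : ∀ t, 0 ≤ φ t) {A : Set ℝ}
    (hA : MeasurableSet A) : (displacementLaw φ).real A = ∫ s in A, φ s := by
  rw [measureReal_def, displacementLaw_apply hA,
    integral_eq_lintegral_of_nonneg_ae (Eventually.of_forall h0) hm.aestronglyMeasurable]

lemma ae_nonneg_displacementLaw (hneg : ∀ t, t < 0 → φ t = 0) :
    ∀ᵐ s ∂(displacementLaw φ), 0 ≤ s := by
  have h1 : {s : ℝ | ¬ 0 ≤ s} = Iio 0 := by ext; simp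
  rw [ae_iff, h1, displacementLaw_apply measurableSet_Iio]
  refine setLIntegral_eq_zero measurableSet_Iio fun s hs => ?_
  simp [hneg s hs]

lemma isProbabilityMeasure_displacementLaw (h0 : ∀ t, 0 ≤ φ t)
    (hneg : ∀ t, t < 0 → φ t = 0) (hint : ∫ t in Ioi 0, φ t = 1) :
    IsProbabilityMeasure (displacementLaw φ) := by
  refine ⟨?_⟩
  have h1 := ae_nonneg_displacementLaw hneg
  have h2 : displacementLaw φ univ = displacementLaw φ (Ici 0) := by
    refine measure_congr ?_
    filter_upwards [h1] with s hs
    exact propext ⟨fun _ => hs, fun _ => mem_univ s⟩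
  have hi : IntegrableOn φ (Ioi 0) := by
    by_contra h
    rw [integral_undef h] at hint
    exact zero_ne_one hint
  rw [h2, displacementLaw_apply measurableSet_Ici, setLIntegral_congr Ioi_ae_eq_Ici.symm,
    ← ofReal_integral_eq_lintegral_ofReal hi (Eventually.of_forall h0), hint, ENNReal.ofReal_one]

lemma regularLaplace_renewalMeasure {κ : Measure ℝ} [IsProbabilityMeasure κ]
    (hκ : ∀ᵐ s ∂κ, 0 ≤ s) {a c : ℝ} (ha : 0 < a) (ha1 : a < 1) (hc : 0 < c)
    (h : Tendsto (fun x : ℝ => x ^ a * κ.real (Ioi x)) atTop (𝓝 c)) :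
    RegularLaplace (renewalMeasure κ) a (1 / (c * Real.Gamma (1 - a)))
      fun l => 1 / laplaceExponent κ l where
  ae_nonneg := ae_nonneg_renewalMeasure hκ
  nonneg _ hl := (one_div_pos.2 (laplaceExponent_pos hκ ha ha1 hc h hl)).le
  laplace _ hl := lintegral_exp_renewalMeasure_eq hκ hl.le (laplaceExponent_pos hκ ha ha1 hc h hl)
  bound := exists_one_div_laplaceExponent_le hκ ha ha1 hc h
  tendsto := tendsto_one_div_laplaceExponent hκ ha ha1 hc h

lemma one_div_div_Gamma_eq {a c : ℝ} (ha : 0 < a) :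
    1 / (c * Real.Gamma (1 - a)) / Real.Gamma a = cAlpha a c * a := by
  have h1 := (Real.Gamma_pos_of_pos ha).ne'
  rw [cAlpha, add_comm, Real.Gamma_add_one ha.ne']
  field_simp

end Kernel

/-! ### The nonlinear renewal equation for the cluster exponent. -/

section Remainder

variable {κ : Measure ℝ} [IsProbabilityMeasure κ] {ν : Measure ℝ≥0} [IsProbabilityMeasure ν]

/-- The terms of higher order in the equation for the cluster exponent, as a function of the value
`x` of the test function and the value `q` of the expected exponent of a child. -/
def nonlinearity (ν : Measure ℝ≥0) (x q : ℝ) : ℝ :=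
  (x - 1 + Real.exp (-x)) + (1 - Real.exp (-x)) * q + Real.exp (-x) * markExponent ν q

omit [IsProbabilityMeasure ν] in
lemma nonlinearity_nonneg {x q : ℝ} (hx : 0 ≤ x) (hq : 0 ≤ q) : 0 ≤ nonlinearity ν x q := by
  have h1 : 0 ≤ x - 1 + Real.exp (-x) := by linarith [Real.add_one_le_exp (-x)]
  have h2 := mul_nonneg (one_sub_exp_neg_nonneg hx) hq
  have h3 := mul_nonneg (Real.exp_pos (-x)).le (markExponent_nonneg (ν := ν) q)
  rw [nonlinearity]
  linarith

lemma exp_neg_sub_one_add_le {x : ℝ} (hx : 0 ≤ x) : x - 1 + Real.exp (-x) ≤ x ^ 2 := by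
  rcases le_or_gt x 1 with h | h
  · have h1 := Real.abs_exp_sub_one_sub_id_le (x := -x) (by rwa [abs_neg, abs_of_nonneg hx])
    have h2 := le_abs_self (Real.exp (-x) - 1 - -x)
    rw [neg_sq] at h1
    linarith
  · have h1 : Real.exp (-x) ≤ 1 := Real.exp_le_one_iff.2 (by linarith)
    nlinarith

omit [IsProbabilityMeasure ν] in
lemma nonlinearity_le {x q : ℝ} (hx : 0 ≤ x) (hq : 0 ≤ q) :
    nonlinearity ν x q ≤ x ^ 2 + x * q + markExponent ν q := by
  have h1 := exp_neg_sub_one_add_le hx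
  have h2 : (1 - Real.exp (-x)) * q ≤ x * q := by
    gcongr
    linarith [Real.add_one_le_exp (-x)]
  have h3 : Real.exp (-x) * markExponent ν q ≤ markExponent ν q :=
    mul_le_of_le_one_left (markExponent_nonneg q) (Real.exp_le_one_iff.2 (by linarith))
  rw [nonlinearity]
  linarith

/-- The expected exponent of the cluster of a child. -/
def childExponent (κ : Measure ℝ) [IsProbabilityMeasure κ] (ν : Measure ℝ≥0)
    [IsProbabilityMeasure ν] (h : ℝ → ℝ≥0∞) (t : ℝ) : ℝ :=
  (shiftOp κ (clusterExponent κ ν h) t).toReal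

/-- The difference between the linearised and the actual equation for the cluster exponent. -/
def remainder (κ : Measure ℝ) [IsProbabilityMeasure κ] (ν : Measure ℝ≥0)
    [IsProbabilityMeasure ν] (h : ℝ → ℝ≥0∞) (t : ℝ) : ℝ≥0∞ :=
  ENNReal.ofReal (nonlinearity ν (h t).toReal (childExponent κ ν h t))

variable {h : ℝ → ℝ≥0∞}

lemma childExponent_nonneg (t : ℝ) : 0 ≤ childExponent κ ν h t := ENNReal.toReal_nonneg

lemma shiftOp_clusterExponent_le_one (hh : Measurable h) (t : ℝ) :
    shiftOp κ (clusterExponent κ ν h) t ≤ 1 := by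
  rw [shiftOp_clusterExponent hh]
  exact tsub_le_self

lemma ofReal_childExponent (hh : Measurable h) (t : ℝ) :
    ENNReal.ofReal (childExponent κ ν h t) = shiftOp κ (clusterExponent κ ν h) t :=
  ENNReal.ofReal_toReal ((shiftOp_clusterExponent_le_one hh t).trans_lt ENNReal.one_lt_top).ne

lemma childExponent_le_one (hh : Measurable h) (t : ℝ) : childExponent κ ν h t ≤ 1 :=
  ENNReal.toReal_le_of_le_ofReal zero_le_one (by simpa using shiftOp_clusterExponent_le_one hh t)

lemma measurable_childExponent (hh : Measurable h) : Measurable (childExponent κ ν h) :=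
  (measurable_shiftOp (measurable_clusterExponent hh)).ennreal_toReal

lemma measurable_remainder (hh : Measurable h) : Measurable (remainder κ ν h) := by
  have h1 := measurable_childExponent (κ := κ) (ν := ν) hh
  have h2 := hh.ennreal_toReal
  unfold remainder nonlinearity
  fun_prop

/-- Inserting `∫ e^{-qx} ν(dx) = 1 - q + ψ(q)`, `ψ = markExponent ν`, into the cluster equation and
moving all but the linear terms to the left leaves only nonnegative terms, so the identity holds in
`ℝ≥0∞`. -/
lemma clusterExponent_add_remainder (hν : ∫⁻ x, (x : ℝ≥0∞) ∂ν = 1) (hh : Measurable h)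
    (hfin : ∀ t, h t ≠ ∞) :
    clusterExponent κ ν h + remainder κ ν h = h + shiftOp κ (clusterExponent κ ν h) := by
  ext1 t
  have hq0 := childExponent_nonneg (κ := κ) (ν := ν) (h := h) t
  have hq1 := childExponent_le_one (κ := κ) (ν := ν) hh t
  rw [Pi.add_apply, Pi.add_apply, ← ofReal_childExponent hh, clusterExponent_eq hh,
    remainder, expNeg_of_ne_top (hfin t)]
  conv_rhs => rw [← ENNReal.ofReal_toReal (hfin t)]
  change 1 - _ * (∫⁻ x : ℝ≥0, ENNReal.ofReal (Real.exp (-(x * childExponent κ ν h t))) ∂ν) + _ = _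
  set q := childExponent κ ν h t
  set x := (h t).toReal
  have hx : 0 ≤ x := ENNReal.toReal_nonneg
  simp_rw [mul_comm _ q]
  rw [← ofReal_integral_eq_lintegral_ofReal (integrable_exp_neg_mul_mark hq0)
    (Eventually.of_forall fun _ => (Real.exp_pos _).le), integral_exp_neg_mul_mark hν hq0]
  have hψ := markExponent_nonneg (ν := ν) q
  have hψ1 := markExponent_le hν hq0
  have he := Real.exp_pos (-x)
  have he1 : Real.exp (-x) ≤ 1 := Real.exp_le_one_iff.2 (by linarith)
  have hp : 0 ≤ 1 - q + markExponent ν q := by linarith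
  have hm : Real.exp (-x) * (1 - q + markExponent ν q) ≤ 1 :=
    mul_le_one₀ he1 hp (by linarith)
  rw [← ENNReal.ofReal_mul he.le, ← ENNReal.ofReal_one,
    ← ENNReal.ofReal_sub _ (mul_nonneg he.le hp), ← ENNReal.ofReal_add (by linarith)
      (nonlinearity_nonneg hx hq0), ← ENNReal.ofReal_add hx hq0, nonlinearity]
  congr 1
  ring

lemma shiftOp_renewalMeasure_eq (hν : ∫⁻ x, (x : ℝ≥0∞) ∂ν = 1) (hh : Measurable h)
    (hfin : ∀ t, h t ≠ ∞) {t : ℝ} (ht : shiftOp (renewalMeasure κ) h t ≠ ∞) :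
    shiftOp (renewalMeasure κ) h t =
      clusterExponent κ ν h t + shiftOp (renewalMeasure κ) (remainder κ ν h) t :=
  eq_add_shiftOp_renewalMeasure (measurable_clusterExponent hh) hh (measurable_remainder hh)
    (clusterExponent_add_remainder hν hh hfin) (clusterExponent_le hν hh) ht

/-- The last term is the gap between the mean and the cluster exponent; after multiplication by `μ`
it is the logarithm of the centred Laplace transform. -/
lemma lintegral_shiftOp_renewalMeasure_eq (hκ : ∀ᵐ s ∂κ, 0 ≤ s)
    (hν : ∫⁻ x, (x : ℝ≥0∞) ∂ν = 1) (hh : Measurable h) (hfin : ∀ t, h t ≠ ∞)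
    (hint : ∫⁻ t in Ici 0, shiftOp (renewalMeasure κ) h t ≠ ∞) :
    ∫⁻ t in Ici 0, shiftOp (renewalMeasure κ) h t = (∫⁻ t in Ici 0, clusterExponent κ ν h t) +
      ∫⁻ s in Ici 0, remainder κ ν h s * renewalMeasure κ (Iic s) := by
  rw [← lintegral_shiftOp_renewalMeasure hκ (measurable_remainder hh),
    ← lintegral_add_left (measurable_clusterExponent hh)]
  refine lintegral_congr_ae ?_
  filter_upwards [ae_lt_top (measurable_shiftOp hh) hint] with t ht
  exact shiftOp_renewalMeasure_eq hν hh hfin ht.ne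

/-- With `u ≤ Uh`, applying `shiftOp κ` gives at most `shiftOp κ (Uh)`, which is a summand of `Uh =
h + shiftOp κ (Uh)`. -/
lemma childExponent_le_shiftOp (hν : ∫⁻ x, (x : ℝ≥0∞) ∂ν = 1) (hh : Measurable h) (t : ℝ) :
    ENNReal.ofReal (childExponent κ ν h t) ≤ shiftOp (renewalMeasure κ) h t := by
  rw [ofReal_childExponent hh, shiftOp_add_eq hh]
  exact (shiftOp_mono (clusterExponent_le hν hh) t).trans le_add_self

/-- Combines `q = u + H - h` with `u = Uh - UH`. Only `Uh` will matter in the limit; the other three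
terms are corrections. -/
lemma childExponent_eq (hν : ∫⁻ x, (x : ℝ≥0∞) ∂ν = 1) (hh : Measurable h)
    (hfin : ∀ t, h t ≠ ∞) {t : ℝ} (ht : shiftOp (renewalMeasure κ) h t ≠ ∞) :
    childExponent κ ν h t = (shiftOp (renewalMeasure κ) h t).toReal -
      (shiftOp (renewalMeasure κ) (remainder κ ν h) t).toReal +
      (remainder κ ν h t).toReal - (h t).toReal := by
  have h1 := shiftOp_renewalMeasure_eq hν hh hfin ht
  have h2 := congrFun (clusterExponent_add_remainder (κ := κ) hν hh hfin) t
  have h3 : clusterExponent κ ν h t ≠ ∞ := ne_top_of_le_ne_top ht (h1 ▸ le_self_add)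
  have h4 : shiftOp (renewalMeasure κ) (remainder κ ν h) t ≠ ∞ :=
    ne_top_of_le_ne_top ht (h1 ▸ le_add_self)
  rw [Pi.add_apply, Pi.add_apply] at h2
  have h5 := congrArg ENNReal.toReal h2
  have h6 := congrArg ENNReal.toReal h1
  have h7 : shiftOp κ (clusterExponent κ ν h) t ≠ ∞ :=
    ((shiftOp_clusterExponent_le_one hh t).trans_lt ENNReal.one_lt_top).ne
  rw [ENNReal.toReal_add h3 (show remainder κ ν h t ≠ ∞ from ENNReal.ofReal_ne_top),
    ENNReal.toReal_add (hfin t) h7] at h5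
  rw [ENNReal.toReal_add h3 h4] at h6
  rw [childExponent]
  linarith

end Remainder

/-! ### Integrability and the exact centred Laplace transform. -/

namespace IsBranchingSystem

variable {Ω : Type*} [MeasurableSpace Ω] {P : Measure Ω} [IsProbabilityMeasure P]
  {S : Ingredients Ω} {μ : ℝ} {φ : ℝ → ℝ} {ν : Measure ℝ≥0} [IsProbabilityMeasure ν]
  [IsProbabilityMeasure (displacementLaw φ)] {g : ℝ → ℝ}

omit [MeasurableSpace Ω] in
lemma setLIntegral_N (hneg : ∀ t, t < 0 → g t = 0) (ω : Ω) :
    ∫⁻ t in Ici 0, ENNReal.ofReal (g t) ∂(S.N ω) = ∫⁻ t, ENNReal.ofReal (g t) ∂(S.N ω) := by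
  rw [← lintegral_indicator measurableSet_Ici]
  congr 1
  ext t
  by_cases ht : t ∈ Ici (0 : ℝ)
  · rw [indicator_of_mem ht]
  · rw [indicator_of_notMem ht, hneg t (by simpa using ht), ENNReal.ofReal_zero]

omit [MeasurableSpace Ω] in
lemma pairN_eq (hm : Measurable g) (h0 : ∀ t, 0 ≤ g t) (hneg : ∀ t, t < 0 → g t = 0) (ω : Ω) :
    S.pairN g ω = (∫⁻ t, ENNReal.ofReal (g t) ∂(S.N ω)).toReal := by
  rw [Ingredients.pairN, integral_eq_lintegral_of_nonneg_ae (Eventually.of_forall h0)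
    hm.aestronglyMeasurable, setLIntegral_N hneg]

variable (hS : IsBranchingSystem P S μ φ ν) (hν : ∫⁻ x, (x : ℝ≥0∞) ∂ν = 1)
  (hm : Measurable g) (h0 : ∀ t, 0 ≤ g t) (hneg : ∀ t, t < 0 → g t = 0)
  (hint : ∫⁻ t in Ici 0, shiftOp (renewalMeasure (displacementLaw φ))
    (fun t => ENNReal.ofReal (g t)) t ≠ ∞)

include hS hν hm hint

lemma lintegral_lintegral_N_ne_top : ∫⁻ ω, ∫⁻ t, ENNReal.ofReal (g t) ∂(S.N ω) ∂P ≠ ∞ := by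
  rw [hS.lintegral_lintegral_N hν hm.ennreal_ofReal]
  exact ENNReal.mul_ne_top ENNReal.ofReal_ne_top hint

lemma ae_lintegral_N_lt_top : ∀ᵐ ω ∂P, ∫⁻ t, ENNReal.ofReal (g t) ∂(S.N ω) < ∞ :=
  ae_lt_top (hS.measurable_lintegral_N hm.ennreal_ofReal)
    (hS.lintegral_lintegral_N_ne_top hν hm hint)

include h0 hneg

lemma ae_integrableOn_N : ∀ᵐ ω ∂P, IntegrableOn g (Ici 0) (S.N ω) := by
  filter_upwards [hS.ae_lintegral_N_lt_top hν hm hint] with ω hω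
  refine ⟨hm.aestronglyMeasurable, ?_⟩
  rwa [hasFiniteIntegral_iff_ofReal (Eventually.of_forall h0), setLIntegral_N hneg]

lemma integrable_pairN : Integrable (S.pairN g) P := by
  simp_rw [funext (pairN_eq (S := S) hm h0 hneg)]
  exact integrable_toReal_of_lintegral_ne_top
    (hS.measurable_lintegral_N hm.ennreal_ofReal).aemeasurable
    (hS.lintegral_lintegral_N_ne_top hν hm hint)

lemma integral_pairN : ∫ ω, S.pairN g ω ∂P =
    (ENNReal.ofReal μ * ∫⁻ t in Ici 0, shiftOp (renewalMeasure (displacementLaw φ))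
      (fun t => ENNReal.ofReal (g t)) t).toReal := by
  simp_rw [pairN_eq (S := S) hm h0 hneg]
  rw [integral_toReal (hS.measurable_lintegral_N hm.ennreal_ofReal).aemeasurable
    (hS.ae_lintegral_N_lt_top hν hm hint), hS.lintegral_lintegral_N hν hm.ennreal_ofReal]

lemma integrable_exp_neg_pairN : Integrable (fun ω => Real.exp (-S.pairN g ω)) P := by
  refine Integrable.of_bound (Real.measurable_exp.comp_aemeasurable
    (hS.integrable_pairN hν hm h0 hneg hint).aemeasurable.neg).aestronglyMeasurable 1
    (Eventually.of_forall fun ω => ?_)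
  rw [Real.norm_of_nonneg (Real.exp_pos _).le, Real.exp_le_one_iff, pairN_eq hm h0 hneg]
  simp

/-- The mean contributes `μ ∫ Uh` to the exponent and the Laplace functional `-μ ∫ u`. Both are
finite, and their difference is the integral of the remainder. -/
lemma integral_exp_neg_pairN (hκ : ∀ᵐ s ∂(displacementLaw φ), 0 ≤ s) (hμ : 0 ≤ μ) :
    ∫ ω, Real.exp (-(S.pairN g ω - ∫ ω', S.pairN g ω' ∂P)) ∂P =
      Real.exp (μ * (∫⁻ s in Ici 0, remainder (displacementLaw φ) ν
        (fun t => ENNReal.ofReal (g t)) s * renewalMeasure (displacementLaw φ) (Iic s)).toReal) := by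
  set h : ℝ → ℝ≥0∞ := fun t => ENNReal.ofReal (g t) with hh
  have hhm : Measurable h := hm.ennreal_ofReal
  have h1 := lintegral_shiftOp_renewalMeasure_eq hκ hν hhm
    (fun t => by simp [hh]) hint
  have hu : ∫⁻ t in Ici 0, clusterExponent (displacementLaw φ) ν h t ≠ ∞ :=
    ne_top_of_le_ne_top hint (h1 ▸ le_self_add)
  have hH : ∫⁻ s in Ici 0, remainder (displacementLaw φ) ν h s *
      renewalMeasure (displacementLaw φ) (Iic s) ≠ ∞ :=
    ne_top_of_le_ne_top hint (h1 ▸ le_add_self)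
  have h2 : ∫ ω, Real.exp (-S.pairN g ω) ∂P = Real.exp (-(μ *
      (∫⁻ t in Ici 0, clusterExponent (displacementLaw φ) ν h t).toReal)) := by
    rw [integral_eq_lintegral_of_nonneg_ae (Eventually.of_forall fun _ => (Real.exp_pos _).le)
      (hS.integrable_exp_neg_pairN hν hm h0 hneg hint).aestronglyMeasurable]
    have h3 : ∫⁻ ω, ENNReal.ofReal (Real.exp (-S.pairN g ω)) ∂P =
        ∫⁻ ω, expNeg (∫⁻ t, h t ∂(S.N ω)) ∂P := by
      refine lintegral_congr_ae ?_
      filter_upwards [hS.ae_lintegral_N_lt_top hν hm hint] with ω hω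
      rw [pairN_eq hm h0 hneg, expNeg_of_ne_top hω.ne]
    rw [h3, hS.lintegral_expNeg_N hhm, expNeg_of_ne_top (ENNReal.mul_ne_top ENNReal.ofReal_ne_top
      hu), ENNReal.toReal_ofReal (Real.exp_pos _).le, ENNReal.toReal_mul,
      ENNReal.toReal_ofReal hμ]
  rw [hS.integral_pairN hν hm h0 hneg hint]
  simp_rw [neg_sub, sub_eq_add_neg, Real.exp_add]
  rw [integral_const_mul, h2, ← Real.exp_add, h1, ENNReal.toReal_mul, ENNReal.toReal_ofReal hμ,
    ENNReal.toReal_add hu hH]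
  ring_nf

end IsBranchingSystem

/-! ### Rescaled test functions and bounds uniform in `T`. -/

lemma norming_eq {α β : ℝ} (hβ : 0 < 1 + β) (T : ℝ) :
    norming α β T = T ^ (α + (1 + α) / (1 + β)) := by
  rw [norming]
  congr 1
  field_simp
  ring

/-- Nonnegative measurable functions which vanish on the negative half-line, with finitely many
discontinuities on the positive half-line and decay of order `(1 + s)^(-γ)`. -/
structure IsDecaying (γ C : ℝ) (f : ℝ → ℝ) : Prop where
  measurable : Measurable f
  nonneg : ∀ s, 0 ≤ f s
  eq_zero : ∀ s, s < 0 → f s = 0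
  finite_discont : {s | 0 ≤ s ∧ ¬ ContinuousWithinAt f (Ici 0) s}.Finite
  pos : 0 < C
  le : ∀ s, 0 ≤ s → f s ≤ C * (1 + s) ^ (-γ)

namespace IsDecaying

variable {α β γ C D : ℝ} {f ρ : ℝ → ℝ} {κ : Measure ℝ} [IsProbabilityMeasure κ]
  {ν : Measure ℝ≥0} [IsProbabilityMeasure ν]

lemma measurable_rescale (hf : IsDecaying γ C f) (T : ℝ) : Measurable (rescale α β T f) := by
  have := hf.measurable
  unfold rescale
  fun_prop

lemma rescale_nonneg (hf : IsDecaying γ C f) {T : ℝ} (hT : 0 ≤ T) (t : ℝ) :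
    0 ≤ rescale α β T f t :=
  mul_nonneg (one_div_nonneg.2 (Real.rpow_nonneg hT _)) (hf.nonneg _)

lemma rescale_eq_zero (hf : IsDecaying γ C f) {T : ℝ} (hT : 0 < T) {t : ℝ} (ht : t < 0) :
    rescale α β T f t = 0 := by
  rw [rescale, hf.eq_zero _ (div_neg_of_neg_of_pos ht hT), mul_zero]

omit [IsProbabilityMeasure κ] in
lemma rescale_mul (hβ : 0 < 1 + β) {T : ℝ} (hT : 0 < T) (s : ℝ) :
    rescale α β T f (T * s) = T ^ (-(α + (1 + α) / (1 + β))) * f s := by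
  rw [rescale, norming_eq hβ, Real.rpow_neg hT.le, one_div, mul_div_cancel_left₀ _ hT.ne']

/-- The rescaled test function with values in `ℝ≥0∞`. -/
abbrev erescale (α β T : ℝ) (f : ℝ → ℝ) (t : ℝ) : ℝ≥0∞ := ENNReal.ofReal (rescale α β T f t)

lemma measurable_erescale (hf : IsDecaying γ C f) (T : ℝ) : Measurable (erescale α β T f) :=
  (hf.measurable_rescale T).ennreal_ofReal

lemma shiftOp_erescale (hβ : 0 < 1 + β) (hf : IsDecaying γ C f) {θ : Measure ℝ} {T : ℝ}
    (hT : 0 < T) (s : ℝ) : shiftOp θ (erescale α β T f) (T * s) =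
      ENNReal.ofReal (T ^ (-(α + (1 + α) / (1 + β)))) *
        ∫⁻ y, ENNReal.ofReal (f (s + y / T)) ∂θ := by
  have := hf.measurable
  rw [shiftOp, ← lintegral_const_mul _ (by fun_prop)]
  refine lintegral_congr fun y => ?_
  have h1 : T * s + y = T * (s + y / T) := by field_simp
  rw [← ENNReal.ofReal_mul (Real.rpow_nonneg hT.le _), h1, ← rescale_mul hβ hT]

/-- The decay exponent is split as `(γ - (1 + α)) + (1 + α)`: one part is spent on `1 + s`, the
other on `1 + y / T`, whose integral against the renewal measure has order `T ^ α`. -/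
lemma exists_shiftOp_erescale_le (hR : RegularLaplace (renewalMeasure κ) α D ρ) (hα : 0 < α)
    (hβ : 0 < 1 + β) (hf : IsDecaying γ C f) (hγ : 1 + α ≤ γ) :
    ∃ B, 0 < B ∧ ∀ T, 1 ≤ T → ∀ s, 0 ≤ s →
      shiftOp (renewalMeasure κ) (erescale α β T f) (T * s) ≤
        ENNReal.ofReal (B * (T ^ (-((1 + α) / (1 + β))) * (1 + s) ^ (-(γ - (1 + α))))) := by
  obtain ⟨B, hB, h⟩ := hR.exists_lintegral_one_add_rpow_le hα
  have hC := hf.pos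
  refine ⟨C * (2 * B), by positivity, fun T hT s hs => ?_⟩
  have hT0 : 0 < T := by linarith
  have h1s : 0 < 1 + s := by linarith
  rw [shiftOp_erescale hβ hf hT0]
  have h1 : ∫⁻ y, ENNReal.ofReal (f (s + y / T)) ∂(renewalMeasure κ) ≤
      ENNReal.ofReal (C * (1 + s) ^ (-(γ - (1 + α)))) * ENNReal.ofReal (B * (1 + T ^ α)) := by
    refine le_trans ?_ (mul_le_mul_right (h T hT0) _)
    rw [← lintegral_const_mul _ (by fun_prop)]
    refine lintegral_mono_ae ?_
    filter_upwards [hR.ae_nonneg] with y hy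
    have hy0 : 0 ≤ y / T := by positivity
    rw [← ENNReal.ofReal_mul (by positivity)]
    refine ENNReal.ofReal_le_ofReal ((hf.le _ (by positivity)).trans ?_)
    have h2 : (1 + (s + y / T)) ^ (-γ) =
        (1 + (s + y / T)) ^ (-(γ - (1 + α))) * (1 + (s + y / T)) ^ (-(1 + α)) := by
      rw [← Real.rpow_add (by positivity)]
      ring_nf
    rw [h2, mul_assoc]
    refine mul_le_mul_of_nonneg_left (mul_le_mul ?_ ?_ (by positivity) (by positivity)) hC.le
    · exact Real.rpow_le_rpow_of_nonpos (by positivity) (by linarith) (by linarith)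
    · exact Real.rpow_le_rpow_of_nonpos (by positivity) (by linarith) (by linarith)
  refine (mul_le_mul_right h1 _).trans ?_
  rw [← ENNReal.ofReal_mul (by positivity), ← ENNReal.ofReal_mul (by positivity)]
  refine ENNReal.ofReal_le_ofReal ?_
  have h3 : 1 + T ^ α ≤ 2 * T ^ α := by linarith [Real.one_le_rpow hT hα.le]
  have h4 : T ^ (-(α + (1 + α) / (1 + β))) * T ^ α = T ^ (-((1 + α) / (1 + β))) := by
    rw [← Real.rpow_add hT0]
    ring_nf
  calc T ^ (-(α + (1 + α) / (1 + β))) * (C * (1 + s) ^ (-(γ - (1 + α))) * (B * (1 + T ^ α)))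
      ≤ T ^ (-(α + (1 + α) / (1 + β))) * (C * (1 + s) ^ (-(γ - (1 + α))) * (B * (2 * T ^ α))) := by
        gcongr
    _ = C * (2 * B) * ((T ^ (-(α + (1 + α) / (1 + β))) * T ^ α) *
          (1 + s) ^ (-(γ - (1 + α)))) := by ring
    _ = _ := by rw [h4]

lemma integrableOn_one_add_rpow {p : ℝ} (hp : p < -1) :
    IntegrableOn (fun s : ℝ => (1 + s) ^ p) (Ioi 0) := by
  have h := integrableOn_add_rpow_Ioi_of_lt (a := p) (c := 0) (m := 1) hp (by norm_num)
  simpa only [add_comm] using h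

/-- After Fubini the integrand is at most a constant depending on `T` times `(1 + s)^{α - γ}`, and
`γ - α > 1`. -/
lemma lintegral_shiftOp_erescale_ne_top (hκ : ∀ᵐ s ∂κ, 0 ≤ s)
    (hR : RegularLaplace (renewalMeasure κ) α D ρ) (hα : 0 < α)
    (hf : IsDecaying γ C f) (hγ : 1 + α < γ) {T : ℝ} (hT : 1 ≤ T) :
    ∫⁻ t in Ici 0, shiftOp (renewalMeasure κ) (erescale α β T f) t ≠ ∞ := by
  obtain ⟨B, hB, h⟩ := hR.exists_measure_Iic_le hα
  have hT0 : 0 < T := by linarith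
  have hC := hf.pos
  have hF : 0 ≤ 1 / norming α β T := one_div_nonneg.2 (Real.rpow_nonneg hT0.le _)
  rw [lintegral_shiftOp_renewalMeasure hκ (hf.measurable_erescale T)]
  set A := 1 / norming α β T * (C * T ^ γ) * B with hA
  have hint : Integrable (fun s : ℝ => A * (1 + s) ^ (-γ + α)) (volume.restrict (Ici 0)) := by
    refine Integrable.const_mul ?_ A
    have := integrableOn_one_add_rpow (p := -γ + α) (by linarith)
    rwa [IntegrableOn, Measure.restrict_congr_set Ioi_ae_eq_Ici] at this
  refine ne_top_of_le_ne_top hint.lintegral_lt_top.ne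
    (setLIntegral_mono (by fun_prop) fun s (hs : 0 ≤ s) => ?_)
  have h1s : 0 < 1 + s := by linarith
  have h1 := h 1 le_rfl s hs
  rw [one_mul, Real.one_rpow, mul_one] at h1
  refine (mul_le_mul_right h1 _).trans ?_
  rw [← ENNReal.ofReal_mul (hf.rescale_nonneg hT0.le s)]
  refine ENNReal.ofReal_le_ofReal ?_
  have h2 : f (s / T) ≤ C * T ^ γ * (1 + s) ^ (-γ) := by
    refine (hf.le _ (by positivity)).trans ?_
    have h3 : (1 + s) / T ≤ 1 + s / T := by
      rw [add_div]
      gcongr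
      exact (div_le_one hT0).2 hT
    rw [mul_assoc]
    gcongr
    calc (1 + s / T) ^ (-γ) ≤ ((1 + s) / T) ^ (-γ) :=
          Real.rpow_le_rpow_of_nonpos (by positivity) h3 (by linarith)
      _ = T ^ γ * (1 + s) ^ (-γ) := by
          rw [Real.div_rpow h1s.le hT0.le, Real.rpow_neg hT0.le, div_inv_eq_mul, mul_comm]
  rw [rescale, hA, Real.rpow_add h1s]
  calc 1 / norming α β T * f (s / T) * (B * (1 + s) ^ α)
      ≤ 1 / norming α β T * (C * T ^ γ * (1 + s) ^ (-γ)) * (B * (1 + s) ^ α) := by gcongr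
    _ = _ := by ring

section Bounds

variable (hR : RegularLaplace (renewalMeasure κ) α D ρ) (hα : 0 < α) (hβ : 0 < β) (hβ1 : β < 1)
  (hf : IsDecaying γ C f) (hγ : 1 + α ≤ γ) (hν : ∫⁻ x, (x : ℝ≥0∞) ∂ν = 1)
  (hψ : ∃ B : ℝ, 0 < B ∧ ∀ l, 0 ≤ l → markExponent ν l ≤ B * l ^ (1 + β))

include hR hα hβ hf hγ hν

lemma exists_childExponent_le :
    ∃ B, 0 < B ∧ ∀ T, 1 ≤ T → ∀ s, 0 ≤ s → childExponent κ ν (erescale α β T f) (T * s) ≤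
        B * (T ^ (-((1 + α) / (1 + β))) * (1 + s) ^ (-(γ - (1 + α)))) := by
  obtain ⟨B, hB, h⟩ := exists_shiftOp_erescale_le hR hα (by linarith) hf hγ (β := β)
  refine ⟨B, hB, fun T hT s hs => ?_⟩
  have hT0 : 0 < T := by linarith
  have h1 := (childExponent_le_shiftOp (κ := κ) hν (hf.measurable_erescale T) (T * s)).trans
    (h T hT s hs)
  exact (ENNReal.ofReal_le_ofReal_iff (by positivity)).1 h1

include hβ1 hψ

lemma exists_nonlinearity_le :
    ∃ B, 0 < B ∧ ∀ T, 1 ≤ T → ∀ s, 0 ≤ s →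
      nonlinearity ν (rescale α β T f (T * s)) (childExponent κ ν (erescale α β T f) (T * s)) ≤
        B * (T ^ (-(1 + α)) * (1 + s) ^ (-((γ - (1 + α)) * (1 + β)))) := by
  obtain ⟨B, hB, h⟩ := exists_childExponent_le hR hα hβ hf hγ hν
  obtain ⟨B', hB', h'⟩ := hψ
  have hC := hf.pos
  refine ⟨C ^ 2 + C * B + B' * B ^ (1 + β), by positivity, fun T hT s hs => ?_⟩
  have hT0 : 0 < T := by linarith
  have h1s : 1 ≤ 1 + s := by linarith
  set e := (1 + α) / (1 + β) with he
  have he0 : 0 < e := by positivity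
  -- Both the test function and `q` are at most constant multiples of `y ≤ 1`. Hence the quadratic
  -- terms are absorbed by `y ^ (1 + β)`, because `β < 1`.
  set y := T ^ (-e) * (1 + s) ^ (-(γ - (1 + α))) with hy
  have hy0 : 0 < y := by positivity
  have hy1 : y ≤ 1 := mul_le_one₀ (Real.rpow_le_one_of_one_le_of_nonpos hT (by linarith))
    (by positivity) (Real.rpow_le_one_of_one_le_of_nonpos h1s (by linarith))
  have hyβ : T ^ (-(1 + α)) * (1 + s) ^ (-((γ - (1 + α)) * (1 + β))) = y ^ (1 + β) := by
    rw [hy, Real.mul_rpow (by positivity) (by positivity), ← Real.rpow_mul hT0.le,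
      ← Real.rpow_mul (by linarith), neg_mul, neg_mul, he, div_mul_cancel₀ _ (by linarith)]
  have hy2 : y ^ 2 ≤ y ^ (1 + β) := by
    rw [← Real.rpow_two]
    exact Real.rpow_le_rpow_of_exponent_ge hy0 hy1 (by linarith)
  rw [hyβ]
  set q := childExponent κ ν (erescale α β T f) (T * s)
  have hq0 : 0 ≤ q := childExponent_nonneg _
  have hq : q ≤ B * y := h T hT s hs
  have hx0 : 0 ≤ rescale α β T f (T * s) := hf.rescale_nonneg hT0.le _
  have hx : rescale α β T f (T * s) ≤ C * y := by
    rw [rescale_mul (by linarith) hT0, hy, mul_left_comm]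
    refine mul_le_mul (Real.rpow_le_rpow_of_exponent_le hT (by linarith))
      ((hf.le s hs).trans ?_) (hf.nonneg s) (by positivity)
    gcongr
    linarith
  set x := rescale α β T f (T * s)
  refine (nonlinearity_le hx0 hq0).trans ?_
  have h1 : x ^ 2 ≤ C ^ 2 * y ^ 2 := by rw [← mul_pow]; gcongr
  have h2 : x * q ≤ C * B * y ^ 2 := by
    calc x * q ≤ (C * y) * (B * y) := by gcongr
      _ = _ := by ring
  have h3 : markExponent ν q ≤ B' * B ^ (1 + β) * y ^ (1 + β) := by
    refine (h' q hq0).trans ?_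
    rw [mul_assoc, ← Real.mul_rpow hB.le hy0.le]
    gcongr
  calc x ^ 2 + x * q + markExponent ν q
      ≤ C ^ 2 * y ^ 2 + C * B * y ^ 2 + B' * B ^ (1 + β) * y ^ (1 + β) := by linarith
    _ ≤ C ^ 2 * y ^ (1 + β) + C * B * y ^ (1 + β) + B' * B ^ (1 + β) * y ^ (1 + β) := by gcongr
    _ = _ := by ring

/-- By `hγ'` the decay of the nonlinearity is at least that of `(1 + y / T)^{-(1+α)}`; the prefactor
`T^{-(1+α)}` and the growth `T ^ α` of the renewal measure leave `T⁻¹`. -/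
lemma exists_shiftOp_remainder_le (hγ' : 1 + α ≤ (γ - (1 + α)) * (1 + β)) :
    ∃ B, 0 < B ∧ ∀ T, 1 ≤ T → ∀ s, 0 ≤ s →
      shiftOp (renewalMeasure κ) (remainder κ ν (erescale α β T f)) (T * s) ≤
        ENNReal.ofReal (B * T ^ (-1 : ℝ)) := by
  obtain ⟨B, hB, h⟩ := exists_nonlinearity_le hR hα hβ hβ1 hf hγ hν hψ
  obtain ⟨B', hB', h'⟩ := hR.exists_lintegral_one_add_rpow_le hα
  refine ⟨B * (2 * B'), by positivity, fun T hT s hs => ?_⟩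
  have hT0 : 0 < T := by linarith
  have h1 : shiftOp (renewalMeasure κ) (remainder κ ν (erescale α β T f)) (T * s) ≤
      ENNReal.ofReal (B * T ^ (-(1 + α))) * ENNReal.ofReal (B' * (1 + T ^ α)) := by
    refine le_trans ?_ (mul_le_mul_right (h' T hT0) _)
    rw [shiftOp, ← lintegral_const_mul _ (by fun_prop)]
    refine lintegral_mono_ae ?_
    filter_upwards [hR.ae_nonneg] with y hy
    have hy0 : 0 ≤ y / T := by positivity
    rw [← ENNReal.ofReal_mul (by positivity), remainder,
      ENNReal.toReal_ofReal (hf.rescale_nonneg hT0.le _)]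
    refine ENNReal.ofReal_le_ofReal ?_
    have e : T * s + y = T * (s + y / T) := by field_simp
    rw [e]
    refine (h T hT (s + y / T) (by positivity)).trans ?_
    rw [← mul_assoc]
    refine mul_le_mul_of_nonneg_left ?_ (by positivity)
    calc (1 + (s + y / T)) ^ (-((γ - (1 + α)) * (1 + β)))
        ≤ (1 + (s + y / T)) ^ (-(1 + α)) :=
          Real.rpow_le_rpow_of_exponent_le (by linarith) (by linarith)
      _ ≤ (1 + y / T) ^ (-(1 + α)) :=
          Real.rpow_le_rpow_of_nonpos (by positivity) (by linarith) (by linarith)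
  refine h1.trans ?_
  rw [← ENNReal.ofReal_mul (by positivity)]
  refine ENNReal.ofReal_le_ofReal ?_
  have h3 : 1 + T ^ α ≤ 2 * T ^ α := by linarith [Real.one_le_rpow hT hα.le]
  have h4 : T ^ (-(1 + α)) * T ^ α = T ^ (-1 : ℝ) := by
    rw [← Real.rpow_add hT0]
    ring_nf
  calc B * T ^ (-(1 + α)) * (B' * (1 + T ^ α)) ≤ B * T ^ (-(1 + α)) * (B' * (2 * T ^ α)) := by
        gcongr
    _ = B * (2 * B') * (T ^ (-(1 + α)) * T ^ α) := by ring
    _ = _ := by rw [h4]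

end Bounds

end IsDecaying

/-! ### Pointwise limits and the limit of the exponent. -/

lemma tendsto_markExponent_div {ν : Measure ℝ≥0} {β k L : ℝ} (hβ : 0 < 1 + β)
    (hψB : ∃ B : ℝ, 0 < B ∧ ∀ l, 0 ≤ l → markExponent ν l ≤ B * l ^ (1 + β))
    (hψ : Tendsto (fun l : ℝ => l ^ (-(1 + β)) * markExponent ν l) (𝓝[>] 0) (𝓝 k))
    {q b : ℝ → ℝ} (hq : ∀ T, 0 ≤ q T) (hq0 : Tendsto q atTop (𝓝 0)) (hb : ∀ᶠ T in atTop, 0 < b T)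
    (hL : 0 ≤ L) (h : Tendsto (fun T => b T * q T) atTop (𝓝 L)) :
    Tendsto (fun T => b T ^ (1 + β) * markExponent ν (q T)) atTop (𝓝 (k * L ^ (1 + β))) := by
  have h1 : Tendsto (fun T => (b T * q T) ^ (1 + β)) atTop (𝓝 (L ^ (1 + β))) :=
    h.rpow_const (Or.inr hβ.le)
  -- If `L = 0`, then `q` may vanish and the asymptotics at `0+` cannot be composed with it; the
  -- global bound takes their place.
  rcases hL.eq_or_lt with rfl | hL
  · obtain ⟨B, hB, hψB⟩ := hψB
    rw [Real.zero_rpow hβ.ne'] at h1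
    rw [Real.zero_rpow hβ.ne', mul_zero]
    refine squeeze_zero' ?_ ?_ (by simpa using h1.const_mul B)
    · filter_upwards [hb] with T hT
      exact mul_nonneg (Real.rpow_nonneg hT.le _) (markExponent_nonneg _)
    · filter_upwards [hb] with T hT
      have := hψB (q T) (hq T)
      rw [Real.mul_rpow hT.le (hq T), mul_left_comm]
      gcongr
  · have hpos : ∀ᶠ T in atTop, 0 < q T := by
      filter_upwards [hb, h.eventually (lt_mem_nhds hL)] with T h2 h3
      exact (pos_iff_pos_of_mul_pos h3).1 h2
    have h2 : Tendsto q atTop (𝓝[>] 0) := tendsto_nhdsWithin_iff.2 ⟨hq0, hpos⟩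
    have h3 := (hψ.comp h2).mul h1
    refine h3.congr' ?_
    filter_upwards [hb, hpos] with T h4 h5
    have h6 : q T ^ (-(1 + β)) * q T ^ (1 + β) = 1 := by
      rw [← Real.rpow_add h5, neg_add_cancel, Real.rpow_zero]
    rw [Function.comp_apply, Real.mul_rpow h4.le h5.le]
    calc q T ^ (-(1 + β)) * markExponent ν (q T) * (b T ^ (1 + β) * q T ^ (1 + β))
        = (q T ^ (-(1 + β)) * q T ^ (1 + β)) * (b T ^ (1 + β) * markExponent ν (q T)) := by ring
      _ = _ := by rw [h6, one_mul]

namespace IsDecaying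

variable {α β γ C D k : ℝ} {f ρ : ℝ → ℝ} {κ : Measure ℝ} [IsProbabilityMeasure κ]
  {ν : Measure ℝ≥0} [IsProbabilityMeasure ν]

lemma finite_discont_shift (hf : IsDecaying γ C f) {s : ℝ} (hs : 0 ≤ s) :
    {y | 0 ≤ y ∧ ¬ ContinuousWithinAt (fun y => f (s + y)) (Ici 0) y}.Finite := by
  refine (hf.finite_discont.preimage (f := fun y => s + y)
    (add_right_injective s).injOn).subset fun y hy => ⟨add_nonneg hs hy.1, fun h => hy.2 ?_⟩
  exact ContinuousWithinAt.comp (g := f) h (by fun_prop) fun z hz => add_nonneg hs hz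

lemma scalingLimit_shift {θ : Measure ℝ} [SFinite θ] (hR : RegularLaplace θ α D ρ) (hα : 0 < α)
    (hf : IsDecaying γ C f) (hγ : 1 + α < γ) {s : ℝ} (hs : 0 ≤ s) :
    ScalingLimit θ α (D / Real.Gamma α) fun y => f (s + y) := by
  refine hR.scalingLimit hα (hf.measurable.comp (by fun_prop)) (hf.finite_discont_shift hs)
    hf.pos hγ fun y hy => ?_
  have hC := hf.pos
  rw [abs_of_nonneg (hf.nonneg _)]
  refine (hf.le _ (add_nonneg hs hy)).trans ?_
  gcongr C * ?_
  exact Real.rpow_le_rpow_of_nonpos (by linarith) (by linarith) (by linarith)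

lemma tendsto_toReal_shiftOp_erescale {θ : Measure ℝ} [SFinite θ] (hR : RegularLaplace θ α D ρ)
    (hα : 0 < α) (hβ : 0 < 1 + β) (hf : IsDecaying γ C f) (hγ : 1 + α < γ) {s : ℝ} (hs : 0 ≤ s) :
    Tendsto (fun T => T ^ ((1 + α) / (1 + β)) * (shiftOp θ (erescale α β T f) (T * s)).toReal)
      atTop (𝓝 (D / Real.Gamma α * potential α f s)) := by
  have h := hf.scalingLimit_shift hR hα hγ hs
  refine h.tendsto.congr' ?_
  filter_upwards [eventually_gt_atTop 0] with T hT
  have hm := hf.measurable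
  rw [shiftOp_erescale hβ hf hT, ENNReal.toReal_mul, ENNReal.toReal_ofReal (by positivity),
    ← integral_eq_lintegral_of_nonneg_ae (Eventually.of_forall fun _ => hf.nonneg _)
      (by fun_prop : Measurable fun y => f (s + y / T)).aestronglyMeasurable, ← mul_assoc,
    ← Real.rpow_add hT]
  congr 2
  ring

/-- The scaling limit applied to an indicator, which has a single discontinuity; the constant `(1 +
s) ^ (2 + α)` merely secures the required decay. -/
lemma tendsto_real_Iic {θ : Measure ℝ} [SFinite θ] (hR : RegularLaplace θ α D ρ) (hα : 0 < α)
    {s : ℝ} (hs : 0 < s) :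
    Tendsto (fun T => T ^ (-α) * θ.real (Iic (T * s))) atTop
      (𝓝 (D / Real.Gamma α * (s ^ α / α))) := by
  have hfin : {y | 0 ≤ y ∧
      ¬ ContinuousWithinAt ((Iic s).indicator fun _ => (1 : ℝ)) (Ici 0) y}.Finite := by
    refine (finite_singleton s).subset fun y hy => ?_
    by_contra h
    rcases lt_or_gt_of_ne (show y ≠ s from h) with h1 | h1
    · refine hy.2 (ContinuousAt.continuousWithinAt (continuousAt_const (y := (1 : ℝ)).congr ?_))
      filter_upwards [Iio_mem_nhds h1] with z hz
      rw [indicator_of_mem (mem_Iic.2 (le_of_lt (mem_Iio.1 hz)))]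
    · refine hy.2 (ContinuousAt.continuousWithinAt (continuousAt_const (y := (0 : ℝ)).congr ?_))
      filter_upwards [Ioi_mem_nhds h1] with z hz
      rw [indicator_of_notMem (notMem_Iic.2 hz)]
  have h := hR.scalingLimit hα (h := (Iic s).indicator fun _ => (1 : ℝ))
    (measurable_const.indicator measurableSet_Iic) hfin (C := (1 + s) ^ (2 + α)) (γ := 2 + α)
    (by positivity) (by linarith) fun y hy => by
      have h1 : (1 + s) ^ (2 + α) * (1 + s) ^ (-(2 + α)) = 1 := by
        rw [← Real.rpow_add (by positivity), add_neg_cancel, Real.rpow_zero]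
      by_cases hys : y ∈ Iic s
      · rw [indicator_of_mem hys, abs_one]
        refine h1.symm.trans_le ?_
        gcongr (1 + s) ^ (2 + α) * ?_
        exact Real.rpow_le_rpow_of_nonpos (by positivity) (by linarith [mem_Iic.1 hys])
          (by linarith)
      · rw [indicator_of_notMem hys, abs_zero]
        positivity
  have h2 : ∫ y in Ioi 0, (Iic s).indicator (fun _ => (1 : ℝ)) y * y ^ (α - 1) = s ^ α / α := by
    have h3 : ∀ y, (Iic s).indicator (fun _ => (1 : ℝ)) y * y ^ (α - 1) =
        (Iic s).indicator (fun y => y ^ (α - 1)) y := fun y => by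
      by_cases hys : y ∈ Iic s <;> simp [hys]
    simp_rw [h3]
    rw [setIntegral_indicator measurableSet_Iic, Ioi_inter_Iic,
      ← intervalIntegral.integral_of_le hs.le, integral_rpow (.inl (by linarith)), sub_add_cancel,
      Real.zero_rpow hα.ne', sub_zero]
  rw [← h2]
  refine h.tendsto.congr' ?_
  filter_upwards [eventually_gt_atTop 0] with T hT
  have h4 : (fun y : ℝ => (Iic s).indicator (fun _ => (1 : ℝ)) (y / T)) =
      (Iic (T * s)).indicator fun _ => (1 : ℝ) := by
    ext y
    have : y / T ∈ Iic s ↔ y ∈ Iic (T * s) := by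
      rw [mem_Iic, mem_Iic, div_le_iff₀ hT, mul_comm]
    by_cases hy : y ∈ Iic (T * s)
    · rw [indicator_of_mem hy, indicator_of_mem (this.2 hy)]
    · rw [indicator_of_notMem hy, indicator_of_notMem (this.not.2 hy)]
  rw [h4, integral_indicator measurableSet_Iic, setIntegral_const, smul_eq_mul, mul_one]

lemma potential_nonneg (hf : IsDecaying γ C f) (s : ℝ) : 0 ≤ potential α f s :=
  setIntegral_nonneg measurableSet_Ioi fun _ (hy : 0 < _) =>
    mul_nonneg (hf.nonneg _) (Real.rpow_nonneg hy.le _)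

lemma measurable_potential (hf : IsDecaying γ C f) : Measurable (potential α f) := by
  have hm := hf.measurable
  exact (StronglyMeasurable.integral_prod_right' (f := fun p : ℝ × ℝ =>
    f (p.1 + p.2) * p.2 ^ (α - 1)) (Measurable.stronglyMeasurable (by fun_prop))).measurable

lemma exists_potential_le (hα : 0 < α) (hf : IsDecaying γ C f) (hγ : 1 + α ≤ γ) :
    ∃ B, 0 ≤ B ∧ ∀ s, 0 ≤ s → potential α f s ≤ B * (1 + s) ^ (-(γ - (1 + α))) := by
  have hC := hf.pos
  refine ⟨C * ∫ y in Ioi 0, (1 + y) ^ (-(1 + α)) * y ^ (α - 1), ?_, fun s hs => ?_⟩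
  · exact mul_nonneg hC.le (setIntegral_nonneg measurableSet_Ioi fun y (hy : 0 < y) => by positivity)
  · rw [mul_right_comm, ← integral_const_mul]
    refine integral_mono_of_nonneg ?_
      ((RegularLaplace.integrableOn_one_add_rpow_mul_rpow hα).const_mul _) ?_
    · refine (ae_restrict_iff' measurableSet_Ioi).2 (Eventually.of_forall fun y (hy : 0 < y) => ?_)
      exact mul_nonneg (hf.nonneg _) (Real.rpow_nonneg hy.le _)
    · refine (ae_restrict_iff' measurableSet_Ioi).2 (Eventually.of_forall fun y (hy : 0 < y) => ?_)
      dsimp only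
      rw [← mul_assoc]
      gcongr
      refine (hf.le _ (by positivity)).trans ?_
      have h2 : (1 + (s + y)) ^ (-γ) =
          (1 + (s + y)) ^ (-(γ - (1 + α))) * (1 + (s + y)) ^ (-(1 + α)) := by
        rw [← Real.rpow_add (by positivity)]
        ring_nf
      rw [h2, mul_assoc]
      refine mul_le_mul_of_nonneg_left (mul_le_mul ?_ ?_ (by positivity) (by positivity)) hC.le
      · exact Real.rpow_le_rpow_of_nonpos (by positivity) (by linarith) (by linarith)
      · exact Real.rpow_le_rpow_of_nonpos (by positivity) (by linarith) (by linarith)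

lemma integrableOn_potential_rpow_mul (hα : 0 < α) (hβ : 0 < 1 + β) (hf : IsDecaying γ C f)
    (hγ : 1 + α ≤ γ) (hγ' : 1 + α < (γ - (1 + α)) * (1 + β)) :
    IntegrableOn (fun t => potential α f t ^ (1 + β) * t ^ α) (Ioi 0) := by
  obtain ⟨B, hB, h⟩ := hf.exists_potential_le hα hγ
  have hm := hf.measurable_potential (α := α)
  refine ((integrableOn_one_add_rpow (p := α - (γ - (1 + α)) * (1 + β)) (by linarith)).const_mul
    (B ^ (1 + β))).mono' (by fun_prop) ?_
  refine (ae_restrict_iff' measurableSet_Ioi).2 (Eventually.of_forall fun t (ht : 0 < t) => ?_)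
  have hp := hf.potential_nonneg (α := α) t
  rw [Real.norm_of_nonneg (by positivity)]
  have h1 : (1 + t) ^ (α - (γ - (1 + α)) * (1 + β)) =
      ((1 + t) ^ (-(γ - (1 + α)))) ^ (1 + β) * (1 + t) ^ α := by
    rw [← Real.rpow_mul (by positivity), ← Real.rpow_add (by positivity)]
    ring_nf
  rw [h1, ← mul_assoc, ← Real.mul_rpow hB (by positivity)]
  gcongr
  · exact h t ht.le
  · linarith

section Limit

variable (hR : RegularLaplace (renewalMeasure κ) α D ρ) (hα : 0 < α) (hαβ : α < β) (hβ1 : β < 1)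
  (hf : IsDecaying γ C f) (hγ' : 1 + α < (γ - (1 + α)) * (1 + β))
  (hν : ∫⁻ x, (x : ℝ≥0∞) ∂ν = 1)
  (hψB : ∃ B : ℝ, 0 < B ∧ ∀ l, 0 ≤ l → markExponent ν l ≤ B * l ^ (1 + β))
  (hψ : Tendsto (fun l : ℝ => l ^ (-(1 + β)) * markExponent ν l) (𝓝[>] 0) (𝓝 k))

lemma tendsto_rpow_mul_zero {p : ℝ} (hp : p < 0) (c : ℝ) :
    Tendsto (fun T : ℝ => c * T ^ p) atTop (𝓝 0) := by
  have h := (tendsto_rpow_neg_atTop (y := -p) (by linarith)).const_mul c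
  simpa only [neg_neg, mul_zero] using h

include hR hα hαβ hβ1 hf hγ' hν hψB

lemma tendsto_childExponent {s : ℝ} (hs : 0 ≤ s) :
    Tendsto (fun T => T ^ ((1 + α) / (1 + β)) * childExponent κ ν (erescale α β T f) (T * s))
      atTop (𝓝 (D / Real.Gamma α * potential α f s)) := by
  have hβ : 0 < β := by linarith
  have hγ : 1 + α < γ := by nlinarith
  obtain ⟨B, hB, h1⟩ := exists_nonlinearity_le hR hα hβ hβ1 hf hγ.le hν hψB
  obtain ⟨B', hB', h2⟩ := exists_shiftOp_remainder_le hR hα hβ hβ1 hf hγ.le hν hψB hγ'.le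
  obtain ⟨B₀, hB₀, h3⟩ := exists_shiftOp_erescale_le (β := β) hR hα (by linarith) hf hγ.le
  have h4 := tendsto_toReal_shiftOp_erescale (β := β) hR hα (by linarith) hf hγ hs
  set e := (1 + α) / (1 + β) with he
  -- Here `α < β` enters: multiplied by `T ^ e`, a remainder of order `T⁻¹` still vanishes.
  have he1 : e < 1 := by rw [he, div_lt_one (by linarith)]; linarith
  have l1 : Tendsto (fun T => T ^ e * (shiftOp (renewalMeasure κ)
      (remainder κ ν (erescale α β T f)) (T * s)).toReal) atTop (𝓝 0) := by
    refine squeeze_zero' ?_ ?_ (tendsto_rpow_mul_zero (p := e - 1) (by linarith) B')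
    · filter_upwards [eventually_ge_atTop 0] with T hT
      positivity
    · filter_upwards [eventually_ge_atTop 1] with T hT
      have hT0 : 0 < T := by linarith
      have h5 := ENNReal.toReal_le_of_le_ofReal (by positivity) (h2 T hT s hs)
      rw [sub_eq_add_neg, Real.rpow_add hT0, mul_left_comm]
      gcongr
  have l2 : Tendsto (fun T => T ^ e * (remainder κ ν (erescale α β T f) (T * s)).toReal) atTop
      (𝓝 0) := by
    refine squeeze_zero' ?_ ?_ (tendsto_rpow_mul_zero (p := e - (1 + α)) (by linarith) B)
    · filter_upwards [eventually_ge_atTop 0] with T hT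
      positivity
    · filter_upwards [eventually_ge_atTop 1] with T hT
      have hT0 : 0 < T := by linarith
      have hx := hf.rescale_nonneg (α := α) (β := β) hT0.le (T * s)
      rw [remainder, ENNReal.toReal_ofReal hx, ENNReal.toReal_ofReal
        (nonlinearity_nonneg hx (childExponent_nonneg _)), sub_eq_add_neg, Real.rpow_add hT0,
        mul_left_comm]
      have h6 : (1 + s) ^ (-((γ - (1 + α)) * (1 + β))) ≤ 1 :=
        Real.rpow_le_one_of_one_le_of_nonpos (by linarith) (by linarith)
      gcongr
      refine (h1 T hT s hs).trans ?_
      gcongr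
      exact mul_le_of_le_one_right (by positivity) h6
  have l3 : Tendsto (fun T => T ^ e * (erescale α β T f (T * s)).toReal) atTop (𝓝 0) := by
    refine (tendsto_rpow_mul_zero (p := -α) (by linarith) (f s)).congr' ?_
    filter_upwards [eventually_gt_atTop 0] with T hT
    rw [ENNReal.toReal_ofReal (hf.rescale_nonneg hT.le _), rescale_mul (by linarith) hT,
      ← mul_assoc, ← Real.rpow_add hT, mul_comm]
    congr 2
    ring
  have h7 := ((h4.sub l1).add l2).sub l3
  rw [sub_zero, add_zero, sub_zero] at h7
  refine h7.congr' ?_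
  filter_upwards [eventually_ge_atTop 1] with T hT
  rw [childExponent_eq hν (hf.measurable_erescale T) (fun _ => ENNReal.ofReal_ne_top)
    (ne_top_of_le_ne_top ENNReal.ofReal_ne_top (h3 T hT s hs))]
  ring

include hψ

lemma tendsto_nonlinearity {s : ℝ} (hs : 0 ≤ s) :
    Tendsto (fun T => T ^ (1 + α) * nonlinearity ν (rescale α β T f (T * s))
      (childExponent κ ν (erescale α β T f) (T * s))) atTop
      (𝓝 (k * (D / Real.Gamma α * potential α f s) ^ (1 + β))) := by
  have hβ : 0 < β := by linarith
  have hγ : 1 + α < γ := by nlinarith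
  have hq := tendsto_childExponent hR hα hαβ hβ1 hf hγ' hν hψB hs
  set e := (1 + α) / (1 + β) with he
  have he0 : 0 < e := by positivity
  -- From `β < 1`. It makes the powers of `T` in front of the quadratic terms negative, so only the
  -- `markExponent` term survives.
  have he2 : (1 + α) / 2 < e := by
    rw [he, div_lt_div_iff_of_pos_left] <;> linarith
  have heβ : e * (1 + β) = 1 + α := div_mul_cancel₀ _ (by linarith)
  set q : ℝ → ℝ := fun T => childExponent κ ν (erescale α β T f) (T * s) with hqdef
  set x : ℝ → ℝ := fun T => rescale α β T f (T * s) with hxdef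
  have hq0 : ∀ T, 0 ≤ q T := fun T => childExponent_nonneg _
  have hx : ∀ᶠ T in atTop, x T = T ^ (-(α + e)) * f s := by
    filter_upwards [eventually_gt_atTop 0] with T hT
    exact rescale_mul (by linarith) hT s
  have hx0 : ∀ᶠ T in atTop, 0 ≤ x T := by
    filter_upwards [eventually_ge_atTop 0] with T hT
    exact hf.rescale_nonneg hT _
  have hxlim : Tendsto x atTop (𝓝 0) := by
    refine (tendsto_rpow_mul_zero (p := -(α + e)) (by linarith) (f s)).congr' ?_
    filter_upwards [hx] with T hT
    rw [hT, mul_comm]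
  have hqlim : Tendsto q atTop (𝓝 0) := by
    have h1 := (tendsto_rpow_neg_atTop he0).mul hq
    rw [zero_mul] at h1
    refine h1.congr' ?_
    filter_upwards [eventually_gt_atTop 0] with T hT
    rw [← mul_assoc, ← Real.rpow_add hT, neg_add_cancel, Real.rpow_zero, one_mul]
  have hL : 0 ≤ D / Real.Gamma α * potential α f s :=
    mul_nonneg (hR.d_nonneg hα) (hf.potential_nonneg s)
  have l3 : Tendsto (fun T => T ^ (1 + α) * markExponent ν (q T)) atTop
      (𝓝 (k * (D / Real.Gamma α * potential α f s) ^ (1 + β))) := by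
    refine (tendsto_markExponent_div (by linarith) hψB hψ hq0 hqlim (b := fun T => T ^ e)
      ((eventually_gt_atTop 0).mono fun T hT => Real.rpow_pos_of_pos hT _) hL hq).congr' ?_
    filter_upwards [eventually_gt_atTop 0] with T hT
    rw [← Real.rpow_mul hT.le, heβ]
  have l1 : Tendsto (fun T => T ^ (1 + α) * (x T - 1 + Real.exp (-x T))) atTop (𝓝 0) := by
    refine squeeze_zero' ?_ ?_
      (tendsto_rpow_mul_zero (p := (1 + α) - (α + e) - (α + e)) (by linarith) (f s ^ 2))
    · filter_upwards [eventually_ge_atTop 0] with T hT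
      have : 0 ≤ x T - 1 + Real.exp (-x T) := by linarith [Real.add_one_le_exp (-x T)]
      positivity
    · filter_upwards [eventually_gt_atTop 0, hx0, hx] with T hT h1 h2
      have h3 := exp_neg_sub_one_add_le h1
      calc T ^ (1 + α) * (x T - 1 + Real.exp (-x T)) ≤ T ^ (1 + α) * x T ^ 2 := by gcongr
        _ = f s ^ 2 * T ^ ((1 + α) - (α + e) - (α + e)) := by
          rw [h2, sub_eq_add_neg _ (α + e), sub_eq_add_neg _ (α + e), Real.rpow_add hT _ (-(α + e)),
            Real.rpow_add hT _ (-(α + e))]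
          ring
  have l2 : Tendsto (fun T => T ^ (1 + α) * ((1 - Real.exp (-x T)) * q T)) atTop (𝓝 0) := by
    have h1 := (tendsto_rpow_mul_zero (p := (1 + α) - (α + e) - e) (by linarith) (f s)).mul hq
    rw [zero_mul] at h1
    refine squeeze_zero' ?_ ?_ h1
    · filter_upwards [eventually_ge_atTop 0, hx0] with T hT h2
      have := one_sub_exp_neg_nonneg h2
      have := hq0 T
      positivity
    · filter_upwards [eventually_gt_atTop 0, hx0, hx] with T hT h1 h2
      have h3 : 1 - Real.exp (-x T) ≤ x T := by linarith [Real.add_one_le_exp (-x T)]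
      have h4 := hq0 T
      calc T ^ (1 + α) * ((1 - Real.exp (-x T)) * q T) ≤ T ^ (1 + α) * (x T * q T) := by gcongr
        _ = T ^ (1 + α) * T ^ (-(α + e)) * (T ^ (-e) * T ^ e) * f s * q T := by
          rw [h2, ← Real.rpow_add hT (-e), neg_add_cancel, Real.rpow_zero]
          ring
        _ = _ := by
          rw [sub_eq_add_neg _ (α + e), sub_eq_add_neg _ e, Real.rpow_add hT _ (-e),
            Real.rpow_add hT _ (-(α + e))]
          ring
  have l4 : Tendsto (fun T => Real.exp (-x T)) atTop (𝓝 1) := by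
    have h := (Real.continuous_exp.tendsto _).comp hxlim.neg
    rwa [neg_zero, Real.exp_zero] at h
  have h := (l1.add l2).add (l4.mul l3)
  rw [zero_add, zero_add, one_mul] at h
  refine h.congr fun T => ?_
  rw [nonlinearity]
  ring

/-- Dominated convergence after the substitution of `T * s` for `s`, with the weights `T ^ (1 + α)`
on the nonlinearity and `T ^ (-α)` on the renewal measure. -/
lemma tendsto_lintegral_remainder :
    Tendsto (fun T => (∫⁻ s in Ici 0, remainder κ ν (erescale α β T f) s *
      renewalMeasure κ (Iic s)).toReal) atTop
      (𝓝 (k * (D / Real.Gamma α) ^ (2 + β) / α *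
        ∫ t in Ioi 0, potential α f t ^ (1 + β) * t ^ α)) := by
  have hβ : 0 < β := by linarith
  have hγ : 1 + α < γ := by nlinarith
  obtain ⟨B, hB, hH⟩ := exists_nonlinearity_le hR hα hβ hβ1 hf hγ.le hν hψB
  obtain ⟨B', hB', hU⟩ := hR.exists_measure_Iic_le hα
  set I : ℝ → ℝ → ℝ := fun T s => (T ^ (1 + α) * nonlinearity ν (rescale α β T f (T * s))
      (childExponent κ ν (erescale α β T f) (T * s))) *
      (T ^ (-α) * (renewalMeasure κ).real (Iic (T * s))) with hI
  have hI0 : ∀ T, 0 ≤ T → ∀ s, 0 ≤ I T s := fun T hT s => by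
    have := nonlinearity_nonneg (ν := ν) (hf.rescale_nonneg (α := α) (β := β) hT (T * s))
      (childExponent_nonneg (κ := κ) (ν := ν) (h := erescale α β T f) (T * s))
    positivity
  set J : ℝ → ℝ → ℝ := fun T s => nonlinearity ν (rescale α β T f s)
    (childExponent κ ν (erescale α β T f) s) * (renewalMeasure κ).real (Iic s) with hJ
  have hIJ : ∀ T, I T = fun s => T ^ (1 + α) * T ^ (-α) * J T (T * s) := fun T => by
    ext s
    rw [hI, hJ]
    ring
  have hJm : ∀ T, Measurable (J T) := fun T => by
    have h1 := measurable_childExponent (κ := κ) (ν := ν)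
      (hf.measurable_erescale (α := α) (β := β) T)
    have h2 := hf.measurable_rescale (α := α) (β := β) T
    have h3 : Measurable fun s => (renewalMeasure κ).real (Iic s) :=
      Measurable.ennreal_toReal (Monotone.measurable fun a b hab =>
        measure_mono (Iic_subset_Iic.2 hab))
    simp only [hJ]
    unfold nonlinearity
    fun_prop
  have hIm : ∀ T, Measurable (I T) := fun T => by
    have := hJm T
    rw [hIJ]
    fun_prop
  have hIeq : ∀ᶠ T in atTop, ∫ s in Ioi 0, I T s = (∫⁻ s in Ici 0,
      remainder κ ν (erescale α β T f) s * renewalMeasure κ (Iic s)).toReal := by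
    filter_upwards [eventually_gt_atTop 0] with T hT
    have h0 : ∀ s, 0 ≤ nonlinearity ν (rescale α β T f s)
        (childExponent κ ν (erescale α β T f) s) := fun s =>
      nonlinearity_nonneg (hf.rescale_nonneg hT.le s) (childExponent_nonneg _)
    -- The two weights multiply to exactly the Jacobian of the substitution.
    have h1 : T ^ (1 + α) * T ^ (-α) = T := by
      rw [← Real.rpow_add hT, add_neg_cancel_right, Real.rpow_one]
    rw [hIJ, h1, integral_const_mul, integral_comp_mul_left_Ioi (J T) 0 hT, mul_zero, smul_eq_mul,
      mul_inv_cancel_left₀ hT.ne', ← integral_Ici_eq_integral_Ioi,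
      integral_eq_lintegral_of_nonneg_ae
        (Eventually.of_forall fun s => mul_nonneg (h0 s) measureReal_nonneg)
        (hJm T).aestronglyMeasurable]
    congr 1
    refine setLIntegral_congr_fun measurableSet_Ici fun s (hs : 0 ≤ s) => ?_
    have h2 := hU 1 le_rfl s hs
    rw [one_mul] at h2
    rw [remainder, ENNReal.toReal_ofReal (hf.rescale_nonneg hT.le s), ENNReal.ofReal_mul (h0 s),
      ofReal_measureReal (ne_top_of_le_ne_top ENNReal.ofReal_ne_top h2)]
  have hlim : k * (D / Real.Gamma α) ^ (2 + β) / α *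
      ∫ t in Ioi 0, potential α f t ^ (1 + β) * t ^ α =
      ∫ s in Ioi 0, (k * (D / Real.Gamma α * potential α f s) ^ (1 + β)) *
        (D / Real.Gamma α * (s ^ α / α)) := by
    rw [← integral_const_mul]
    refine integral_congr_ae (Eventually.of_forall fun s => ?_)
    have hd := hR.d_nonneg hα
    dsimp only
    rw [Real.mul_rpow hd (hf.potential_nonneg s), show 2 + β = (1 + β) + 1 by ring,
      Real.rpow_add_one' hd (by linarith)]
    ring
  rw [hlim]
  refine Tendsto.congr' hIeq ?_
  -- The exponent of `1 + s` is below `-1` precisely by `hγ'`.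
  refine tendsto_integral_filter_of_dominated_convergence
    (fun s => B * B' * (1 + s) ^ (α - (γ - (1 + α)) * (1 + β)))
    (Eventually.of_forall fun T => (hIm T).aestronglyMeasurable) ?_
    ((integrableOn_one_add_rpow (by linarith)).const_mul _) ?_
  · filter_upwards [eventually_ge_atTop 1] with T hT
    have hT0 : 0 < T := by linarith
    refine (ae_restrict_iff' measurableSet_Ioi).2 (Eventually.of_forall fun s (hs : 0 < s) => ?_)
    rw [Real.norm_of_nonneg (hI0 T hT0.le s)]
    have h1 := hH T hT s hs.le
    have h2 : (renewalMeasure κ).real (Iic (T * s)) ≤ B' * T ^ α * (1 + s) ^ α :=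
      ENNReal.toReal_le_of_le_ofReal (by positivity) (hU T hT s hs.le)
    have h3 : T ^ (1 + α) * T ^ (-(1 + α)) = 1 := by
      rw [← Real.rpow_add hT0, add_neg_cancel, Real.rpow_zero]
    have h4 : T ^ (-α) * T ^ α = 1 := by
      rw [← Real.rpow_add hT0, neg_add_cancel, Real.rpow_zero]
    calc I T s ≤ (T ^ (1 + α) * (B * (T ^ (-(1 + α)) *
          (1 + s) ^ (-((γ - (1 + α)) * (1 + β)))))) *
          (T ^ (-α) * (B' * T ^ α * (1 + s) ^ α)) := by
          rw [hI]
          dsimp only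
          gcongr
      _ = B * B' * ((1 + s) ^ α * (1 + s) ^ (-((γ - (1 + α)) * (1 + β)))) *
          (T ^ (1 + α) * T ^ (-(1 + α))) * (T ^ (-α) * T ^ α) := by ring
      _ = _ := by rw [h3, h4, mul_one, mul_one, ← Real.rpow_add (by linarith), ← sub_eq_add_neg]
  · refine (ae_restrict_iff' measurableSet_Ioi).2 (Eventually.of_forall fun s (hs : 0 < s) => ?_)
    exact (tendsto_nonlinearity hR hα hαβ hβ1 hf hγ' hν hψB hψ hs.le).mul
      (tendsto_real_Iic hR hα hs)

end Limit

end IsDecaying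

/-! ### Reduction to functions vanishing on the negative half-line, and conclusion. -/

lemma IsTestFunction.isDecaying_indicator {γ : ℝ} {f : ℝ → ℝ} (hf : IsTestFunction γ f) :
    ∃ C, IsDecaying γ C ((Ici 0).indicator f) := by
  obtain ⟨C, hC, hle⟩ := hf.decay
  -- Measurability comes from continuity off a finite set: the indicator differs from a piecewise
  -- continuous function at finitely many points only.
  have hcont : ContinuousOn f (Ici 0 \ {s | 0 ≤ s ∧ ¬ ContinuousWithinAt f (Ici 0) s}) :=
    fun s hs => (by_contra fun h => hs.2 ⟨hs.1, h⟩ : ContinuousWithinAt f (Ici 0) s).mono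
      sdiff_subset
  refine ⟨C, ⟨?_, fun s => indicator_nonneg (fun s hs => hf.nonneg s hs) s,
    fun s hs => indicator_of_notMem (notMem_Ici.2 hs) f, ?_, hC, fun s hs => ?_⟩⟩
  · classical
    have h1 := hcont.measurable_piecewise (continuousOn_const (c := (0 : ℝ)))
      (measurableSet_Ici.diff hf.finite_discont.measurableSet)
    refine h1.measurable_of_countable_ne (hf.finite_discont.countable.mono fun s hs => ?_)
    by_contra h
    refine hs ?_
    by_cases h0 : s ∈ Ici (0 : ℝ)
    · rw [indicator_of_mem h0, piecewise_eq_of_mem _ _ _ (mem_sdiff_of_mem h0 h)]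
    · rw [indicator_of_notMem h0, piecewise_eq_of_notMem _ _ _ fun h2 => h0 h2.1]
  · refine hf.finite_discont.subset fun s hs => ⟨hs.1, fun h => hs.2 ?_⟩
    exact h.congr (fun y hy => indicator_of_mem hy f) (indicator_of_mem (mem_Ici.2 hs.1) f)
  · rw [indicator_of_mem (mem_Ici.2 hs), Real.rpow_neg (by linarith), ← div_eq_mul_inv]
    exact (le_abs_self _).trans (hle s hs)

lemma rescale_indicator {α β T : ℝ} (hT : 0 < T) (f : ℝ → ℝ) :
    EqOn (rescale α β T ((Ici 0).indicator f)) (rescale α β T f) (Ici 0) := fun t ht => by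
  rw [rescale, rescale, indicator_of_mem (mem_Ici.2 (div_nonneg (mem_Ici.1 ht) hT.le))]

lemma Ingredients.pairN_rescale_indicator {Ω : Type*} (S : Ingredients Ω) {α β T : ℝ} (hT : 0 < T)
    (f : ℝ → ℝ) :
    S.pairN (rescale α β T ((Ici 0).indicator f)) = S.pairN (rescale α β T f) :=
  funext fun _ => setIntegral_congr_fun measurableSet_Ici (rescale_indicator hT f)

lemma shift_indicator {α : ℝ} (f : ℝ → ℝ) {t : ℝ} (ht : 0 ≤ t) :
    EqOn (fun s => (Ici 0).indicator f (t + s) * s ^ (α - 1)) (fun s => f (t + s) * s ^ (α - 1))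
      (Ioi 0) := fun s (hs : 0 < s) => by
  dsimp only
  rw [indicator_of_mem (mem_Ici.2 (by linarith))]

lemma potential_indicator {α : ℝ} (f : ℝ → ℝ) {t : ℝ} (ht : 0 ≤ t) :
    potential α ((Ici 0).indicator f) t = potential α f t :=
  setIntegral_congr_fun measurableSet_Ioi (shift_indicator f ht)

lemma limitConst_eq {α β : ℝ} (hα : 0 < α) (hα1 : α < 1) (hβ : 0 < β) {cφ : ℝ} (hcφ : 0 < cφ)
    (cν : ℝ) :
    Real.Gamma (1 - β) / β * cν * (cAlpha α cφ * α) ^ (2 + β) / α = limitConst α β cφ cν := by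
  have hc : 0 ≤ cAlpha α cφ := by
    have h1 := Real.Gamma_pos_of_pos (show 0 < 1 + α by linarith)
    have h2 := Real.Gamma_pos_of_pos (show 0 < 1 - α by linarith)
    unfold cAlpha
    positivity
  rw [limitConst, Real.mul_rpow hc hα.le]
  have h : α ^ (2 + β) = α ^ (1 + β) * α := by
    rw [← Real.rpow_add_one hα.ne']
    ring_nf
  rw [h]
  field_simp

end MarkedHawkes

end

theorem proposition4p1 {Ω : Type*} [MeasurableSpace Ω] (P : Measure Ω) [IsProbabilityMeasure P]
    (μ : ℝ) (hμ : 0 < μ)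
    (α β cφ cν : ℝ) (hα : 0 < α) (hαβ : α < β) (hβ : β < 1) (hcφ : 0 < cφ) (hcν : 0 < cν)
    -- the kernel: a probability density on the positive half-line with a heavy tail
    (φ : ℝ → ℝ) (hφ_meas : Measurable φ) (hφ_nonneg : ∀ t, 0 ≤ φ t)
    (hφ_neg : ∀ t, t < 0 → φ t = 0) (hφ_int : ∫ t in Ioi 0, φ t = 1)
    (hφ_tail : Tendsto (fun t : ℝ => t ^ α * ∫ s in Ioi t, φ s) atTop (𝓝 cφ))
    -- the mark distribution: mean one and a heavy tail
    (ν : Measure ℝ≥0) [IsProbabilityMeasure ν] (hν_mean : ∫⁻ x, (x : ℝ≥0∞) ∂ν = 1)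
    (hν_tail : Tendsto (fun x : ℝ => x ^ (1 + β) * ν.real {z : ℝ≥0 | x < (z : ℝ)}) atTop (𝓝 cν))
    -- the marked Hawkes process
    (S : MarkedHawkes.Ingredients Ω) (hS : MarkedHawkes.IsBranchingSystem P S μ φ ν)
    -- the test function
    (γ : ℝ) (hγ : (2 + β) / (1 + β) * (1 + α) < γ)
    (f : ℝ → ℝ) (hf : MarkedHawkes.IsTestFunction γ f) :
    -- all quantities are well defined and finite
    (∀ T : ℝ, 1 ≤ T →
      (∀ᵐ ω ∂P, IntegrableOn (MarkedHawkes.rescale α β T f) (Ici 0) (S.N ω)) ∧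
      Integrable (S.pairN (MarkedHawkes.rescale α β T f)) P ∧
      Integrable (fun ω => Real.exp (-MarkedHawkes.pairX P S α β T f ω)) P) ∧
    (∀ t : ℝ, 0 ≤ t → IntegrableOn (fun s => f (t + s) * s ^ (α - 1)) (Ioi 0)) ∧
    IntegrableOn (fun t => MarkedHawkes.potential α f t ^ (1 + β) * t ^ α) (Ioi 0) ∧
    -- convergence of the Laplace transforms
    Tendsto (fun T : ℝ => ∫ ω, Real.exp (-MarkedHawkes.pairX P S α β T f ω) ∂P) atTop
      (𝓝 (Real.exp (μ * MarkedHawkes.limitConst α β cφ cν *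
        ∫ t in Ioi 0, MarkedHawkes.potential α f t ^ (1 + β) * t ^ α))) := by
  have hα1 : α < 1 := hαβ.trans hβ
  have hβ0 : 0 < β := hα.trans hαβ
  -- The hypothesis on `γ` in the form used throughout; multiplied out it reads `γ * (1 + β) > (2 +
  -- β) * (1 + α)`.
  have hγ2 : 1 + α < (γ - (1 + α)) * (1 + β) := by
    have h1 : (2 + β) / (1 + β) * (1 + α) * (1 + β) < γ * (1 + β) := by gcongr
    have h2 : (2 + β) / (1 + β) * (1 + α) * (1 + β) = (2 + β) * (1 + α) := by field_simp
    nlinarith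
  have hγ1 : 1 + α < γ := by nlinarith
  have := MarkedHawkes.isProbabilityMeasure_displacementLaw hφ_nonneg hφ_neg hφ_int
  have hκ := MarkedHawkes.ae_nonneg_displacementLaw hφ_neg
  have hR := MarkedHawkes.regularLaplace_renewalMeasure hκ hα hα1 hcφ
    (by simpa only [MarkedHawkes.displacementLaw_real hφ_meas hφ_nonneg measurableSet_Ioi] using
      hφ_tail)
  obtain ⟨C, hf₀⟩ := hf.isDecaying_indicator
  set f₀ := (Ici (0 : ℝ)).indicator f with hf₀_def
  -- From here on `f₀` replaces `f`: it has the same pairings with `N` and the same potential at `t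
  -- ≥ 0`.
  have hint : ∀ {T : ℝ}, 1 ≤ T → _ := fun {T} hT =>
    hf₀.lintegral_shiftOp_erescale_ne_top (β := β) hκ hR hα hγ1 hT
  have hpairN : ∀ {T : ℝ}, 1 ≤ T →
      S.pairN (MarkedHawkes.rescale α β T f₀) = S.pairN (MarkedHawkes.rescale α β T f) :=
    fun hT => S.pairN_rescale_indicator (by linarith) f
  have hneg : ∀ {T : ℝ}, 1 ≤ T → ∀ t, t < 0 → MarkedHawkes.rescale α β T f₀ t = 0 :=
    fun hT t ht => hf₀.rescale_eq_zero (by linarith) ht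
  have hnonneg : ∀ {T : ℝ}, 1 ≤ T → ∀ t, 0 ≤ MarkedHawkes.rescale α β T f₀ t :=
    fun hT t => hf₀.rescale_nonneg (by linarith) t
  have hpot : EqOn (fun t => MarkedHawkes.potential α f₀ t ^ (1 + β) * t ^ α)
      (fun t => MarkedHawkes.potential α f t ^ (1 + β) * t ^ α) (Ioi 0) :=
    fun t (ht : 0 < t) => by
      dsimp only
      rw [hf₀_def, MarkedHawkes.potential_indicator f ht.le]
  refine ⟨fun T hT => ⟨?_, ?_, ?_⟩, fun t ht => ?_, ?_, ?_⟩
  · filter_upwards [hS.ae_integrableOn_N hν_mean (hf₀.measurable_rescale T) (hnonneg hT) (hneg hT)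
      (hint hT)] with ω hω
    exact hω.congr_fun (MarkedHawkes.rescale_indicator (by linarith) f) measurableSet_Ici
  · rw [← hpairN hT]
    exact hS.integrable_pairN hν_mean (hf₀.measurable_rescale T) (hnonneg hT) (hneg hT) (hint hT)
  · simp_rw [MarkedHawkes.pairX, ← hpairN hT, neg_sub, sub_eq_add_neg, Real.exp_add]
    exact (hS.integrable_exp_neg_pairN hν_mean (hf₀.measurable_rescale T) (hnonneg hT) (hneg hT)
      (hint hT)).const_mul _
  · exact (hf₀.scalingLimit_shift hR hα hγ1 ht).integrableOn.congr_fun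
      (MarkedHawkes.shift_indicator f ht) measurableSet_Ioi
  · exact (hf₀.integrableOn_potential_rpow_mul hα (by linarith) hγ1.le hγ2).congr_fun hpot
      measurableSet_Ioi
  · have h := hf₀.tendsto_lintegral_remainder hR hα hαβ hβ hγ2 hν_mean
      (MarkedHawkes.exists_markExponent_le hν_mean hβ0 hβ hν_tail)
      (MarkedHawkes.tendsto_markExponent hβ0 hβ hν_tail)
    rw [MarkedHawkes.one_div_div_Gamma_eq hα, MarkedHawkes.limitConst_eq hα hα1 hβ0 hcφ,
      setIntegral_congr_fun measurableSet_Ioi hpot] at h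
    rw [mul_assoc]
    refine ((Real.continuous_exp.tendsto _).comp (h.const_mul μ)).congr' ?_
    filter_upwards [eventually_ge_atTop 1] with T hT
    simp_rw [MarkedHawkes.pairX, ← hpairN hT]
    exact (hS.integral_exp_neg_pairN hν_mean (hf₀.measurable_rescale T) (hnonneg hT) (hneg hT)
      (hint hT) hκ hμ.le).symm
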